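/- For a finite simple graph $G=(V,E)$ let $\mathrm{MaxCut}(G)$ be the maximum, over all two-colourings of $V$, of the number of edges with differently coloured ends (the colourings attaining it are the optimal cuts). With $X_u, Z_u$ the Pauli operators acting on qubit $u\in V$, let $H_m=\sum_{u\in V}X_u$ and $H_p=\sum_{(u,v)\in E}Z_uZ_v$; let $\mathfrak g_G$ be the real Lie algebra, under the commutator, generated by $\mathrm i H_m$ and $\mathrm i H_p$ (the dynamical Lie algebra, DLA, of $G$), and let $\mathfrak g_{G,\mathrm{ma}}$ be the real Lie algebra generated by all $\mathrm i X_u$ $(u\in V)$ and all $\mathrm i Z_uZ_v$ $((u,v)\in E)$. The DLA of $G$ is free if $\mathfrak g_G=\mathfrak g_{G,\mathrm{ma}}$. An odd graph is a connected graph with at least $3$ vertices, all of odd degree. An asymmetric subdivision of a graph $H$ is obtained by replacing all edges of $H$, or all but one, by paths with at least one new inner vertex each, the numbers of new vertices on different replaced edges being pairwise different. An asymmetrically subdivided odd graph is an asymmetric subdivision of an odd graph. Theorem. There are a constant $c$ and three polynomial-time algorithms (on random access machines with unit-cost addition and subtraction; graphs are given by adjacency matrices and cuts by bit vectors) with the following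 properties. For every finite connected graph $G=(V,E)$, the first algorithm computes from $G$ an asymmetrically subdivided odd graph $G'=(V',E')$ with $|V'|,|E'|\le c\cdot\max(1,|E|^2)$, so $|V'|,|E'|\in O(|E|^2)$, such that 1. $\mathrm{MaxCut}(G')-\mathrm{MaxCut}(G)=|V'|-|V|$; the second algorithm computes an optimal cut of $G'$ from $G$ and any optimal cut of $G$, and the third computes an optimal cut of $G$ from $G$ and any optimal cut of $G'$; 2. the DLA of $G'$ is free: $\mathfrak g_{G'}=\mathfrak g_{G',\mathrm{ma}}$. -/

import Mathlib

namespace DLAMaxCut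

/-! ### Cuts -/

section Cuts

variable {V : Type*} [Fintype V]

open Classical in
/-- The size of the cut given by a two-colouring `C`: the number of edges whose two ends have
different colours. -/
noncomputable def cutSize (G : SimpleGraph V) (C : V → Bool) : ℕ :=
  (G.edgeFinset.filter fun e => ¬ (e.map C).IsDiag).card

open Classical in
/-- The maximum size of a cut of `G`. -/
noncomputable def maxCut (G : SimpleGraph V) : ℕ :=
  Finset.univ.sup fun C : V → Bool => cutSize G C

/-- `C` is an optimal solution of the MaxCut problem on `G`. -/
def IsOptimalCut (G : SimpleGraph V) (C : V → Bool) : Prop :=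
  cutSize G C = maxCut G

end Cuts

/-! ### Asymmetrically subdivided odd graphs -/

section Subdivision

/-- A connected graph with at least three vertices, all of odd degree. -/
structure IsOddGraph {V : Type*} [Fintype V] (G : SimpleGraph V) : Prop where
  connected : G.Connected
  three_le_card : 3 ≤ Fintype.card V
  odd_degree : ∀ v, Odd (G.neighborSet v).ncard

variable {W : Type*}

/-- The vertices `u = 0, w¹ = 1, …, w^ℓ = ℓ, v = ℓ + 1` of the path that replaces the edge
`e = uv`, where `u = src e`, `v = tgt e`, `ℓ = len e`. The vertices of the subdivision are the old
vertices together with `len e` new ones for every edge `e`. -/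
def pathVertex {H : SimpleGraph W} (src tgt : H.edgeSet → W) (len : H.edgeSet → ℕ)
    (e : H.edgeSet) : ℕ → W ⊕ (Σ e : H.edgeSet, Fin (len e))
  | 0 => Sum.inl (src e)
  | j + 1 => if h : j < len e then Sum.inr ⟨e, ⟨j, h⟩⟩ else Sum.inl (tgt e)

/-- The subdivision of `H` in which every edge `e` is replaced by a path with `len e` new inner
vertices; `len e = 0` means that the edge `e` is kept. -/
def subdivide (H : SimpleGraph W) (src tgt : H.edgeSet → W) (len : H.edgeSet → ℕ) :
    SimpleGraph (W ⊕ (Σ e : H.edgeSet, Fin (len e))) :=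
  SimpleGraph.fromEdgeSet {a | ∃ e : H.edgeSet, ∃ i ≤ len e,
    a = s(pathVertex src tgt len e i, pathVertex src tgt len e (i + 1))}

/-- `G` is (up to isomorphism) an asymmetric subdivision of `H`: at most one edge of `H` is not
subdivided, and the other edges receive pairwise different numbers of new vertices. -/
def IsAsymmetricSubdivision {V : Type*} (H : SimpleGraph W) (G : SimpleGraph V) : Prop :=
  ∃ (src tgt : H.edgeSet → W) (len : H.edgeSet → ℕ),
    (∀ e, s(src e, tgt e) = e.1) ∧
    {e | len e = 0}.Subsingleton ∧
    Set.InjOn len {e | 1 ≤ len e} ∧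
    Nonempty (G ≃g subdivide H src tgt len)

/-- `G` is an asymmetric subdivision of an odd graph. -/
def IsAsymmetricallySubdividedOddGraph {V : Type*} (G : SimpleGraph V) : Prop :=
  ∃ (k : ℕ) (H : SimpleGraph (Fin k)), IsOddGraph H ∧ IsAsymmetricSubdivision H G

end Subdivision

/-! ### Dynamical Lie algebras of QAOA-MaxCut -/

section DLA

variable {V : Type*} [Fintype V] [DecidableEq V]

/-- Operators on the qubits labelled by `V`, as matrices in the computational basis. -/
abbrev Operator (V : Type*) := Matrix (V → Fin 2) (V → Fin 2) ℂ

/-- The tensor product over `u : V` of the one-qubit operators `P u`. -/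
def tensor (P : V → Matrix (Fin 2) (Fin 2) ℂ) : Operator V :=
  Matrix.of fun x y => ∏ u, P u (x u) (y u)

/-- The Pauli matrix `X`. -/
def pauliX : Matrix (Fin 2) (Fin 2) ℂ := !![0, 1; 1, 0]

/-- The Pauli matrix `Z`. -/
def pauliZ : Matrix (Fin 2) (Fin 2) ℂ := !![1, 0; 0, -1]

/-- `X` acting on the qubit `u`. -/
def opX (u : V) : Operator V := tensor fun w => if w = u then pauliX else 1

/-- `Z` acting on the qubit `u`. -/
def opZ (u : V) : Operator V := tensor fun w => if w = u then pauliZ else 1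

theorem opZ_eq_diagonal (u : V) :
    opZ u = Matrix.diagonal fun x : V → Fin 2 => pauliZ (x u) (x u) := by
  ext x y
  by_cases hxy : x = y
  · subst hxy
    rw [Matrix.diagonal_apply_eq]
    simp only [opZ, tensor, Matrix.of_apply]
    rw [Finset.prod_eq_single u]
    · simp
    · intro w _ hw
      simp [hw]
    · simp
  · rw [Matrix.diagonal_apply_ne _ hxy]
    obtain ⟨w, hw⟩ := Function.ne_iff.mp hxy
    simp only [opZ, tensor, Matrix.of_apply]
    refine Finset.prod_eq_zero (Finset.mem_univ w) ?_
    by_cases hwu : w = u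
    · simp only [hwu, if_true]
      rw [hwu] at hw
      generalize x u = a at hw ⊢
      generalize y u = b at hw ⊢
      fin_cases a <;> fin_cases b <;> simp_all [pauliZ]
    · simp [hwu, Matrix.one_apply_ne hw]

theorem opZ_mul_comm (u v : V) : opZ u * opZ v = opZ v * opZ u := by
  simp only [opZ_eq_diagonal, Matrix.diagonal_mul_diagonal, mul_comm]

/-- `Z_u Z_v` for the unordered pair `e = {u, v}`. -/
def opZZ (e : Sym2 V) : Operator V :=
  Sym2.lift ⟨fun u v => opZ u * opZ v, opZ_mul_comm⟩ e

open Classical in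
/-- The problem Hamiltonian `H_p`, the sum of `Z_u Z_v` over the edges `uv`. -/
noncomputable def problemHamiltonian (G : SimpleGraph V) : Operator V :=
  ∑ e ∈ G.edgeFinset, opZZ e

/-- The mixer Hamiltonian `H_m`, the sum of all `X_u`. -/
def mixerHamiltonian (V : Type*) [Fintype V] [DecidableEq V] : Operator V :=
  ∑ u : V, opX u

attribute [local instance] LieRing.ofAssociativeRing

/-- The standard dynamical Lie algebra: the real Lie algebra (under the commutator) generated by
`i H_p` and `i H_m`. -/
noncomputable def dla (G : SimpleGraph V) : LieSubalgebra ℝ (Operator V) :=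
  LieSubalgebra.lieSpan ℝ (Operator V)
    {Complex.I • problemHamiltonian G, Complex.I • mixerHamiltonian V}

/-- The multi-angle dynamical Lie algebra: the real Lie algebra generated by all `i X_u` and by
`i Z_u Z_v` for all edges `uv`. -/
noncomputable def dlaMultiAngle (G : SimpleGraph V) : LieSubalgebra ℝ (Operator V) :=
  LieSubalgebra.lieSpan ℝ (Operator V)
    (Set.range (fun u : V => Complex.I • opX u) ∪ (fun e => Complex.I • opZZ e) '' G.edgeSet)

/-- The dynamical Lie algebra of `G` is free. -/
def IsFreeDLA (G : SimpleGraph V) : Prop :=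
  dla G = dlaMultiAngle G

end DLA

/-! ### Random access machines and their running time

A structured random access machine with registers and arrays holding natural numbers. A program
mentions only finitely many registers and arrays by name; array cells are addressed indirectly.
Each instruction and each test costs one step. The only arithmetic is addition and truncated
subtraction, so after `t` steps all numbers have `O(t)` bits more than at the start, and polynomial
time on this machine is polynomial time on a Turing machine. -/

section Machine

/-- The state of a machine: registers, and arrays indexed by name and address. -/
structure RamState where
  reg : ℕ → ℕ
  arr : ℕ → ℕ → ℕ

/-- Elementary instructions. -/
inductive Instr where
  /-- `r := k` -/
  | const (r k : ℕ)
  /-- `r := s + t` -/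
  | add (r s t : ℕ)
  /-- `r := s - t` (truncated) -/
  | sub (r s t : ℕ)
  /-- `r := a[s]` -/
  | load (r a s : ℕ)
  /-- `a[s] := r` -/
  | store (a s r : ℕ)

/-- The effect of an elementary instruction. -/
def Instr.exec : Instr → RamState → RamState
  | .const r k, σ => { σ with reg := Function.update σ.reg r k }
  | .add r s t, σ => { σ with reg := Function.update σ.reg r (σ.reg s + σ.reg t) }
  | .sub r s t, σ => { σ with reg := Function.update σ.reg r (σ.reg s - σ.reg t) }
  | .load r a s, σ => { σ with reg := Function.update σ.reg r (σ.arr a (σ.reg s)) }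
  | .store a s r, σ =>
    { σ with arr := Function.update σ.arr a (Function.update (σ.arr a) (σ.reg s) (σ.reg r)) }

/-- Programs. -/
inductive Program where
  /-- an elementary instruction -/
  | instr (c : Instr)
  /-- do nothing -/
  | skip
  /-- first `p`, then `q` -/
  | seq (p q : Program)
  /-- if register `r` is nonzero then `p` else `q` -/
  | ite (r : ℕ) (p q : Program)
  /-- while register `r` is nonzero do `p` -/
  | loop (r : ℕ) (p : Program)

/-- `Run p σ τ t`: started in the state `σ`, the program `p` halts in the state `τ` after exactly
`t` steps. -/
inductive Run : Program → RamState → RamState → ℕ → Prop where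
  | instr (c : Instr) (σ : RamState) : Run (.instr c) σ (c.exec σ) 1
  | skip (σ : RamState) : Run .skip σ σ 1
  | seq {p q : Program} {σ τ υ : RamState} {t₁ t₂ : ℕ} :
      Run p σ τ t₁ → Run q τ υ t₂ → Run (.seq p q) σ υ (t₁ + t₂)
  | ite_true {r : ℕ} {p q : Program} {σ τ : RamState} {t : ℕ} :
      σ.reg r ≠ 0 → Run p σ τ t → Run (.ite r p q) σ τ (t + 1)
  | ite_false {r : ℕ} {p q : Program} {σ τ : RamState} {t : ℕ} :
      σ.reg r = 0 → Run q σ τ t → Run (.ite r p q) σ τ (t + 1)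
  | loop_done {r : ℕ} {p : Program} {σ : RamState} :
      σ.reg r = 0 → Run (.loop r p) σ σ 1
  | loop_step {r : ℕ} {p : Program} {σ τ υ : RamState} {t₁ t₂ : ℕ} :
      σ.reg r ≠ 0 → Run p σ τ t₁ → Run (.loop r p) τ υ t₂ →
      Run (.loop r p) σ υ (t₁ + t₂ + 1)

/-- The initial state on the input word `x`: register `0` holds the length of `x`, array `0` holds
the bits of `x`, and everything else is zero. -/
def inputState (x : List Bool) : RamState where
  reg r := if r = 0 then x.length else 0
  arr a i := if a = 0 then (x.getD i false).toNat else 0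

/-- The state `τ` shows the output word `y`: register `0` holds the length of `y`, and array `1`
holds the bits of `y`. -/
def ShowsOutput (τ : RamState) (y : List Bool) : Prop :=
  τ.reg 0 = y.length ∧ ∀ i < y.length, τ.arr 1 i = (y.getD i false).toNat

/-- On the input word `x`, the program `p` outputs the word `y` after at most `t` steps. -/
def OutputsWithin (p : Program) (x y : List Bool) (t : ℕ) : Prop :=
  ∃ (τ : RamState) (s : ℕ), s ≤ t ∧ Run p (inputState x) τ s ∧ ShowsOutput τ y

end Machine

/-! ### Encodings -/

section Encoding

open Classical in
/-- A graph on `{0, …, n - 1}` as a word: `n` in unary, a separator, and the adjacency matrix in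
row-major order. -/
noncomputable def encodeGraph {n : ℕ} (G : SimpleGraph (Fin n)) : List Bool :=
  List.replicate n true ++ false ::
    List.ofFn fun k : Fin (n * n) => decide (G.Adj k.divNat k.modNat)

/-- A two-colouring of `{0, …, n - 1}` as a word of length `n`. -/
def encodeCut {n : ℕ} (C : Fin n → Bool) : List Bool :=
  List.ofFn C

end Encoding

end DLAMaxCut

/-! Give every vertex of $G$ of degree $d$ exactly $d+3$ new leaves. Its degree becomes $2d+3$ and
leaves have degree $1$, so the result is an odd graph. Number its $K = 3|E|+3|V|$ edges by $t < K$
and replace edge $t$ by a path with $2t+2$ inner vertices. This is `reducedGraph`.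

Cuts. A path with $2t+3$ edges has at most $2t+2$ colour changes if its ends have equal colours and
at most $2t+3$ otherwise, and colours alternating from one end attain the bound. Hence the paths add
$\sum_t (2t+2) = K(K+1)$ to the maximum cut, which is the number of inner vertices, and each leaf
adds one more cut edge. The increase is thus the number of new vertices. Restricting colourings in
one direction, and extending them alternatingly in the other, preserves optimality
(`cutSize_reducedGraph_le`, `cutSize_of_isAlternating`, `optimalCut_correspondence`).

Freeness. Let $L$ be a Lie algebra containing the two generators. Consider the vertex sets $S$ with
$\mathrm i\sum_{u\in S} X_u \in L$ and the edge sets $F$ with $\mathrm i\sum_{uv\in F} Z_uZ_v \in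
L$. Two filters act on them: from $S$ and $F$ one gets the vertices of $S$ on an odd number of edges
of $F$ (`xSum_odd`), and the edges of $F$ with exactly one end in $S$ (`zSum_xor`). With
differences, this leaves a combinatorial task: to reach all singletons (`PathSystem.singletons`).
Odd degrees separate old vertices from inner ones, which have degree two. Peeling the paths from
their ends sorts inner vertices and edges by their distance from the ends. As the lengths differ,
the peeling reaches the middle of each path at a different time, which isolates that middle; from
there one works outwards to the two end edges of the path. These give the pair of ends of each edge
of the odd graph; two leaf edges at a common vertex break up the pair, and a walk along each path
isolates the rest.

Algorithms. Explicit programs are verified with loop invariants. The vertices of $G$ keep their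
numbers and the inner vertices are numbered in the order of the paths, so that extending a cut is
sequential writing and restricting it is copying a prefix. -/

namespace DLAMaxCut

/-! ### Parity filters in Lie algebras of operators -/

section ParityFilters

set_option linter.unusedSectionVars false

variable {V : Type*} [Fintype V] [DecidableEq V]

attribute [local instance] LieRing.ofAssociativeRing

theorem tensor_mul (P Q : V → Matrix (Fin 2) (Fin 2) ℂ) :
    tensor P * tensor Q = tensor fun u => P u * Q u := by
  ext x y
  simp only [tensor, Matrix.mul_apply, Matrix.of_apply, Finset.prod_univ_sum,
    Fintype.piFinset_univ, Finset.prod_mul_distrib]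

theorem tensor_one : tensor (fun _ : V => (1 : Matrix (Fin 2) (Fin 2) ℂ)) = 1 := by
  ext x y
  by_cases h : x = y
  · subst h; simp [tensor]
  · obtain ⟨w, hw⟩ := Function.ne_iff.mp h
    rw [Matrix.one_apply_ne h]
    exact Finset.prod_eq_zero (Finset.mem_univ w) (Matrix.one_apply_ne hw)

theorem opX_mul_self (u : V) : opX u * opX u = 1 := by
  rw [opX, tensor_mul, ← tensor_one]
  congr 1
  funext w
  by_cases h : w = u
  · simp [h, pauliX, Matrix.one_fin_two]
  · simp [h]

theorem opX_commute (u v : V) : Commute (opX u) (opX v) := by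
  rw [Commute, SemiconjBy, opX, opX, tensor_mul, tensor_mul]
  congr 1
  funext w
  by_cases h : w = u <;> by_cases h' : w = v <;> simp [h, h']

theorem opX_apply (u : V) (x y : V → Fin 2) [Decidable (x u ≠ y u ∧ ∀ w, w ≠ u → x w = y w)] :
    opX u x y = if x u ≠ y u ∧ ∀ w, w ≠ u → x w = y w then 1 else 0 := by
  simp only [opX, tensor, Matrix.of_apply]
  split_ifs with h
  · refine Finset.prod_eq_one fun w _ => ?_
    by_cases hw : w = u
    · subst hw
      have h1 := h.1
      generalize x w = a at h1 ⊢
      generalize y w = b at h1 ⊢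
      fin_cases a <;> fin_cases b <;> simp_all [pauliX]
    · simp only [hw, if_false, h.2 w hw, Matrix.one_apply_eq]
  · by_cases hu : x u = y u
    · refine Finset.prod_eq_zero (Finset.mem_univ u) ?_
      generalize x u = a at hu ⊢
      subst hu
      generalize y u = b
      fin_cases b <;> simp [pauliX]
    · simp only [ne_eq, hu, not_false_eq_true, true_and, not_forall] at h
      obtain ⟨w, hw, hxy⟩ := h
      refine Finset.prod_eq_zero (Finset.mem_univ w) ?_
      simp [hw, Matrix.one_apply_ne hxy]

/-- The eigenvalue of `Z` on a computational basis state. -/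
def spin (a : Fin 2) : ℤ := if a = 0 then 1 else -1

theorem pauliZ_apply_self (a : Fin 2) : pauliZ a a = (spin a : ℂ) := by
  fin_cases a <;> simp [pauliZ, spin]

theorem spin_of_ne {a b : Fin 2} (h : a ≠ b) : spin b = -spin a := by
  fin_cases a <;> fin_cases b <;> simp_all [spin]

theorem spin_cast_zmod (a : Fin 2) : ((spin a : ℤ) : ZMod 2) = 1 := by
  fin_cases a <;> simp [spin]

theorem opX_mul_opZ_of_ne {u v : V} (h : u ≠ v) : opZ v * opX u = opX u * opZ v := by
  classical
  rw [opZ_eq_diagonal]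
  ext x y
  rw [Matrix.diagonal_mul, Matrix.mul_diagonal, opX_apply]
  split_ifs with hxy
  · rw [hxy.2 v h.symm]; ring
  · simp

theorem opX_mul_opZ_self (u : V) : opZ u * opX u = -(opX u * opZ u) := by
  classical
  rw [opZ_eq_diagonal]
  ext x y
  rw [Matrix.neg_apply, Matrix.diagonal_mul, Matrix.mul_diagonal, opX_apply]
  split_ifs with hxy
  · rw [pauliZ_apply_self, pauliZ_apply_self, spin_of_ne hxy.1]; simp
  · simp

theorem opZ_mul_opZ (u v : V) : opZ u * opZ v =
    Matrix.diagonal fun x : V → Fin 2 => ((spin (x u) * spin (x v) : ℤ) : ℂ) := by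
  simp only [opZ_eq_diagonal, Matrix.diagonal_mul_diagonal, pauliZ_apply_self, Int.cast_mul]

/-- A Lie algebra that contains `i` times a real diagonal matrix is closed under multiplying the
entries by a function of the squared differences of the diagonal entries. -/
theorem mul_sq_sub_mem {ι : Type*} [Fintype ι] [DecidableEq ι]
    {L : LieSubalgebra ℝ (Matrix ι ι ℂ)} {b : ι → ℝ}
    (hb : Complex.I • Matrix.diagonal (fun x => (b x : ℂ)) ∈ L) {M : Matrix ι ι ℂ} (hM : M ∈ L)
    (g : ℝ → ℝ) :
    Matrix.of (fun x y => ((g ((b x - b y) ^ 2) : ℝ) : ℂ) * M x y) ∈ L := by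
  classical
  have hpow : ∀ k : ℕ,
      Matrix.of (fun x y => ((((b x - b y) ^ 2) ^ k : ℝ) : ℂ) * M x y) ∈ L := by
    intro k
    induction k with
    | zero =>
      convert hM using 2
      ext x y
      simp
    | succ k ih =>
      -- One commutator with $\mathrm i\,\mathrm{diag}(b)$ multiplies the entry $(x,y)$ by $\mathrm
      -- i(b_x-b_y)$. Two of them give a real factor, the negative of the wanted one.
      have h := neg_mem (L.lie_mem hb (L.lie_mem hb ih))
      convert h using 2
      ext x y
      simp only [Ring.lie_def, Matrix.neg_apply, Matrix.sub_apply, smul_mul_assoc,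
        mul_smul_comm, Matrix.smul_apply, Matrix.diagonal_mul, Matrix.mul_diagonal,
        Matrix.of_apply, smul_eq_mul, mul_sub, sub_mul]
      push_cast
      linear_combination (norm := ring_nf)
        (-(((b x : ℂ) - b y) ^ 2) ^ (k + 1) * M x y) * Complex.I_sq
      simp only [Complex.I_sq]
      ring
  have hpoly : ∀ p : Polynomial ℝ,
      Matrix.of (fun x y => ((p.eval ((b x - b y) ^ 2) : ℝ) : ℂ) * M x y) ∈ L := by
    intro p
    induction p using Polynomial.induction_on' with
    | add p q hp hq =>
      convert L.add_mem hp hq using 2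
      ext x y
      simp [add_mul]
    | monomial k a =>
      convert L.smul_mem a (hpow k) using 2
      ext x y
      simp [mul_assoc]
  -- Only finitely many squared differences occur, so a polynomial interpolating `g` at them does
  -- the same as `g`.
  let s : Finset ℝ := Finset.univ.image fun xy : ι × ι => (b xy.1 - b xy.2) ^ 2
  convert hpoly (Lagrange.interpolate s id g) using 7 with x y
  have hs : (b x - b y) ^ 2 ∈ s :=
    Finset.mem_image.mpr ⟨(x, y), Finset.mem_univ _, rfl⟩
  exact (Lagrange.eval_interpolate_at_node (v := id) g Function.injective_id.injOn hs).symm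

variable {ι : Type*} [Fintype ι]

open Classical in
/-- `i` times the sum of `X_u` over the vertices in `S`. -/
noncomputable def xSum (S : Set V) : Operator V :=
  ∑ u with u ∈ S, Complex.I • opX u

open Classical in
/-- `i` times the sum of `Z_u Z_v` over the edges in `F`, with ends `u` and `v` given by `p`
and `q`. -/
noncomputable def zSum (p q : ι → V) (F : Set ι) : Operator V :=
  ∑ a with a ∈ F, Complex.I • (opZ (p a) * opZ (q a))

variable {L : LieSubalgebra ℝ (Operator V)} {p q : ι → V}

theorem xSum_diff {S S' : Set V} (hS : xSum S ∈ L) (hS' : xSum S' ∈ L) (h : S' ⊆ S) :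
    xSum (S \ S') ∈ L := by
  classical
  have : xSum (S \ S') = xSum S - xSum S' := by
    rw [eq_sub_iff_add_eq, xSum, xSum, xSum, ← Finset.sum_union]
    · congr 1
      ext u
      simp only [Finset.mem_union, Finset.mem_filter, Finset.mem_univ, true_and, Set.mem_sdiff]
      have := @h u
      tauto
    · simp only [Finset.disjoint_left, Finset.mem_filter, Set.mem_sdiff]
      tauto
  rw [this]
  exact L.sub_mem hS hS'

theorem zSum_diff {F F' : Set ι} (hF : zSum p q F ∈ L) (hF' : zSum p q F' ∈ L) (h : F' ⊆ F) :
    zSum p q (F \ F') ∈ L := by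
  classical
  have : zSum p q (F \ F') = zSum p q F - zSum p q F' := by
    rw [eq_sub_iff_add_eq, zSum, zSum, zSum, ← Finset.sum_union]
    · congr 1
      ext u
      simp only [Finset.mem_union, Finset.mem_filter, Finset.mem_univ, true_and, Set.mem_sdiff]
      have := @h u
      tauto
    · simp only [Finset.disjoint_left, Finset.mem_filter, Set.mem_sdiff]
      tauto
  rw [this]
  exact L.sub_mem hF hF'

/-- Flipping the qubit `u` changes the energy of the edges in `F` by twice a number of the
same parity as the number of edges in `F` at `u`. -/
theorem exists_half_energy_diff (hpq : ∀ a, p a ≠ q a) (F : Finset ι) {u : V} {x y : V → Fin 2}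
    (hu : x u ≠ y u) (hxy : ∀ w, w ≠ u → x w = y w) :
    ∃ k : ℤ, (∑ a ∈ F, spin (x (p a)) * spin (x (q a))) -
      (∑ a ∈ F, spin (y (p a)) * spin (y (q a))) = 2 * k ∧
      (Odd k ↔ Odd {a | a ∈ F ∧ (p a = u ∨ q a = u)}.ncard) := by
  classical
  -- Only the terms of the edges at `u` change, each by reversing its sign. Each summand of $k$ is
  -- then $\pm1$ for an edge at `u`, which fixes the parity.
  refine ⟨∑ a ∈ F, if p a = u ∨ q a = u then spin (x (p a)) * spin (x (q a)) else 0, ?_, ?_⟩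
  · rw [← Finset.sum_sub_distrib, Finset.mul_sum]
    refine Finset.sum_congr rfl fun a _ => ?_
    split_ifs with h
    · rcases h with h | h
      · have h' : q a ≠ u := fun h' => hpq a (h.trans h'.symm)
        rw [h, ← hxy _ h', spin_of_ne hu]; ring
      · have h' : p a ≠ u := fun h' => hpq a (h'.trans h.symm)
        rw [h, ← hxy _ h', spin_of_ne hu]; ring
    · push Not at h
      rw [hxy _ h.1, hxy _ h.2]; ring
  · have hset : {a | a ∈ F ∧ (p a = u ∨ q a = u)} = ↑(F.filter fun a => p a = u ∨ q a = u) := by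
      ext a; simp
    rw [hset, Set.ncard_coe_finset, ← ZMod.natCast_eq_one_iff_odd, ← ZMod.intCast_eq_one_iff_odd,
      Int.cast_sum, Finset.card_filter, Nat.cast_sum]
    refine Eq.congr_left (Finset.sum_congr rfl fun a _ => ?_)
    split_ifs <;> simp [spin_cast_zmod]

/-- A nonzero entry of $X_u$ joins basis states that differ exactly in the qubit $u$. Their energies
on `F` differ by $2k$ with $k$ of the parity of the degree of $u$ in `F`. Hence `mul_sq_sub_mem` can
keep the odd $u$ and delete the others. -/
theorem xSum_odd (hpq : ∀ a, p a ≠ q a) {S : Set V} {F : Set ι} (hS : xSum S ∈ L)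
    (hF : zSum p q F ∈ L) :
    xSum {u | u ∈ S ∧ Odd {a | a ∈ F ∧ (p a = u ∨ q a = u)}.ncard} ∈ L := by
  classical
  let b : (V → Fin 2) → ℝ := fun x =>
    ((∑ a with a ∈ F, spin (x (p a)) * spin (x (q a)) : ℤ) : ℝ)
  have hb : Complex.I • Matrix.diagonal (fun x => (b x : ℂ)) ∈ L := by
    convert hF using 1
    rw [zSum, ← Finset.smul_sum]
    congr 1
    ext x y
    rw [Matrix.sum_apply]
    by_cases h : x = y
    · subst h
      simp [opZ_mul_opZ, b]
    · simp [opZ_mul_opZ, h]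
  -- The square loses the sign of $k$, but not its parity.
  let g : ℝ → ℝ := fun s => if ∃ k : ℤ, Odd k ∧ s = (2 * k) ^ 2 then 1 else 0
  convert mul_sq_sub_mem hb hS g using 1
  ext x y
  simp only [xSum, Matrix.of_apply, Matrix.sum_apply, Finset.mul_sum]
  rw [← Finset.sum_filter_add_sum_filter_not (Finset.univ.filter fun u => u ∈ S)
    (fun u => Odd {a | a ∈ F ∧ (p a = u ∨ q a = u)}.ncard)]
  have key : ∀ u, x u ≠ y u → (∀ w, w ≠ u → x w = y w) →
      (g ((b x - b y) ^ 2) =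
        if Odd {a | a ∈ F ∧ (p a = u ∨ q a = u)}.ncard then 1 else 0) := by
    intro u hu hxy
    obtain ⟨k, hk, hodd⟩ := exists_half_energy_diff hpq (Finset.univ.filter (· ∈ F)) hu hxy
    simp only [Finset.mem_filter, Finset.mem_univ, true_and] at hodd
    have hbk : b x - b y = 2 * (k : ℝ) := by
      simp only [b]
      exact_mod_cast hk
    rw [hbk]
    refine if_congr (Iff.trans ⟨?_, fun h => ⟨k, h, rfl⟩⟩ hodd) rfl rfl
    rintro ⟨k', hk', h⟩
    have h' : k ^ 2 = k' ^ 2 := by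
      have : (k : ℝ) ^ 2 = (k' : ℝ) ^ 2 := by linarith
      exact_mod_cast this
    rcases sq_eq_sq_iff_eq_or_eq_neg.mp h' with rfl | rfl
    · exact hk'
    · exact hk'.neg
  rw [← add_zero (Finset.sum _ _)]
  congr 1
  · rw [Finset.filter_filter]
    refine Finset.sum_congr (by ext u; simp) fun u hu => ?_
    simp only [Matrix.smul_apply, opX_apply]
    split_ifs with h
    · rw [key u h.1 h.2, if_pos (by simpa using (Finset.mem_filter.mp hu).2.2)]; simp
    · simp
  · refine (Finset.sum_eq_zero fun u hu => ?_).symm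
    simp only [Matrix.smul_apply, opX_apply]
    split_ifs with h
    · rw [key u h.1 h.2, if_neg (Finset.mem_filter.mp hu).2]; simp
    · simp

/-- Since `A` commutes with `c`, each commutator contributes a factor $2c$ on the left of $z$. -/
theorem lie_four_add_lie_two {R : Type*} [Ring R] {A c z : R} (hAz : ⁅A, z⁆ = c * z + c * z)
    (hAc : Commute A c) :
    ⁅A, ⁅A, ⁅A, ⁅A, z⁆⁆⁆⁆ + 16 * ⁅A, ⁅A, z⁆⁆ = 16 * (c ^ 4 * z) + 64 * (c ^ 2 * z) := by
  have h : ∀ k : ℕ, ⁅A, c ^ k * z⁆ = c ^ (k + 1) * z + c ^ (k + 1) * z := by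
    intro k
    have hk : A * c ^ k = c ^ k * A := hAc.pow_right k
    rw [Ring.lie_def] at hAz ⊢
    rw [← mul_assoc, hk, mul_assoc, mul_assoc, ← mul_sub, hAz, mul_add, ← mul_assoc, ← pow_succ]
  have h1 : ⁅A, z⁆ = c ^ 1 * z + c ^ 1 * z := by rw [pow_one]; exact hAz
  simp only [h1, lie_add, h]
  noncomm_ring

theorem opX_mul_edge {u v : V} (huv : u ≠ v) (w : V) :
    opZ u * opZ v * opX w = (if w = u ∨ w = v then -1 else 1) * (opX w * (opZ u * opZ v)) := by
  by_cases hu : w = u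
  · subst hu
    rw [if_pos (Or.inl rfl), mul_assoc, opX_mul_opZ_of_ne huv, ← mul_assoc, opX_mul_opZ_self]
    noncomm_ring
  · by_cases hv : w = v
    · subst hv
      rw [if_pos (Or.inr rfl), mul_assoc, opX_mul_opZ_self, mul_neg, ← mul_assoc,
        opX_mul_opZ_of_ne huv.symm]
      noncomm_ring
    · rw [if_neg (by tauto), mul_assoc, opX_mul_opZ_of_ne hv, ← mul_assoc, opX_mul_opZ_of_ne hu,
        one_mul, mul_assoc]

theorem xSum_commute (S S' : Set V) : Commute (xSum S) (xSum S') := by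
  classical
  refine Commute.sum_left _ _ _ fun u _ => Commute.sum_right _ _ _ fun v _ => ?_
  exact ((opX_commute u v).smul_right _).smul_left _

/-- $X_w$ anticommutes with $Z_uZ_v$ if $w$ is one of $u, v$ and commutes with it otherwise. -/
theorem lie_xSum_edge {u v : V} (huv : u ≠ v) (S : Set V) :
    ⁅xSum S, opZ u * opZ v⁆ =
      xSum (S ∩ {u, v}) * (opZ u * opZ v) + xSum (S ∩ {u, v}) * (opZ u * opZ v) := by
  classical
  have h : xSum (S ∩ {u, v}) = ∑ w with w ∈ S, if w = u ∨ w = v then Complex.I • opX w else 0 := by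
    rw [xSum, ← Finset.sum_filter, Finset.filter_filter]
    simp
  rw [Ring.lie_def, h, xSum, Finset.sum_mul, Finset.mul_sum, Finset.sum_mul,
    ← Finset.sum_sub_distrib, ← Finset.sum_add_distrib]
  refine Finset.sum_congr rfl fun w _ => ?_
  rw [mul_smul_comm, opX_mul_edge huv]
  split_ifs
  · simp
  · simp

/-- On $Z_uZ_v$ the square of the adjoint action has the eigenvalue $0$ if neither end is in `S`,
$-4$ if exactly one is, and $0$ and $-16$ if both are. The polynomial $s^2+16s$ vanishes at $0$ and
$-16$ and is $-48$ at $-4$. -/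
theorem lie_four_xSum_edge {u v : V} (huv : u ≠ v) (S : Set V) [Decidable (Xor (u ∈ S) (v ∈ S))] :
    ⁅xSum S, ⁅xSum S, ⁅xSum S, ⁅xSum S, opZ u * opZ v⁆⁆⁆⁆ +
      16 * ⁅xSum S, ⁅xSum S, opZ u * opZ v⁆⁆ =
      if Xor (u ∈ S) (v ∈ S) then (-48 : ℝ) • (opZ u * opZ v) else 0 := by
  classical
  rw [lie_four_add_lie_two (lie_xSum_edge huv S) (xSum_commute _ _)]
  have single : ∀ w, xSum {w} ^ 2 = (-1 : Operator V) := by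
    intro w
    have : xSum {w} = Complex.I • opX w := by simp [xSum, Finset.filter_eq']
    simp [this, pow_two, opX_mul_self, smul_smul]
  have conclude : ∀ w, S ∩ {u, v} = {w} →
      16 * (xSum (S ∩ {u, v}) ^ 4 * (opZ u * opZ v)) +
        64 * (xSum (S ∩ {u, v}) ^ 2 * (opZ u * opZ v)) = (-48 : ℝ) • (opZ u * opZ v) := by
    intro w hw
    rw [hw, show (4 : ℕ) = 2 * 2 from rfl, pow_mul, single, neg_smul, ofNat_smul_eq_nsmul]
    noncomm_ring
  by_cases hu : u ∈ S <;> by_cases hv : v ∈ S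
  · have hS : S ∩ {u, v} = {u, v} := by
      ext w; simp only [Set.mem_inter_iff, Set.mem_insert_iff, Set.mem_singleton_iff]
      constructor
      · exact fun h => h.2
      · rintro (rfl | rfl) <;> tauto
    have hx : xSum (S ∩ {u, v}) = xSum {u} + xSum {v} := by
      rw [hS, xSum, xSum, xSum, ← Finset.sum_union]
      · congr 1
        ext; simp
      · simp [Finset.disjoint_left, huv]
    -- With $P = (\mathrm iX_u)(\mathrm iX_v)$ and $P^2=1$, the square $c^2=-2+2P$ satisfies $c^4 =
    -- 8-8P = -4c^2$, so the two terms cancel.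
    have hsq : xSum (S ∩ {u, v}) ^ 2 =
        (-2 : ℤ) • 1 + (2 : ℤ) • (xSum {u} * xSum {v}) := by
      rw [hx, pow_two, add_mul, mul_add, mul_add, (xSum_commute {v} {u}).eq, ← pow_two, ← pow_two,
        single, single]
      abel
    have hprod : (xSum {u} * xSum {v}) * (xSum {u} * xSum {v}) = (1 : Operator V) := by
      rw [mul_assoc, ← mul_assoc (xSum {v}), (xSum_commute {v} {u}).eq, mul_assoc, ← pow_two,
        ← mul_assoc, ← pow_two, single, single]
      simp
    rw [if_neg (by simp [hu, hv, Xor]), show (4 : ℕ) = 2 * 2 from rfl, pow_mul, hsq]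
    generalize xSum {u} * xSum {v} = c at hprod
    have h4 : ((-2 : ℤ) • (1 : Operator V) + (2 : ℤ) • c) ^ 2 = (8 : ℤ) • 1 - (8 : ℤ) • c := by
      have : ((-2 : ℤ) • (1 : Operator V) + (2 : ℤ) • c) ^ 2 =
          (4 : ℤ) • 1 - (8 : ℤ) • c + (4 : ℤ) • (c * c) := by noncomm_ring
      rw [this, hprod]
      noncomm_ring
    rw [h4]
    noncomm_ring
  · rw [if_pos (by simp [hu, hv, Xor]), conclude u]
    ext w; simp only [Set.mem_inter_iff, Set.mem_insert_iff, Set.mem_singleton_iff]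
    constructor
    · rintro ⟨h, rfl | rfl⟩ <;> tauto
    · rintro rfl; tauto
  · rw [if_pos (by simp [hu, hv, Xor]), conclude v]
    ext w; simp only [Set.mem_inter_iff, Set.mem_insert_iff, Set.mem_singleton_iff]
    constructor
    · rintro ⟨h, rfl | rfl⟩ <;> tauto
    · rintro rfl; tauto
  · have hS : S ∩ {u, v} = ∅ := by
      ext w; simp only [Set.mem_inter_iff, Set.mem_insert_iff, Set.mem_singleton_iff,
        Set.mem_empty_iff_false, iff_false]
      rintro ⟨h, rfl | rfl⟩ <;> tauto
    rw [if_neg (by simp [hu, hv, Xor]), hS]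
    simp [xSum]

/-- `lie_four_xSum_edge` is summed over `F`; the scalar $-1/48$ normalises the surviving terms. -/
theorem zSum_xor (hpq : ∀ a, p a ≠ q a) {S : Set V} {F : Set ι} (hS : xSum S ∈ L)
    (hF : zSum p q F ∈ L) :
    zSum p q {a | a ∈ F ∧ Xor (p a ∈ S) (q a ∈ S)} ∈ L := by
  classical
  have h2 := L.lie_mem hS (L.lie_mem hS hF)
  have h4 := L.lie_mem hS (L.lie_mem hS h2)
  have h := L.smul_mem (-48⁻¹ : ℝ) (L.add_mem h4 (L.smul_mem (16 : ℝ) h2))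
  convert h using 1
  have key : ⁅xSum S, ⁅xSum S, ⁅xSum S, ⁅xSum S, zSum p q F⁆⁆⁆⁆ +
      (16 : ℝ) • ⁅xSum S, ⁅xSum S, zSum p q F⁆⁆ =
      ∑ a with a ∈ F, Complex.I • (if Xor (p a ∈ S) (q a ∈ S) then
        (-48 : ℝ) • (opZ (p a) * opZ (q a)) else 0) := by
    simp only [zSum, lie_sum, Finset.smul_sum, ← Finset.sum_add_distrib]
    refine Finset.sum_congr rfl fun a _ => ?_
    rw [← lie_four_xSum_edge (hpq a) S]
    simp only [Ring.lie_def, mul_smul_comm, smul_mul_assoc, ← smul_sub, smul_add,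
      ofNat_smul_eq_nsmul, smul_comm (16 : ℕ) Complex.I]
    noncomm_ring
  rw [key, zSum, Finset.smul_sum]
  simp only [Set.mem_ofPred_eq, ← Finset.filter_filter]
  rw [Finset.sum_filter]
  refine Finset.sum_congr rfl fun a _ => ?_
  split_ifs
  · rw [smul_comm, smul_smul]; norm_num
  · simp

/-- The edges of `G` are the pairs `p a, q a`, each listed once. -/
structure EnumeratesEdges {V ι : Type*} (G : SimpleGraph V) (p q : ι → V) : Prop where
  injective : Function.Injective fun a => s(p a, q a)
  range_eq : Set.range (fun a => s(p a, q a)) = G.edgeSet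

theorem EnumeratesEdges.ne {V ι : Type*} {G : SimpleGraph V} {p q : ι → V}
    (h : EnumeratesEdges G p q) (a : ι) : p a ≠ q a := by
  have : s(p a, q a) ∈ G.edgeSet := h.range_eq ▸ Set.mem_range_self a
  exact G.ne_of_adj (G.mem_edgeSet.mp this)

open Classical in
theorem EnumeratesEdges.sum_edgeFinset {V ι M : Type*} [Fintype V] [Fintype ι] [AddCommMonoid M]
    {G : SimpleGraph V} {p q : ι → V} (h : EnumeratesEdges G p q) (f : Sym2 V → M) :
    ∑ e ∈ G.edgeFinset, f e = ∑ a, f s(p a, q a) := by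
  have : G.edgeFinset = Finset.univ.image fun a => s(p a, q a) := by
    ext e
    rw [SimpleGraph.mem_edgeFinset, ← h.range_eq]
    simp
  rw [this, Finset.sum_image fun a _ b _ hab => h.injective hab]

/-- The dynamical Lie algebra is free if every Lie algebra closed under the parity filters and
containing the two Hamiltonians contains the individual generators. -/
theorem isFreeDLA_of_singletons {G : SimpleGraph V} (h : EnumeratesEdges G p q)
    (hG : ∀ L : LieSubalgebra ℝ (Operator V), xSum Set.univ ∈ L → zSum p q Set.univ ∈ L →
      (∀ u, xSum {u} ∈ L) ∧ ∀ a, zSum p q {a} ∈ L) :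
    IsFreeDLA G := by
  classical
  have hX : Complex.I • mixerHamiltonian V = xSum Set.univ := by
    simp [xSum, mixerHamiltonian, Finset.smul_sum]
  have hZ : Complex.I • problemHamiltonian G = zSum p q Set.univ := by
    rw [problemHamiltonian, h.sum_edgeFinset]
    simp [zSum, opZZ, Finset.smul_sum]
  apply le_antisymm
  · refine LieSubalgebra.lieSpan_le.mpr ?_
    rintro M (rfl | rfl)
    · rw [hZ]
      refine sum_mem fun a _ => LieSubalgebra.subset_lieSpan (Or.inr ⟨s(p a, q a), ?_, rfl⟩)
      exact h.range_eq ▸ Set.mem_range_self a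
    · rw [hX]
      exact sum_mem fun u _ => LieSubalgebra.subset_lieSpan (Or.inl ⟨u, rfl⟩)
  · obtain ⟨hu, ha⟩ := hG (dla G) (hX ▸ LieSubalgebra.subset_lieSpan (Or.inr rfl))
      (hZ ▸ LieSubalgebra.subset_lieSpan (Or.inl rfl))
    refine LieSubalgebra.lieSpan_le.mpr ?_
    rintro M (⟨u, rfl⟩ | ⟨e, he, rfl⟩)
    · simpa [xSum, Finset.filter_eq'] using hu u
    · rw [← h.range_eq] at he
      obtain ⟨a, rfl⟩ := he
      have := ha a
      rwa [zSum, Finset.sum_eq_single_of_mem a (by simp)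
        fun b hb hne => absurd (by simpa using hb) hne] at this

end ParityFilters

/-! ### Combinatorics: separating the vertices and edges of a path system -/

section Peeling

/-- A family of vertex sets and a family of edge sets that contain all vertices and all edges and
are closed under differences and under the two parity filters. -/
structure ParityClosed {V ι : Type*} (p q : ι → V) (X : Set V → Prop) (Z : Set ι → Prop) :
    Prop where
  univ_left : X Set.univ
  univ_right : Z Set.univ
  diff_left : ∀ {S S'}, X S → X S' → S' ⊆ S → X (S \ S')
  diff_right : ∀ {F F'}, Z F → Z F' → F' ⊆ F → Z (F \ F')
  odd : ∀ {S F}, X S → Z F → X {u | u ∈ S ∧ Odd {a | a ∈ F ∧ (p a = u ∨ q a = u)}.ncard}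
  xor : ∀ {S F}, X S → Z F → Z {a | a ∈ F ∧ Xor (p a ∈ S) (q a ∈ S)}

/-- The edges of the paths: path `t` has `2 * t + 2` inner vertices and `2 * t + 3` edges. -/
abbrev PathEdge (K : ℕ) := Σ t : Fin K, Fin (2 * (t : ℕ) + 3)

/-- A family of paths `v t 0, …, v t (2 * t + 3)` whose ends are among the vertices in `O` and
whose inner vertices are the vertices outside `O`, each occurring once. -/
structure PathSystem {V : Type*} {K : ℕ} (v : Fin K → ℕ → V) (O : Set V) : Prop where
  src_mem : ∀ t, v t 0 ∈ O
  tgt_mem : ∀ t : Fin K, v t (2 * t + 3) ∈ O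
  ends_ne : ∀ t : Fin K, v t 0 ≠ v t (2 * t + 3)
  inner_notMem : ∀ (t : Fin K) (j : ℕ), 1 ≤ j → j ≤ 2 * t + 2 → v t j ∉ O
  inner_inj : ∀ (t t' : Fin K) (j j' : ℕ), 1 ≤ j → j ≤ 2 * t + 2 → 1 ≤ j' → j' ≤ 2 * t' + 2 →
    v t j = v t' j' → t = t' ∧ j = j'
  inner_surj : ∀ x, x ∉ O → ∃ (t : Fin K) (j : ℕ), 1 ≤ j ∧ j ≤ 2 * t + 2 ∧ x = v t j

variable {V : Type*} {K : ℕ}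

/-- The first vertex of an edge. -/
def edgeFst (v : Fin K → ℕ → V) (a : PathEdge K) : V := v a.1 a.2

/-- The second vertex of an edge. -/
def edgeSnd (v : Fin K → ℕ → V) (a : PathEdge K) : V := v a.1 (a.2 + 1)

/-- The inner vertices `v t j` with `P t j`. -/
def innerSet (v : Fin K → ℕ → V) (P : ℕ → ℕ → Prop) : Set V :=
  {x | ∃ (t : Fin K) (j : ℕ), 1 ≤ j ∧ j ≤ 2 * t + 2 ∧ x = v t j ∧ P t j}

/-- The edges number `i` of path `t` with `P t i`. -/
def edgeSetOf (K : ℕ) (P : ℕ → ℕ → Prop) : Set (PathEdge K) :=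
  {a | P a.1 a.2}

namespace PathSystem

variable {v : Fin K → ℕ → V} {O : Set V} (hv : PathSystem v O)

include hv

theorem mem_innerSet {P : ℕ → ℕ → Prop} {t : Fin K} {j : ℕ} (h1 : 1 ≤ j) (h2 : j ≤ 2 * t + 2) :
    v t j ∈ innerSet v P ↔ P t j := by
  constructor
  · rintro ⟨t', j', h1', h2', h, hP⟩
    obtain ⟨rfl, rfl⟩ := hv.inner_inj _ _ _ _ h1 h2 h1' h2' h
    exact hP
  · exact fun hP => ⟨t, j, h1, h2, rfl, hP⟩

theorem notMem_innerSet {P : ℕ → ℕ → Prop} {x : V} (hx : x ∈ O) : x ∉ innerSet v P := by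
  rintro ⟨t, j, h1, h2, rfl, -⟩
  exact hv.inner_notMem t j h1 h2 hx

theorem ext_innerSet {S : Set V} {P : ℕ → ℕ → Prop} (hO : ∀ x ∈ O, x ∉ S)
    (h : ∀ (t : Fin K) (j : ℕ), 1 ≤ j → j ≤ 2 * t + 2 → (v t j ∈ S ↔ P t j)) :
    S = innerSet v P := by
  ext x
  by_cases hx : x ∈ O
  · exact iff_of_false (hO x hx) (hv.notMem_innerSet hx)
  · obtain ⟨t, j, h1, h2, rfl⟩ := hv.inner_surj x hx
    rw [hv.mem_innerSet h1 h2, h t j h1 h2]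

/-- An inner vertex meets only the edges `j - 1` and `j` of its own path. -/
theorem odd_inner (Q : ℕ → ℕ → Prop) (t : Fin K) (j : ℕ) (h1 : 1 ≤ j) (h2 : j ≤ 2 * t + 2) :
    Odd {a | a ∈ edgeSetOf K Q ∧ (edgeFst v a = v t j ∨ edgeSnd v a = v t j)}.ncard ↔
      Xor (Q t (j - 1)) (Q t j) := by
  classical
  let e₁ : PathEdge K := ⟨t, j - 1, by omega⟩
  let e₂ : PathEdge K := ⟨t, j, by omega⟩
  have hne : e₁ ≠ e₂ := by
    intro h
    have := congrArg (fun a : PathEdge K => (a.2 : ℕ)) h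
    simp only [e₁, e₂] at this
    omega
  have hset : {a | a ∈ edgeSetOf K Q ∧ (edgeFst v a = v t j ∨ edgeSnd v a = v t j)} =
      ↑(({e₁, e₂} : Finset (PathEdge K)).filter fun a => Q a.1 a.2) := by
    ext ⟨s, i⟩
    simp only [edgeSetOf, Set.mem_ofPred_eq, edgeFst, edgeSnd, Finset.coe_filter,
      Finset.mem_insert, Finset.mem_singleton]
    rw [and_comm]
    refine and_congr_left fun _ => ⟨?_, ?_⟩
    · have hi := i.2
      rintro (h | h)
      · have h0 : (i : ℕ) ≠ 0 := fun h0 =>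
          hv.inner_notMem t j h1 h2 (by rw [← h, h0]; exact hv.src_mem s)
        obtain ⟨rfl, h'⟩ := hv.inner_inj _ _ _ _ (by omega) (by omega) h1 h2 h
        exact Or.inr (by simp only [e₂]; congr 1; exact Fin.ext h')
      · have h0 : (i : ℕ) + 1 ≠ 2 * s + 3 := fun h0 =>
          hv.inner_notMem t j h1 h2 (by rw [← h, h0]; exact hv.tgt_mem s)
        obtain ⟨rfl, h'⟩ := hv.inner_inj _ _ _ _ (by omega) (by omega) h1 h2 h
        exact Or.inl (by simp only [e₁]; congr 1; exact Fin.ext (by simp; omega))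
    · rintro (h | h)
      · simp only [e₁, Sigma.mk.injEq] at h
        obtain ⟨rfl, h⟩ := h
        obtain rfl := eq_of_heq h
        exact Or.inr (by congr 1; simp; omega)
      · simp only [e₂, Sigma.mk.injEq] at h
        obtain ⟨rfl, h⟩ := h
        obtain rfl := eq_of_heq h
        exact Or.inl rfl
  rw [hset, Set.ncard_coe_finset, Finset.filter_insert, Finset.filter_singleton]
  by_cases hq₁ : Q t (j - 1) <;> by_cases hq₂ : Q t j <;>
    simp [e₁, e₂, hq₁, hq₂, Xor]
  rw [Finset.card_pair hne]
  decide

variable {X : Set V → Prop} {Z : Set (PathEdge K) → Prop}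
  (hc : ParityClosed (edgeFst v) (edgeSnd v) X Z)

include hc

omit hv in
theorem edge_univ : Z (edgeSetOf K fun _ _ => True) := by
  convert hc.univ_right
  simp [edgeSetOf]

/-- This and the next lemmas turn the closure properties into linear arithmetic on positions. The
resulting set `R` is free to be stated in a convenient form. -/
theorem inner_odd {P Q : ℕ → ℕ → Prop} (hP : X (innerSet v P)) (hQ : Z (edgeSetOf K Q))
    {R : ℕ → ℕ → Prop}
    (hR : ∀ t j, 1 ≤ j → j ≤ 2 * t + 2 → (P t j ∧ Xor (Q t (j - 1)) (Q t j) ↔ R t j)) :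
    X (innerSet v R) := by
  convert hc.odd hP hQ using 1
  refine (hv.ext_innerSet (fun x hx h => hv.notMem_innerSet hx h.1) fun t j h1 h2 => ?_).symm
  rw [Set.mem_ofPred_eq, hv.mem_innerSet h1 h2, hv.odd_inner Q t j h1 h2, hR t j h1 h2]

theorem edge_xor {P Q : ℕ → ℕ → Prop} (hP : X (innerSet v P)) (hQ : Z (edgeSetOf K Q))
    {R : ℕ → ℕ → Prop}
    (hR : ∀ t i, i ≤ 2 * t + 2 →
      (Q t i ∧ Xor (1 ≤ i ∧ P t i) (i + 1 ≤ 2 * t + 2 ∧ P t (i + 1)) ↔ R t i)) :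
    Z (edgeSetOf K R) := by
  convert hc.xor hP hQ using 1
  ext ⟨t, i⟩
  have hi := i.2
  have h1 : v t i ∈ innerSet v P ↔ 1 ≤ (i : ℕ) ∧ P t i := by
    by_cases h : 1 ≤ (i : ℕ)
    · rw [hv.mem_innerSet h (by omega), and_iff_right h]
    · have h0 : (i : ℕ) = 0 := by omega
      rw [h0]
      exact iff_of_false (hv.notMem_innerSet (hv.src_mem t)) (by omega)
  have h2 : v t (i + 1) ∈ innerSet v P ↔ (i : ℕ) + 1 ≤ 2 * t + 2 ∧ P t (i + 1) := by
    by_cases h : (i : ℕ) + 1 ≤ 2 * t + 2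
    · rw [hv.mem_innerSet (by omega) h, and_iff_right h]
    · have h0 : (i : ℕ) + 1 = 2 * t + 3 := by omega
      rw [h0]
      exact iff_of_false (hv.notMem_innerSet (hv.tgt_mem t)) (by omega)
  simp only [edgeSetOf, Set.mem_ofPred_eq, edgeFst, edgeSnd, h1, h2]
  exact (hR t i (by omega)).symm

theorem inner_diff {P Q R : ℕ → ℕ → Prop} (hP : X (innerSet v P)) (hQ : X (innerSet v Q))
    (h : ∀ t j, 1 ≤ j → j ≤ 2 * t + 2 → Q t j → P t j)
    (hR : ∀ t j, 1 ≤ j → j ≤ 2 * t + 2 → (P t j ∧ ¬ Q t j ↔ R t j)) :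
    X (innerSet v R) := by
  convert hc.diff_left hP hQ ?_ using 1
  · refine (hv.ext_innerSet (fun x hx h => hv.notMem_innerSet hx h.1) fun t j h1 h2 => ?_).symm
    rw [Set.mem_sdiff, hv.mem_innerSet h1 h2, hv.mem_innerSet h1 h2, hR t j h1 h2]
  · rintro x ⟨t, j, h1, h2, rfl, hx⟩
    exact ⟨t, j, h1, h2, rfl, h _ _ h1 h2 hx⟩

omit hv in
theorem edge_diff {P Q R : ℕ → ℕ → Prop} (hP : Z (edgeSetOf K P)) (hQ : Z (edgeSetOf K Q))
    (h : ∀ t i, i ≤ 2 * t + 2 → Q t i → P t i)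
    (hR : ∀ t i, i ≤ 2 * t + 2 → (P t i ∧ ¬ Q t i ↔ R t i)) :
    Z (edgeSetOf K R) := by
  convert hc.diff_right hP hQ ?_ using 1
  · ext ⟨t, i⟩
    exact (hR t i (by omega)).symm
  · rintro ⟨t, i⟩ ha
    exact h t i (by omega) ha

/-- Every path has at least three edges, so its two end edges have exactly one end in `O` and its
other edges have none. -/
theorem edge_xor_old (hO : X O) {Q R : ℕ → ℕ → Prop} (hQ : Z (edgeSetOf K Q))
    (hR : ∀ t i, i ≤ 2 * t + 2 → (Q t i ∧ (i = 0 ∨ i = 2 * t + 2) ↔ R t i)) :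
    Z (edgeSetOf K R) := by
  convert hc.xor hO hQ using 1
  ext ⟨t, i⟩
  have hi := i.2
  have h1 : v t i ∈ O ↔ (i : ℕ) = 0 := by
    by_cases h : 1 ≤ (i : ℕ)
    · exact iff_of_false (hv.inner_notMem t i h (by omega)) (by omega)
    · have h0 : (i : ℕ) = 0 := by omega
      rw [h0]
      exact iff_of_true (hv.src_mem t) rfl
  have h2 : v t (i + 1) ∈ O ↔ (i : ℕ) = 2 * t + 2 := by
    by_cases h : (i : ℕ) + 1 ≤ 2 * t + 2
    · exact iff_of_false (hv.inner_notMem t _ (by omega) h) (by omega)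
    · have h0 : (i : ℕ) + 1 = 2 * t + 3 := by omega
      rw [h0]
      exact iff_of_true (hv.tgt_mem t) (by omega)
  simp only [edgeSetOf, Set.mem_ofPred_eq, edgeFst, edgeSnd, h1, h2]
  rw [← hR t i (by omega)]
  refine and_congr_right fun _ => ?_
  simp only [Xor]
  omega

/-- Layer by layer from the ends of the paths, the inner vertices are separated by their distance
from the ends, and so are the edges. -/
theorem peel (hO : X O) (hI : X (innerSet v fun _ _ => True)) (k : ℕ) :
    X (innerSet v fun t j => k + 1 ≤ j ∧ j + (k + 1) ≤ 2 * t + 3) ∧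
    Z (edgeSetOf K fun t i => (k + 1 ≤ i ∧ i + (k + 1) ≤ 2 * t + 2) ∨ i = t + 1) := by
  induction k with
  | zero =>
    constructor
    · refine hv.inner_diff hc hI (Q := fun _ _ => False) ?_ (by simp) fun t j h1 h2 => ?_
      · convert hc.diff_left hI hI le_rfl using 1
        refine (hv.ext_innerSet (by simp) (by simp)).symm
      · simp; omega
    · have := hv.edge_xor_old hc hO (edge_univ hc) (R := fun t i => i = 0 ∨ i = 2 * t + 2) (by simp)
      exact edge_diff hc (edge_univ hc) this (by simp) fun t i hi => by rw [true_and]; omega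
  | succ k ih =>
    obtain ⟨hX, hZ⟩ := ih
    have hL := hv.inner_odd hc hX hZ (R := fun t j => j = k + 1 ∧ j + (k + 1) ≤ 2 * t + 3 ∨
      k + 1 ≤ j ∧ j + (k + 1) = 2 * t + 3) fun t j h1 h2 => by simp only [Xor]; omega
    refine ⟨hv.inner_diff hc hX hL (fun t j h1 h2 => by omega) fun t j h1 h2 => by omega, ?_⟩
    -- The middle edge `t + 1` has either both ends in the layer or none, so the filter never
    -- catches it and it survives all rounds.
    have hE := hv.edge_xor hc hL hZ (R := fun t i => i ≠ t + 1 ∧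
      (i = k + 1 ∧ i + (k + 1) ≤ 2 * t + 2 ∨ k + 1 ≤ i ∧ i + (k + 1) = 2 * t + 2))
      fun t i hi => by simp only [Xor]; omega
    exact edge_diff hc hZ hE (fun t i hi => by omega) fun t i hi => by omega

/-- The outermost remaining vertices have lost their outer edge and so meet one remaining edge;
those further inside meet two. -/
theorem layer (hO : X O) (hI : X (innerSet v fun _ _ => True)) (k : ℕ) :
    X (innerSet v fun t j => j = k + 1 ∧ j + (k + 1) ≤ 2 * t + 3 ∨
      k + 1 ≤ j ∧ j + (k + 1) = 2 * t + 3) := by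
  obtain ⟨hX, hZ⟩ := hv.peel hc hO hI k
  exact hv.inner_odd hc hX hZ fun t j h1 h2 => by simp only [Xor]; omega

theorem edge_layer (hO : X O) (hI : X (innerSet v fun _ _ => True)) (k : ℕ) :
    Z (edgeSetOf K fun t i => i ≠ t + 1 ∧
      (i = k + 1 ∧ i + (k + 1) ≤ 2 * t + 2 ∨ k + 1 ≤ i ∧ i + (k + 1) = 2 * t + 2)) :=
  hv.edge_xor hc (hv.layer hc hO hI k) (hv.peel hc hO hI k).2
    fun t i hi => by simp only [Xor]; omega

/-- The two middle vertices of a path are separated from all other vertices, as the lengths of the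
paths are different. -/
theorem middle (hO : X O) (hI : X (innerSet v fun _ _ => True)) (s : ℕ) :
    X (innerSet v fun t j => t = s ∧ (j = s + 1 ∨ j = s + 2)) := by
  have hL := hv.layer hc hO hI s
  obtain ⟨-, hZ⟩ := hv.peel hc hO hI (s + 1)
  -- The layer `s` has no vertices on shorter paths. On longer ones, both edges at its vertices have
  -- been peeled. On the path `s` itself the middle edge remains, and it meets both middle vertices.
  exact hv.inner_odd hc hL hZ fun t j h1 h2 => by simp only [Xor]; omega

/-- Induction outwards from the middle of the path `s`. A symmetric pair of vertices selects, within
the next layer of edges of all paths, the pair on this path; that pair of edges selects the next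
pair of vertices in turn. At `d = s` the two end edges are reached. -/
theorem edge_pair (hO : X O) (hI : X (innerSet v fun _ _ => True)) (s d : ℕ) (hd : d ≤ s) :
    Z (edgeSetOf K fun t i => t = s ∧ (i = s - d ∨ i + (s - d) = 2 * s + 2)) := by
  have step : ∀ d, d ≤ s →
      X (innerSet v fun t j => t = s ∧ (j = s - d + 1 ∨ j + (s - d + 1) = 2 * s + 3)) →
      Z (edgeSetOf K fun t i => t = s ∧ (i = s - d ∨ i + (s - d) = 2 * s + 2)) := by
    intro d hd h
    obtain h0 | ⟨k, hk⟩ : s - d = 0 ∨ ∃ k, s - d = k + 1 :=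
      (s - d).eq_zero_or_eq_succ_pred.imp_right fun h => ⟨_, h⟩
    · have hU : Z (edgeSetOf K fun _ _ => True) := by
        convert hc.univ_right
        simp [edgeSetOf]
      have := hv.edge_xor_old hc hO (edge_univ hc) (R := fun t i => i = 0 ∨ i = 2 * t + 2) (by simp)
      exact hv.edge_xor hc h this fun t i hi => by simp only [Xor]; omega
    · exact hv.edge_xor hc h (hv.edge_layer hc hO hI k) fun t i hi => by simp only [Xor]; omega
  induction d with
  | zero =>
    refine step 0 (by omega) ?_
    convert hv.middle hc hO hI s using 5
    omega
  | succ d ih =>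
    refine step _ hd ?_
    obtain ⟨k, hk⟩ : ∃ k, s - d = k + 1 := ⟨s - d - 1, by omega⟩
    exact hv.inner_odd hc (hv.layer hc hO hI k) (ih (by omega))
      fun t j h1 h2 => by simp only [Xor]; omega

-- An edge at an old vertex is the first or the last one of its path. A path has two different ends,
-- so it contributes at most one edge, and edges may be counted as paths.
omit hc in
theorem ncard_old (Q : ℕ → ℕ → Prop) {x : V} (hx : x ∈ O) :
    {a | a ∈ edgeSetOf K Q ∧ (edgeFst v a = x ∨ edgeSnd v a = x)}.ncard =
      {t : Fin K | Q t 0 ∧ v t 0 = x ∨ Q t (2 * t + 2) ∧ v t (2 * t + 3) = x}.ncard := by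
  have key : ∀ a : PathEdge K, (edgeFst v a = x ∨ edgeSnd v a = x) →
      (a.2 : ℕ) = 0 ∧ v a.1 0 = x ∨ (a.2 : ℕ) = 2 * a.1 + 2 ∧ v a.1 (2 * a.1 + 3) = x := by
    rintro ⟨t, i⟩ h
    have hi := i.2
    simp only [edgeFst, edgeSnd] at h ⊢
    rcases h with h | h
    · have h0 : (i : ℕ) = 0 := by
        by_contra h0
        exact hv.inner_notMem t i (by omega) (by omega) (h ▸ hx)
      exact Or.inl ⟨h0, h0 ▸ h⟩
    · have h0 : (i : ℕ) = 2 * t + 2 := by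
        by_contra h0
        exact hv.inner_notMem t (i + 1) (by omega) (by omega) (h ▸ hx)
      exact Or.inr ⟨h0, by rw [h0] at h; exact h⟩
  rw [← Set.InjOn.ncard_image (f := Sigma.fst)]
  · congr 1
    ext t
    constructor
    · rintro ⟨a, ⟨haQ, ha⟩, rfl⟩
      rcases key a ha with ⟨h0, h⟩ | ⟨h0, h⟩
      · exact Or.inl ⟨by rw [← h0]; exact haQ, h⟩
      · exact Or.inr ⟨by rw [← h0]; exact haQ, h⟩
    · rintro (⟨hQ, h⟩ | ⟨hQ, h⟩)
      · exact ⟨⟨t, 0, by omega⟩, ⟨hQ, Or.inl h⟩, rfl⟩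
      · exact ⟨⟨t, 2 * t + 2, by omega⟩, ⟨hQ, Or.inr h⟩, rfl⟩
  · rintro ⟨t, i⟩ ⟨-, ha⟩ ⟨t', i'⟩ ⟨-, hb⟩ (rfl : t = t')
    have hij : (i : ℕ) = i' := by
      rcases key _ ha with ⟨h0, h⟩ | ⟨h0, h⟩ <;> rcases key _ hb with ⟨h0', h'⟩ | ⟨h0', h'⟩
      · exact h0.trans h0'.symm
      · exact absurd (h.trans h'.symm) (hv.ends_ne t)
      · exact absurd (h'.trans h.symm) (hv.ends_ne t)
      · exact h0.trans h0'.symm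
    rw [Fin.ext hij]

/-- Once the end edges of a single path are isolated, they cut `S` down to the ends of this path,
each of which meets exactly one of them. -/
theorem old_odd {S : Set V} (hS : X S) (hSO : S ⊆ O) {Q : ℕ → ℕ → Prop}
    (hQ : Z (edgeSetOf K Q)) (s : Fin K) (hQs : ∀ t : Fin K, Q t 0 ↔ t = s)
    (hQs' : ∀ t : Fin K, Q t (2 * t + 2) ↔ t = s) :
    X {u | u ∈ S ∧ (u = v s 0 ∨ u = v s (2 * s + 3))} := by
  convert hc.odd hS hQ using 1
  ext x
  simp only [Set.mem_ofPred_eq]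
  refine and_congr_right fun hx => ?_
  rw [hv.ncard_old Q (hSO hx)]
  simp only [hQs, hQs']
  by_cases h : x = v s 0 ∨ x = v s (2 * s + 3)
  · rw [iff_true_left h]
    have : {t : Fin K | t = s ∧ v t 0 = x ∨ t = s ∧ v t (2 * t + 3) = x} = {s} := by
      ext t
      constructor
      · rintro (h | h) <;> exact h.1
      · rintro rfl
        exact h.imp (fun h => ⟨rfl, h.symm⟩) fun h => ⟨rfl, h.symm⟩
    rw [this, Set.ncard_singleton]
    exact odd_one
  · rw [iff_false_left h]
    have : {t : Fin K | t = s ∧ v t 0 = x ∨ t = s ∧ v t (2 * t + 3) = x} = ∅ := by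
      ext t
      simp only [Set.mem_ofPred_eq, Set.mem_empty_iff_false, iff_false]
      rintro (⟨rfl, h'⟩ | ⟨rfl, h'⟩)
      · exact h (Or.inl h'.symm)
      · exact h (Or.inr h'.symm)
    rw [this, Set.ncard_empty]
    decide

/-- If the vertices in `O` have odd degree, they are separated from the inner vertices. -/
theorem old_and_inner
    (hodd : ∀ x ∈ O, Odd {t : Fin K | v t 0 = x ∨ v t (2 * t + 3) = x}.ncard) :
    X O ∧ X (innerSet v fun _ _ => True) := by
  have hO : X O := by
    -- Inner vertices meet two edges, old ones an odd number.
    convert hc.odd hc.univ_left (edge_univ hc) using 1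
    ext x
    simp only [Set.mem_ofPred_eq, Set.mem_univ, true_and]
    by_cases hx : x ∈ O
    · refine iff_of_true hx ?_
      rw [hv.ncard_old _ hx]
      simpa using hodd x hx
    · obtain ⟨t, j, h1, h2, rfl⟩ := hv.inner_surj x hx
      refine iff_of_false hx ?_
      rw [hv.odd_inner _ t j h1 h2]
      simp
  refine ⟨hO, ?_⟩
  convert hc.diff_left hc.univ_left hO (Set.subset_univ _) using 1
  refine (hv.ext_innerSet (fun x hx h => h.2 hx) fun t j h1 h2 => iff_of_true ?_ trivial).symm
  exact ⟨Set.mem_univ _, hv.inner_notMem t j h1 h2⟩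

/-- If the graph of which the paths form the subdivision has only odd degrees, and every vertex is
on an edge that meets another one in its first end, all vertices and edges can be separated. -/
theorem singletons
    (hodd : ∀ x ∈ O, Odd {t : Fin K | v t 0 = x ∨ v t (2 * t + 3) = x}.ncard)
    (hsep : ∀ x ∈ O, ∃ t t' : Fin K, (x = v t 0 ∨ x = v t (2 * t + 3)) ∧ v t 0 = v t' 0 ∧
      v t (2 * t + 3) ≠ v t' 0 ∧ v t (2 * t + 3) ≠ v t' (2 * t' + 3)) :
    (∀ x, X {x}) ∧ ∀ a, Z {a} := by
  obtain ⟨hO, hI⟩ := hv.old_and_inner hc hodd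
  have hpair : ∀ s : Fin K, Z (edgeSetOf K fun t i => t = s ∧ (i = 0 ∨ i = 2 * s + 2)) := by
    intro s
    convert hv.edge_pair hc hO hI s s le_rfl using 5
    omega
  have hpair' : ∀ (S : Set V), X S → S ⊆ O → ∀ s : Fin K,
      X {u | u ∈ S ∧ (u = v s 0 ∨ u = v s (2 * s + 3))} := fun S hS hSO s =>
    hv.old_odd hc hS hSO (hpair s) s
      (fun t => ⟨fun h => Fin.ext h.1, fun h => ⟨congrArg _ h, Or.inl rfl⟩⟩)
      (fun t => ⟨fun h => Fin.ext h.1, fun h => ⟨congrArg _ h, Or.inr (h ▸ rfl)⟩⟩)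
  have hold : ∀ x ∈ O, X {x} := by
    intro x hx
    obtain ⟨t, t', hxt, h1, h2, h3⟩ := hsep x hx
    have hP := hpair' O hO le_rfl t
    have hsrc : X {v t 0} := by
      -- The end pairs of `t` and `t'` meet only in their common first end.
      convert hpair' _ hP (fun u hu => hu.1) t' using 1
      ext u
      simp only [Set.mem_singleton_iff, Set.mem_ofPred_eq]
      constructor
      · rintro rfl
        exact ⟨⟨hv.src_mem t, Or.inl rfl⟩, Or.inl h1⟩
      · rintro ⟨⟨-, rfl | rfl⟩, h⟩
        · rfl
        · exact absurd h (by tauto)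
    rcases hxt with rfl | rfl
    · exact hsrc
    · convert hc.diff_left hP hsrc ?_ using 1
      · ext u
        simp only [Set.mem_singleton_iff, Set.mem_ofPred_eq, Set.mem_sdiff]
        constructor
        · rintro rfl
          exact ⟨⟨hv.tgt_mem t, Or.inr rfl⟩, (hv.ends_ne t).symm⟩
        · tauto
      · rintro u rfl
        exact ⟨hv.src_mem t, Or.inl rfl⟩
  have hedge : ∀ (s : Fin K) (k : ℕ), k ≤ 2 * s + 2 →
      Z (edgeSetOf K fun t i => t = s ∧ i = k) ∧
      (k ≤ 2 * s + 1 → X (innerSet v fun t j => t = s ∧ j = k + 1)) := by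
    intro s k hk
    induction k with
    | zero =>
      have h0 : Z (edgeSetOf K fun t i => t = s ∧ i = 0) := by
        -- Of the two end edges, only the first one contains the first end of the path.
        convert hc.xor (hold _ (hv.src_mem s)) (hpair s) using 1
        ext ⟨t, i⟩
        have hi := i.2
        simp only [edgeSetOf, Set.mem_ofPred_eq, edgeFst, edgeSnd, Set.mem_singleton_iff]
        rw [and_assoc]
        refine and_congr_right fun hts => ?_
        obtain rfl := Fin.ext hts
        constructor
        · intro h
          refine ⟨Or.inl h, Or.inl ⟨by rw [h], fun h' => ?_⟩⟩
          exact hv.inner_notMem t (i + 1) (by omega) (by omega) (h' ▸ hv.src_mem t)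
        · rintro ⟨h | h, h'⟩
          · exact h
          · exfalso
            rcases h' with ⟨h', -⟩ | ⟨h', -⟩
            · exact hv.inner_notMem t i (by omega) (by omega) (h' ▸ hv.src_mem t)
            · rw [h] at h'
              exact hv.ends_ne t h'.symm
      exact ⟨h0, fun _ => hv.inner_odd hc hI h0 fun t j h1 h2 => by
        simp only [Xor, true_and]; omega⟩
    | succ k ih =>
      obtain ⟨hZ, hX⟩ := ih (by omega)
      have hX := hX (by omega)
      -- An isolated inner vertex yields its two edges, of which the earlier is already isolated.
      -- The later one then yields the next vertex in the same way.
      have h1 := hv.edge_xor hc hX (edge_univ hc)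
        (R := fun t i => t = s ∧ (i = k ∨ i = k + 1)) fun t i hi => by
          simp only [Xor, true_and]; omega
      have h2 : Z (edgeSetOf K fun t i => t = s ∧ i = k + 1) :=
        edge_diff hc h1 hZ (fun t i hi => by omega) fun t i hi => by omega
      refine ⟨h2, fun hk' => ?_⟩
      have h3 := hv.inner_odd hc hI h2
        (R := fun t j => t = s ∧ (j = k + 1 ∨ j = k + 1 + 1)) fun t j h1 h2 => by
          simp only [Xor, true_and]; omega
      exact hv.inner_diff hc h3 hX (fun t j h1 h2 => by omega) fun t j h1 h2 => by omega
  constructor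
  · intro x
    by_cases hx : x ∈ O
    · exact hold x hx
    · obtain ⟨t, j, h1, h2, rfl⟩ := hv.inner_surj x hx
      convert (hedge t (j - 1) (by omega)).2 (by omega) using 1
      refine hv.ext_innerSet (fun x hx h => ?_) fun t' j' h1' h2' => ?_
      · rw [Set.mem_singleton_iff] at h
        exact hv.inner_notMem t j h1 h2 (h ▸ hx)
      · rw [Set.mem_singleton_iff]
        constructor
        · intro h
          obtain ⟨rfl, rfl⟩ := hv.inner_inj _ _ _ _ h1' h2' h1 h2 h
          exact ⟨rfl, by omega⟩
        · rintro ⟨h, h'⟩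
          rw [Fin.ext h, h', Nat.sub_add_cancel h1]
  · rintro ⟨t, i⟩
    convert (hedge t i (by omega)).1 using 1
    ext ⟨t', i'⟩
    simp only [Set.mem_singleton_iff, edgeSetOf, Set.mem_ofPred_eq]
    constructor
    · rintro h
      cases h
      exact ⟨rfl, rfl⟩
    · rintro ⟨h, h'⟩
      obtain rfl := Fin.ext h
      rw [Fin.ext h']

end PathSystem

end Peeling

/-! ### Graphs given by a list of their edges -/

section EdgeEnumeration

theorem EnumeratesEdges.adj_iff {V ι : Type*} {G : SimpleGraph V} {p q : ι → V}
    (h : EnumeratesEdges G p q) {x y : V} : G.Adj x y ↔ ∃ a, s(p a, q a) = s(x, y) := by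
  rw [← SimpleGraph.mem_edgeSet, ← h.range_eq, Set.mem_range]

theorem enumeratesEdges_fromEdgeSet {V ι : Type*} {p q : ι → V} (hne : ∀ a, p a ≠ q a)
    (hinj : Function.Injective fun a => s(p a, q a)) :
    EnumeratesEdges (SimpleGraph.fromEdgeSet (Set.range fun a => s(p a, q a))) p q := by
  refine ⟨hinj, ?_⟩
  rw [SimpleGraph.edgeSet_fromEdgeSet, eq_comm, sdiff_eq_left, Set.disjoint_left]
  rintro _ ⟨a, rfl⟩ h
  exact hne a (by simpa using h)

theorem EnumeratesEdges.ncard_edgeSet {V ι : Type*} [Fintype ι] {G : SimpleGraph V} {p q : ι → V}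
    (h : EnumeratesEdges G p q) : G.edgeSet.ncard = Fintype.card ι := by
  rw [← h.range_eq, ← Set.image_univ, Set.ncard_image_of_injective _ h.injective, Set.ncard_univ,
    Nat.card_eq_fintype_card]

theorem EnumeratesEdges.ncard_neighborSet {V ι : Type*} {G : SimpleGraph V} {p q : ι → V}
    (h : EnumeratesEdges G p q) (x : V) :
    (G.neighborSet x).ncard = {a | p a = x ∨ q a = x}.ncard := by
  classical
  have h1 : (G.neighborSet x).ncard = (G.incidenceSet x).ncard :=
    (Nat.card_congr (G.incidenceSetEquivNeighborSet x)).symm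
  rw [h1, ← Set.ncard_image_of_injective _ h.injective]
  congr 1
  ext e
  simp only [SimpleGraph.incidenceSet, ← h.range_eq, Set.mem_ofPred_eq, Set.mem_image]
  constructor
  · rintro ⟨⟨a, rfl⟩, hx⟩
    exact ⟨a, (Sym2.mem_iff.mp hx).imp Eq.symm Eq.symm, rfl⟩
  · rintro ⟨a, ha, rfl⟩
    exact ⟨⟨a, rfl⟩, Sym2.mem_iff.mpr (ha.imp Eq.symm Eq.symm)⟩

theorem EnumeratesEdges.cutSize_eq {V ι : Type*} [Fintype V] [Fintype ι] {G : SimpleGraph V}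
    {p q : ι → V} (h : EnumeratesEdges G p q) (C : V → Bool) :
    cutSize G C = ∑ a, if C (p a) = C (q a) then 0 else 1 := by
  classical
  rw [cutSize, Finset.card_filter, h.sum_edgeFinset]
  refine Finset.sum_congr rfl fun a _ => ?_
  by_cases hC : C (p a) = C (q a) <;> simp [hC]

end EdgeEnumeration

/-! ### Path systems as graphs: freeness and asymmetric subdivision -/

section PathSystems

namespace PathSystem

variable {V : Type*} {K : ℕ} {v : Fin K → ℕ → V} {O : Set V} (hv : PathSystem v O)

include hv

theorem eq_of_inner_eq {t t' : Fin K} {j j' : ℕ} (h1 : 1 ≤ j) (h2 : j ≤ 2 * t + 2)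
    (h' : j' ≤ 2 * t' + 3) (h : v t j = v t' j') : t = t' ∧ j = j' := by
  by_cases h0 : j' = 0
  · subst h0
    exact absurd (h ▸ hv.src_mem t') (hv.inner_notMem t j h1 h2)
  by_cases h3 : j' = 2 * t' + 3
  · subst h3
    exact absurd (h ▸ hv.tgt_mem t') (hv.inner_notMem t j h1 h2)
  exact hv.inner_inj _ _ _ _ h1 h2 (by omega) (by omega) h

theorem edge_ne (a : PathEdge K) : edgeFst v a ≠ edgeSnd v a := by
  obtain ⟨t, i⟩ := a
  have hi := i.2
  intro h
  simp only [edgeFst, edgeSnd] at h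
  by_cases h0 : (i : ℕ) = 0
  · have := (hv.eq_of_inner_eq (by omega) (by omega) (by omega) h.symm).2
    omega
  · have := (hv.eq_of_inner_eq (by omega) (by omega) (by omega) h).2
    omega

/-- Every edge has an inner vertex as an end, and an inner vertex determines its path and its
position there. -/
theorem edge_injective : Function.Injective fun a => s(edgeFst v a, edgeSnd v a) := by
  rintro ⟨t, i⟩ ⟨t', i'⟩ h
  have hi := i.2
  have hi' := i'.2
  have key : t = t' ∧ (i : ℕ) = i' := by
    rcases Sym2.eq_iff.mp h with ⟨h1, h2⟩ | ⟨h1, h2⟩ <;>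
      simp only [edgeFst, edgeSnd] at h1 h2
    · by_cases h0 : (i : ℕ) = 0
      · have := hv.eq_of_inner_eq (by omega) (by omega) (by omega) h2
        exact ⟨this.1, by omega⟩
      · exact hv.eq_of_inner_eq (by omega) (by omega) (by omega) h1
    · by_cases h0 : (i : ℕ) = 0
      · obtain ⟨rfl, h3⟩ := hv.eq_of_inner_eq (by omega) (by omega) (by omega) h2
        have := (hv.eq_of_inner_eq (by omega) (by omega) (by omega) h1.symm).2
        omega
      · obtain ⟨rfl, h3⟩ := hv.eq_of_inner_eq (by omega) (by omega) (by omega) h1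
        by_cases h4 : (i' : ℕ) = 0
        · have := (hv.eq_of_inner_eq (by omega) (by omega) (by omega) h2).2
          omega
        · have := (hv.eq_of_inner_eq (by omega) (by omega) (by omega) h2.symm).2
          omega
  obtain ⟨rfl, h⟩ := key
  rw [Fin.ext h]

theorem isFreeDLA [Fintype V] [DecidableEq V] {G : SimpleGraph V}
    (hG : EnumeratesEdges G (edgeFst v) (edgeSnd v))
    (hodd : ∀ x ∈ O, Odd {t : Fin K | v t 0 = x ∨ v t (2 * t + 3) = x}.ncard)
    (hsep : ∀ x ∈ O, ∃ t t' : Fin K, (x = v t 0 ∨ x = v t (2 * t + 3)) ∧ v t 0 = v t' 0 ∧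
      v t (2 * t + 3) ≠ v t' 0 ∧ v t (2 * t + 3) ≠ v t' (2 * t' + 3)) :
    IsFreeDLA G :=
  isFreeDLA_of_singletons hG fun L hX hZ => hv.singletons
    (X := fun S => xSum S ∈ L) (Z := fun F => zSum (edgeFst v) (edgeSnd v) F ∈ L)
    ⟨hX, hZ, xSum_diff, zSum_diff, xSum_odd hG.ne, zSum_xor hG.ne⟩ hodd hsep

/-- A graph that consists of a system of paths with `2, 4, 6, …` inner vertices is an asymmetric
subdivision. -/
theorem isAsymmetricSubdivision {W : Type*} {H : SimpleGraph W} {G : SimpleGraph V}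
    (hG : EnumeratesEdges G (edgeFst v) (edgeSnd v)) {p q : Fin K → W}
    (hH : EnumeratesEdges H p q) {f : W → V} (hf : Function.Injective f) (hfO : Set.range f = O)
    (hp : ∀ t, f (p t) = v t 0) (hq : ∀ t : Fin K, f (q t) = v t (2 * t + 3)) :
    IsAsymmetricSubdivision H G := by
  let φ : Fin K → H.edgeSet := fun t => ⟨s(p t, q t), hH.range_eq ▸ Set.mem_range_self t⟩
  have hφ : Function.Bijective φ := by
    refine ⟨fun a b hab => hH.injective (congrArg Subtype.val hab), ?_⟩
    rintro ⟨e, he⟩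
    rw [← hH.range_eq] at he
    obtain ⟨t, rfl⟩ := he
    exact ⟨t, rfl⟩
  let idx : H.edgeSet ≃ Fin K := (Equiv.ofBijective φ hφ).symm
  have hidx : ∀ e : H.edgeSet, s(p (idx e), q (idx e)) = e.1 := fun e =>
    congrArg Subtype.val ((Equiv.ofBijective φ hφ).apply_symm_apply e)
  let len : H.edgeSet → ℕ := fun e => 2 * (idx e : ℕ) + 2
  let src : H.edgeSet → W := fun e => p (idx e)
  let tgt : H.edgeSet → W := fun e => q (idx e)
  let F : W ⊕ (Σ e : H.edgeSet, Fin (len e)) → V :=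
    Sum.elim f fun a => v (idx a.1) (a.2 + 1)
  have hF : Function.Bijective F := by
    constructor
    · rintro (w | ⟨e, j⟩) (w' | ⟨e', j'⟩) h
      · exact congrArg Sum.inl (hf h)
      · exact absurd (hfO ▸ ⟨w, h⟩ : v (idx e') (j' + 1) ∈ O)
          (hv.inner_notMem _ _ (by omega) (by have := j'.2; simp only [len] at this; omega))
      · exact absurd (hfO ▸ ⟨w', h.symm⟩ : v (idx e) (j + 1) ∈ O)
          (hv.inner_notMem _ _ (by omega) (by have := j.2; simp only [len] at this; omega))
      · have hj := j.2
        have hj' := j'.2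
        simp only [len] at hj hj'
        simp only [F, Sum.elim_inr] at h
        obtain ⟨h1, h2⟩ := hv.inner_inj _ _ _ _ (by omega) (by omega) (by omega) (by omega) h
        obtain rfl := idx.injective h1
        rw [Fin.ext (Nat.succ_injective h2)]
    · intro x
      by_cases hx : x ∈ O
      · rw [← hfO] at hx
        obtain ⟨w, rfl⟩ := hx
        exact ⟨Sum.inl w, rfl⟩
      · obtain ⟨t, j, h1, h2, rfl⟩ := hv.inner_surj x hx
        obtain ⟨e, rfl⟩ := idx.surjective t
        exact ⟨Sum.inr ⟨e, j - 1, by simp only [len]; omega⟩,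
          by simp only [F, Sum.elim_inr]; congr 1; omega⟩
  have hpath : ∀ (e : H.edgeSet) (j : ℕ), j ≤ 2 * (idx e : ℕ) + 3 →
      F (pathVertex src tgt len e j) = v (idx e) j := by
    intro e j hj
    cases j with
    | zero => exact hp _
    | succ j =>
      by_cases h : j < len e
      · simp [pathVertex, h, F]
      · have h' : j + 1 = 2 * (idx e : ℕ) + 3 := by simp only [len] at h; omega
        simp only [pathVertex, h, dif_neg, not_false_eq_true, F, Sum.elim_inl, tgt, hq, h']
  refine ⟨src, tgt, len, hidx, ?_, ?_, ⟨RelIso.symm ⟨Equiv.ofBijective F hF, ?_⟩⟩⟩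
  -- Every edge receives at least two new vertices, so none is kept.
  · intro e he
    simp [len] at he
  · intro e _ e' _ h
    have : (idx e : ℕ) = idx e' := by simp only [len] at h; omega
    exact idx.injective (Fin.ext this)
  · intro x y
    rw [Equiv.ofBijective_apply, Equiv.ofBijective_apply, hG.adj_iff, subdivide,
      SimpleGraph.fromEdgeSet_adj]
    have hmap : ∀ a b : W ⊕ (Σ e : H.edgeSet, Fin (len e)),
        s(F a, F b) = s(F x, F y) ↔ s(x, y) = s(a, b) := by
      intro a b
      rw [← Sym2.map_mk F a b, ← Sym2.map_mk F x y, (Sym2.map.injective hF.1).eq_iff, eq_comm]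
    constructor
    · rintro ⟨⟨t, i⟩, h⟩
      have hi := i.2
      have hne : F x ≠ F y := by
        intro hxy
        have := hv.edge_ne ⟨t, i⟩
        rw [hxy] at h
        rcases Sym2.eq_iff.mp h with ⟨h1, h2⟩ | ⟨h1, h2⟩ <;> exact this (h1.trans h2.symm)
      refine ⟨?_, fun hxy => hne (congrArg F hxy)⟩
      obtain ⟨e, rfl⟩ := idx.surjective t
      refine ⟨e, i, by simp only [len]; omega, ?_⟩
      rw [← hmap, hpath _ _ (by omega), hpath _ _ (by omega)]
      exact h
    · rintro ⟨⟨e, i, hi, h⟩, -⟩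
      simp only [len] at hi
      rw [← hmap, hpath _ _ (by omega), hpath _ _ (by omega)] at h
      exact ⟨⟨idx e, i, by omega⟩, h⟩

end PathSystem

end PathSystems

/-! ### Cuts along paths of odd length -/

section Cuts

/-- The number of colour changes among the first `k` steps. -/
def changes (c : ℕ → Bool) (k : ℕ) : ℕ :=
  ∑ i ∈ Finset.range k, if c i = c (i + 1) then 0 else 1

theorem changes_le (c : ℕ → Bool) (k : ℕ) : changes c k ≤ k := by
  calc changes c k ≤ ∑ _i ∈ Finset.range k, 1 :=
        Finset.sum_le_sum fun i _ => by split_ifs <;> simp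
    _ = k := by simp

theorem changes_mod_two (c : ℕ → Bool) (k : ℕ) :
    changes c k % 2 = if c 0 = c k then 0 else 1 := by
  induction k with
  | zero => simp [changes]
  | succ k ih =>
    rw [changes, Finset.sum_range_succ, ← changes, Nat.add_mod, ih]
    cases c 0 <;> cases c k <;> cases c (k + 1) <;> rfl

/-- If the ends agree, the number of changes is even and cannot be the odd length. -/
theorem changes_odd_le (c : ℕ → Bool) (a : ℕ) :
    changes c (2 * a + 1) ≤ 2 * a + if c 0 = c (2 * a + 1) then 0 else 1 := by
  have h1 := changes_le c (2 * a + 1)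
  have h2 := changes_mod_two c (2 * a + 1)
  split_ifs at h2 ⊢ <;> omega

/-- The last step is left free because the colour of the far end is prescribed. After an even number
of changes the colour is the initial one, so the last step is a change exactly if the ends differ.
-/
theorem changes_of_alternating (c : ℕ → Bool) (a : ℕ) (h : ∀ i < 2 * a, c (i + 1) = !c i) :
    changes c (2 * a + 1) = 2 * a + if c 0 = c (2 * a + 1) then 0 else 1 := by
  have h1 : changes c (2 * a) = 2 * a := by
    rw [changes, Finset.sum_congr rfl fun i hi => if_neg ?_]
    · simp
    · rw [h i (Finset.mem_range.mp hi)]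
      cases c i <;> simp
  have h2 := changes_mod_two c (2 * a)
  rw [h1] at h2
  have h3 : c 0 = c (2 * a) := by
    by_contra h3
    rw [if_neg h3] at h2
    omega
  rw [changes, Finset.sum_range_succ, ← changes, h1, ← h3]

variable {V : Type*} [Fintype V] {K : ℕ} {v : Fin K → ℕ → V}

theorem cutSize_paths {G : SimpleGraph V} (hG : EnumeratesEdges G (edgeFst v) (edgeSnd v))
    (C : V → Bool) : cutSize G C = ∑ t : Fin K, changes (fun j => C (v t j)) (2 * t + 3) := by
  rw [hG.cutSize_eq, Fintype.sum_sigma]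
  refine Finset.sum_congr rfl fun t _ => ?_
  rw [changes, Finset.sum_range]
  rfl

theorem cutSize_paths_le {G : SimpleGraph V} (hG : EnumeratesEdges G (edgeFst v) (edgeSnd v))
    (C : V → Bool) : cutSize G C ≤
      ∑ t : Fin K, (2 * (t : ℕ) + 2 + if C (v t 0) = C (v t (2 * t + 3)) then 0 else 1) := by
  rw [cutSize_paths hG]
  exact Finset.sum_le_sum fun t _ => changes_odd_le (fun j => C (v t j)) (t + 1)

theorem cutSize_paths_of_alternating {G : SimpleGraph V}
    (hG : EnumeratesEdges G (edgeFst v) (edgeSnd v)) (C : V → Bool)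
    (hC : ∀ (t : Fin K) (i : ℕ), i < 2 * t + 2 → C (v t (i + 1)) = !C (v t i)) :
    cutSize G C =
      ∑ t : Fin K, (2 * (t : ℕ) + 2 + if C (v t 0) = C (v t (2 * t + 3)) then 0 else 1) := by
  rw [cutSize_paths hG]
  exact Finset.sum_congr rfl fun t _ =>
    changes_of_alternating (fun j => C (v t j)) (t + 1) fun i hi => hC t i hi

theorem sum_two_mul_add_two (K : ℕ) : ∑ t : Fin K, (2 * (t : ℕ) + 2) = K * (K + 1) := by
  rw [Fin.sum_univ_eq_sum_range fun t => 2 * t + 2]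
  induction K with
  | zero => rfl
  | succ K ih => rw [Finset.sum_range_succ, ih]; ring

theorem cutSize_le_maxCut (G : SimpleGraph V) (C : V → Bool) : cutSize G C ≤ maxCut G := by
  classical
  exact Finset.le_sup (f := fun C => cutSize G C) (Finset.mem_univ C)

theorem exists_isOptimalCut (G : SimpleGraph V) : ∃ C, IsOptimalCut G C := by
  classical
  obtain ⟨C, -, hC⟩ := Finset.exists_mem_eq_sup (Finset.univ : Finset (V → Bool))
    Finset.univ_nonempty fun C => cutSize G C
  exact ⟨C, hC.symm⟩

/-- Optimal cuts of `G` and `G'` correspond to each other if every cut of `G'` restricts to a cut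
of `G` that is smaller by at most `d`, and every cut of `G` has an extension for which the
difference is `d`. -/
theorem optimalCut_correspondence {V' : Type*} [Fintype V'] {G : SimpleGraph V}
    {G' : SimpleGraph V'} (d : ℕ) (r : (V' → Bool) → V → Bool)
    (hle : ∀ C', cutSize G' C' ≤ cutSize G (r C') + d)
    (hext : ∀ C, ∃ C', cutSize G' C' = cutSize G C + d) :
    maxCut G' = maxCut G + d ∧ (∀ C', IsOptimalCut G' C' → IsOptimalCut G (r C')) := by
  have h : maxCut G' = maxCut G + d := by
    obtain ⟨C, hC⟩ := exists_isOptimalCut G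
    obtain ⟨C', hC'⟩ := exists_isOptimalCut G'
    obtain ⟨D, hD⟩ := hext C
    have h1 := hle C'
    have h2 := cutSize_le_maxCut G (r C')
    have h3 := cutSize_le_maxCut G' D
    rw [IsOptimalCut] at hC hC'
    omega
  refine ⟨h, fun C' hC' => ?_⟩
  have h1 := hle C'
  have h2 := cutSize_le_maxCut G (r C')
  rw [IsOptimalCut] at hC' ⊢
  omega

end Cuts

/-! ### The odd graph, its subdivision, and their numbering -/

section Construction

/-- The position `j` on the path that replaces the edge number `t` from `src t` to `tgt t`; the
`2 * t + 2` inner vertices of this path are numbered from `h + t * (t + 1)` on. -/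
def pathPos (h : ℕ) (src tgt : ℕ → ℕ) (t : ℕ) : ℕ → ℕ
  | 0 => src t
  | j + 1 => if j < 2 * t + 2 then h + t * (t + 1) + j else tgt t

theorem pathPos_inner (h : ℕ) (src tgt : ℕ → ℕ) {t j : ℕ} (h1 : 1 ≤ j) (h2 : j ≤ 2 * t + 2) :
    pathPos h src tgt t j + 1 = h + t * (t + 1) + j := by
  obtain ⟨j, rfl⟩ : ∃ i, j = i + 1 := ⟨j - 1, by omega⟩
  rw [pathPos, if_pos (by omega)]
  omega

theorem pathPos_last (h : ℕ) (src tgt : ℕ → ℕ) (t : ℕ) :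
    pathPos h src tgt t (2 * t + 3) = tgt t := by
  simp [pathPos]

/-- The pairs `src t, tgt t` for `t < K` are the edges, each listed once, of a graph on
`{0, …, h - 1}`. -/
structure IsEdgeListing (h K : ℕ) (src tgt : ℕ → ℕ) : Prop where
  src_lt : ∀ t < K, src t < h
  tgt_lt : ∀ t < K, tgt t < h
  ne : ∀ t < K, src t ≠ tgt t
  inj : ∀ t < K, ∀ t' < K, s(src t, tgt t) = s(src t', tgt t') → t = t'

/-- $t(t+1)$ is the number of inner vertices of the paths before $t$, so consecutive paths own
consecutive, disjoint blocks of numbers. -/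
theorem block_le {t t' : ℕ} (h : t < t') : t * (t + 1) + (2 * t + 2) ≤ t' * (t' + 1) := by
  calc t * (t + 1) + (2 * t + 2) = (t + 1) * (t + 1 + 1) := by ring
    _ ≤ t' * (t' + 1) := by gcongr <;> omega

theorem exists_block {K y : ℕ} (h : y < K * (K + 1)) :
    ∃ t < K, ∃ j < 2 * t + 2, y = t * (t + 1) + j := by
  induction K with
  | zero => omega
  | succ K ih =>
    by_cases hy : y < K * (K + 1)
    · obtain ⟨t, ht, h⟩ := ih hy
      exact ⟨t, by omega, h⟩
    · refine ⟨K, by omega, y - K * (K + 1), ?_, by omega⟩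
      have : (K + 1) * (K + 1 + 1) = K * (K + 1) + (2 * K + 2) := by ring
      omega

namespace IsEdgeListing

variable {h K : ℕ} {src tgt : ℕ → ℕ} (hE : IsEdgeListing h K src tgt)

include hE

theorem pathPos_lt {t : ℕ} (ht : t < K) (j : ℕ) : pathPos h src tgt t j < h + K * (K + 1) := by
  cases j with
  | zero => exact (hE.src_lt t ht).trans_le (Nat.le_add_right _ _)
  | succ j =>
    rw [pathPos]
    split_ifs with hj
    · have := block_le ht
      omega
    · exact (hE.tgt_lt t ht).trans_le (Nat.le_add_right _ _)

/-- The vertices on the paths. -/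
def vert (t : Fin K) (j : ℕ) : Fin (h + K * (K + 1)) :=
  ⟨pathPos h src tgt t j, hE.pathPos_lt t.2 j⟩

theorem pathSystem : PathSystem hE.vert {x | x.1 < h} where
  src_mem t := hE.src_lt t t.2
  tgt_mem t := by
    simp only [Set.mem_ofPred_eq, vert, pathPos_last]
    exact hE.tgt_lt t t.2
  ends_ne t := by
    simp only [ne_eq, vert, Fin.mk.injEq, pathPos_last]
    exact hE.ne t t.2
  inner_notMem t j h1 h2 := by
    have := pathPos_inner h src tgt h1 h2
    simp only [Set.mem_ofPred_eq, vert]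
    omega
  inner_inj t t' j j' h1 h2 h1' h2' heq := by
    have e1 := pathPos_inner h src tgt h1 h2
    have e2 := pathPos_inner h src tgt h1' h2'
    simp only [vert, Fin.mk.injEq] at heq
    rcases lt_trichotomy (t : ℕ) t' with hlt | hlt | hlt
    · have := block_le hlt
      omega
    · refine ⟨Fin.ext hlt, ?_⟩
      rw [hlt] at e1
      rw [hlt] at heq
      omega
    · have := block_le hlt
      omega
  inner_surj x hx := by
    simp only [Set.mem_ofPred_eq, not_lt] at hx
    obtain ⟨t, ht, j, hj, hy⟩ := exists_block (K := K) (y := x - h) (by have := x.2; omega)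
    refine ⟨⟨t, ht⟩, j + 1, by omega, by simp only; omega, Fin.ext ?_⟩
    have := pathPos_inner h src tgt (t := t) (j := j + 1) (by omega) (by omega)
    simp only [vert]
    omega

/-- The graph with the listed edges. -/
def graph : SimpleGraph (Fin h) :=
  SimpleGraph.fromEdgeSet (Set.range fun t : Fin K =>
    s((⟨src t, hE.src_lt t t.2⟩ : Fin h), ⟨tgt t, hE.tgt_lt t t.2⟩))

/-- The subdivision in which the edge number `t` receives `2 * t + 2` new vertices. -/
def subdivision : SimpleGraph (Fin (h + K * (K + 1))) :=
  SimpleGraph.fromEdgeSet (Set.range fun a : PathEdge K => s(edgeFst hE.vert a, edgeSnd hE.vert a))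

theorem enumerates_graph : EnumeratesEdges hE.graph
    (fun t : Fin K => (⟨src t, hE.src_lt t t.2⟩ : Fin h)) fun t => ⟨tgt t, hE.tgt_lt t t.2⟩ := by
  refine enumeratesEdges_fromEdgeSet (fun t ht => hE.ne t t.2 (Fin.mk.inj ht)) fun t t' htt' => ?_
  exact Fin.ext (hE.inj t t.2 t' t'.2 (congrArg (Sym2.map Fin.val) htt'))

theorem enumerates_subdivision :
    EnumeratesEdges hE.subdivision (edgeFst hE.vert) (edgeSnd hE.vert) :=
  enumeratesEdges_fromEdgeSet hE.pathSystem.edge_ne hE.pathSystem.edge_injective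

theorem vert_zero (t : Fin K) :
    hE.vert t 0 = Fin.castLE (Nat.le_add_right _ _) ⟨src t, hE.src_lt t t.2⟩ := rfl

theorem vert_last (t : Fin K) : hE.vert t (2 * t + 3) =
    Fin.castLE (Nat.le_add_right _ _) ⟨tgt t, hE.tgt_lt t t.2⟩ :=
  Fin.ext (pathPos_last h src tgt t)

theorem isAsymmetricSubdivision : IsAsymmetricSubdivision hE.graph hE.subdivision := by
  refine hE.pathSystem.isAsymmetricSubdivision hE.enumerates_subdivision hE.enumerates_graph
    (Fin.castLE_injective (Nat.le_add_right h (K * (K + 1)))) ?_ (fun t => rfl)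
    fun t => (hE.vert_last t).symm
  ext x
  constructor
  · rintro ⟨y, rfl⟩
    exact y.2
  · intro hx
    exact ⟨⟨x, hx⟩, rfl⟩

theorem isFreeDLA
    (hodd : ∀ x < h, Odd {t : Fin K | src t = x ∨ tgt t = x}.ncard)
    (hsep : ∀ x < h, ∃ t < K, ∃ t' < K, (x = src t ∨ x = tgt t) ∧ src t = src t' ∧
      tgt t ≠ src t' ∧ tgt t ≠ tgt t') :
    IsFreeDLA hE.subdivision := by
  refine hE.pathSystem.isFreeDLA hE.enumerates_subdivision (fun x hx => ?_) fun x hx => ?_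
  · convert hodd x hx using 6 with t
    · exact Fin.ext_iff
    · rw [Fin.ext_iff, vert_last]; rfl
  · obtain ⟨t, ht, t', ht', h1, h2, h3, h4⟩ := hsep x hx
    refine ⟨⟨t, ht⟩, ⟨t', ht'⟩, ?_⟩
    simp only [vert_zero, vert_last, Fin.ext_iff, Fin.val_castLE, ne_eq]
    exact ⟨h1, h2, h3, h4⟩

theorem ncard_edgeSet_subdivision : hE.subdivision.edgeSet.ncard = K * (K + 1) + K := by
  rw [hE.enumerates_subdivision.ncard_edgeSet, Fintype.card_sigma, ← sum_two_mul_add_two]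
  simp only [Fintype.card_fin, Finset.sum_add_distrib, Finset.sum_const, Finset.card_univ,
    smul_eq_mul]
  ring

end IsEdgeListing

/-! #### The odd graph -/

open Classical in
/-- Adjacency of numbers. -/
noncomputable def adjNat {n : ℕ} (G : SimpleGraph (Fin n)) (i j : ℕ) : Bool :=
  decide (∃ (hi : i < n) (hj : j < n), G.Adj ⟨i, hi⟩ ⟨j, hj⟩)

theorem adjNat_iff {n : ℕ} {G : SimpleGraph (Fin n)} {i j : ℕ} :
    adjNat G i j = true ↔ ∃ (hi : i < n) (hj : j < n), G.Adj ⟨i, hi⟩ ⟨j, hj⟩ := by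
  classical
  rw [adjNat, decide_eq_true_iff]

variable {n : ℕ} (G : SimpleGraph (Fin n))

/-- The edges from `i` to larger vertices below `k`. -/
noncomputable def edgeRow (i k : ℕ) : List (ℕ × ℕ) :=
  ((List.range k).filter fun j => decide (i < j) && adjNat G i j).map (Prod.mk i)

/-- The edges of `G`. -/
noncomputable def edgeList : List (ℕ × ℕ) :=
  (List.range n).flatMap fun i => edgeRow G i n

/-- For an edge list, one leaf for every end of an edge, and three leaves for every vertex. -/
def leafList (n : ℕ) (es : List (ℕ × ℕ)) : List ℕ :=
  es.flatMap (fun e => [e.1, e.2]) ++ (List.range n).flatMap fun i => [i, i, i]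

/-- The neighbours of the leaves. -/
noncomputable def leaves : List ℕ := leafList n (edgeList G)

/-- The edges of the odd graph: the edges of `G`, followed by the edges to the leaves. -/
noncomputable def oddList : List (ℕ × ℕ) := edgeList G ++ (leaves G).zipIdx n

/-- The first end of an edge of the odd graph. -/
noncomputable def oddSrc (t : ℕ) : ℕ := ((oddList G).getD t (0, 0)).1

/-- The second end of an edge of the odd graph. -/
noncomputable def oddTgt (t : ℕ) : ℕ := ((oddList G).getD t (0, 0)).2

theorem mem_edgeList {p : ℕ × ℕ} : p ∈ edgeList G ↔ p.1 < p.2 ∧ adjNat G p.1 p.2 = true := by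
  obtain ⟨i, j⟩ := p
  simp only [edgeList, edgeRow, List.mem_flatMap, List.mem_range, List.mem_map, List.mem_filter,
    Bool.and_eq_true, decide_eq_true_eq, Prod.mk.injEq]
  constructor
  · rintro ⟨_, _, _, h, rfl, rfl⟩
    exact h.2
  · intro h
    obtain ⟨hi, hj, -⟩ := adjNat_iff.mp h.2
    exact ⟨i, hi, j, ⟨hj, h⟩, rfl, rfl⟩

theorem lt_of_mem_edgeList {p : ℕ × ℕ} (h : p ∈ edgeList G) : p.1 < n ∧ p.2 < n := by
  obtain ⟨hi, hj, -⟩ := adjNat_iff.mp ((mem_edgeList G).mp h).2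
  exact ⟨hi, hj⟩

theorem nodup_edgeList : (edgeList G).Nodup := by
  rw [edgeList, List.nodup_flatMap]
  refine ⟨fun i _ => (List.nodup_range.filter _).map (Prod.mk_right_injective i), ?_⟩
  refine List.nodup_range.imp fun {i j} hij => ?_
  simp only [Function.onFun, List.disjoint_left, edgeRow, List.mem_map]
  rintro _ ⟨a, -, rfl⟩ ⟨b, -, h⟩
  exact hij (congrArg Prod.fst h).symm

theorem length_leaves : (leaves G).length = 2 * (edgeList G).length + 3 * n := by
  simp [leaves, leafList, List.length_flatMap, mul_comm]

theorem length_oddList : (oddList G).length = 3 * (edgeList G).length + 3 * n := by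
  simp only [oddList, List.length_append, List.length_zipIdx, length_leaves]
  ring

theorem lt_of_mem_leaves {a : ℕ} (h : a ∈ leaves G) : a < n := by
  simp only [leaves, leafList, List.mem_append, List.mem_flatMap, List.mem_range] at h
  rcases h with ⟨e, he, h⟩ | ⟨i, hi, h⟩
  · have := lt_of_mem_edgeList G he
    simp only [List.mem_cons, List.not_mem_nil, or_false] at h
    omega
  · simp only [List.mem_cons, List.not_mem_nil, or_false] at h
    omega

theorem odd_edge {t : ℕ} (ht : t < (edgeList G).length) :
    oddSrc G t = (edgeList G)[t].1 ∧ oddTgt G t = (edgeList G)[t].2 := by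
  simp [oddSrc, oddTgt, oddList, List.getD_eq_getElem?_getD, List.getElem?_append_left, ht]

theorem odd_leaf {s : ℕ} (hs : s < (leaves G).length) :
    oddSrc G ((edgeList G).length + s) = (leaves G)[s] ∧
      oddTgt G ((edgeList G).length + s) = n + s := by
  simp [oddSrc, oddTgt, oddList, List.getD_eq_getElem?_getD, hs]

theorem edge_or_leaf {t : ℕ} (ht : t < (oddList G).length) :
    t < (edgeList G).length ∨
      ∃ s < (leaves G).length, t = (edgeList G).length + s := by
  rw [oddList, List.length_append, List.length_zipIdx] at ht
  by_cases h : t < (edgeList G).length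
  · exact Or.inl h
  · exact Or.inr ⟨t - (edgeList G).length, by omega, by omega⟩

theorem odd_edge_lt {t : ℕ} (ht : t < (edgeList G).length) :
    oddSrc G t < oddTgt G t ∧ oddTgt G t < n := by
  rw [(odd_edge G ht).1, (odd_edge G ht).2]
  have h := List.getElem_mem ht
  exact ⟨((mem_edgeList G).mp h).1, (lt_of_mem_edgeList G h).2⟩

theorem odd_leaf_lt {s : ℕ} (hs : s < (leaves G).length) :
    oddSrc G ((edgeList G).length + s) < n := by
  rw [(odd_leaf G hs).1]
  exact lt_of_mem_leaves G (List.getElem_mem hs)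

theorem edge_inj {t t' : ℕ} (ht : t < (edgeList G).length) (ht' : t' < (edgeList G).length)
    (h : s(oddSrc G t, oddTgt G t) = s(oddSrc G t', oddTgt G t')) : t = t' := by
  have h1 := odd_edge_lt G ht
  have h2 := odd_edge_lt G ht'
  rw [← (nodup_edgeList G).getElem_inj_iff (hi := ht) (hj := ht'), Prod.ext_iff,
    ← (odd_edge G ht).1, ← (odd_edge G ht).2, ← (odd_edge G ht').1, ← (odd_edge G ht').2]
  rcases Sym2.eq_iff.mp h with h | h
  · exact h
  · omega

theorem isEdgeListing_odd :
    IsEdgeListing (n + (leaves G).length) (oddList G).length (oddSrc G) (oddTgt G) where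
  src_lt t ht := by
    rcases edge_or_leaf G ht with ht | ⟨s, hs, rfl⟩
    · have := odd_edge_lt G ht
      omega
    · have := odd_leaf_lt G hs
      omega
  tgt_lt t ht := by
    rcases edge_or_leaf G ht with ht | ⟨s, hs, rfl⟩
    · have := odd_edge_lt G ht
      omega
    · have := (odd_leaf G hs).2
      omega
  ne t ht := by
    rcases edge_or_leaf G ht with ht | ⟨s, hs, rfl⟩
    · exact (odd_edge_lt G ht).1.ne
    · have := (odd_leaf G hs).2
      have := odd_leaf_lt G hs
      omega
  inj t ht t' ht' h := by
    rcases edge_or_leaf G ht with ht | ⟨s, hs, rfl⟩ <;>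
      rcases edge_or_leaf G ht' with ht' | ⟨s', hs', rfl⟩
    · exact edge_inj G ht ht' h
    · have h1 := odd_edge_lt G ht
      have h2 := (odd_leaf G hs').2
      rcases Sym2.eq_iff.mp h with h | h <;> omega
    · have h1 := odd_edge_lt G ht'
      have h2 := (odd_leaf G hs).2
      rcases Sym2.eq_iff.mp h with h | h <;> omega
    · have h1 := odd_leaf_lt G hs
      have h2 := (odd_leaf G hs).2
      have h1' := odd_leaf_lt G hs'
      have h2' := (odd_leaf G hs').2
      rcases Sym2.eq_iff.mp h with h | h <;> omega

theorem enumerates_edgeList : EnumeratesEdges G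
    (fun t : Fin (edgeList G).length =>
      (⟨oddSrc G t, (odd_edge_lt G t.2).1.trans (odd_edge_lt G t.2).2⟩ : Fin n))
    (fun t => ⟨oddTgt G t, (odd_edge_lt G t.2).2⟩) where
  injective t t' h := Fin.ext (edge_inj G t.2 t'.2 (congrArg (Sym2.map Fin.val) h))
  range_eq := by
    have key : ∀ x y : Fin n, x < y → G.Adj x y → ∃ t : Fin (edgeList G).length,
        oddSrc G t = x ∧ oddTgt G t = y := by
      intro x y hxy h
      have : ((x : ℕ), (y : ℕ)) ∈ edgeList G :=
        (mem_edgeList G).mpr ⟨hxy, adjNat_iff.mpr ⟨x.2, y.2, h⟩⟩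
      obtain ⟨t, ht, hget⟩ := List.mem_iff_getElem.mp this
      refine ⟨⟨t, ht⟩, ?_⟩
      simp only [(odd_edge G ht).1, (odd_edge G ht).2, hget, and_self]
    ext e
    induction e with | _ x y
    rw [SimpleGraph.mem_edgeSet]
    constructor
    · rintro ⟨t, h⟩
      have hmem := ((mem_edgeList G).mp (List.getElem_mem t.2)).2
      obtain ⟨h1, h2, h3⟩ := adjNat_iff.mp hmem
      rw [← SimpleGraph.mem_edgeSet, ← h]
      change G.Adj _ _
      convert h3 using 1
      · exact Fin.ext (odd_edge G t.2).1
      · exact Fin.ext (odd_edge G t.2).2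
    · intro h
      rcases lt_or_gt_of_ne (G.ne_of_adj h) with hxy | hxy
      · obtain ⟨t, h1, h2⟩ := key x y hxy h
        exact ⟨t, Sym2.eq_iff.mpr (Or.inl ⟨Fin.ext h1, Fin.ext h2⟩)⟩
      · obtain ⟨t, h1, h2⟩ := key y x hxy h.symm
        exact ⟨t, Sym2.eq_iff.mpr (Or.inr ⟨Fin.ext h1, Fin.ext h2⟩)⟩

/-- The odd graph obtained from `G` by attaching leaves. -/
noncomputable def oddGraph : SimpleGraph (Fin (n + (leaves G).length)) :=
  (isEdgeListing_odd G).graph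

/-- The number of vertices of the reduction. -/
noncomputable def reducedSize : ℕ :=
  n + (leaves G).length + (oddList G).length * ((oddList G).length + 1)

/-- The asymmetric subdivision of the odd graph. -/
noncomputable def reducedGraph : SimpleGraph (Fin (reducedSize G)) :=
  (isEdgeListing_odd G).subdivision

/-- The two ends of an edge differ, so the disjunction is a sum of two indicators. The sum over the
list splits into the edges of `G` and the leaf edges. -/
theorem ncard_odd_edges (x : ℕ) :
    {t : Fin (oddList G).length | oddSrc G t = x ∨ oddTgt G t = x}.ncard =
      ((oddList G).map fun p => (if p.1 = x then 1 else 0) + if p.2 = x then 1 else 0).sum := by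
  classical
  rw [← Fin.sum_univ_fun_getElem, Set.ncard_eq_toFinset_card', Finset.card_eq_sum_ones]
  simp only [Set.toFinset_ofPred, Finset.sum_filter]
  refine Finset.sum_congr rfl fun t _ => ?_
  have h1 : (oddList G)[(t : ℕ)].1 = oddSrc G t := by simp [oddSrc]
  have h2 : (oddList G)[(t : ℕ)].2 = oddTgt G t := by simp [oddTgt]
  have h3 := (isEdgeListing_odd G).ne t t.2
  rw [h1, h2]
  by_cases h : oddSrc G t = x
  · have h' : oddTgt G t ≠ x := fun h' => h3 (h.trans h'.symm)
    simp [h, h']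
  · simp [h]

theorem sum_map_ite_eq (l : List ℕ) (x : ℕ) :
    (l.map fun a => if a = x then 1 else 0).sum = l.count x := by
  induction l with
  | nil => rfl
  | cons a l ih =>
    by_cases h : a = x <;> simp [ih, h, add_comm]

/-- The sum is the degree of `x` in `G`, written in the same form as in `ncard_odd_edges`, so that
the two add up to an even number. -/
theorem count_leaves {x : ℕ} (hx : x < n) : (leaves G).count x =
    ((edgeList G).map fun p => (if p.1 = x then 1 else 0) + if p.2 = x then 1 else 0).sum + 3 := by
  rw [leaves, leafList, List.count_append]
  congr 1
  · rw [List.count_flatMap]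
    congr 1
    refine List.map_congr_left fun p _ => ?_
    by_cases h1 : p.1 = x <;> by_cases h2 : p.2 = x <;> simp [h1, h2]
  · rw [List.count_flatMap]
    have : List.map (List.count x ∘ fun i => [i, i, i]) (List.range n) =
        List.map (fun i => 3 * if i = x then 1 else 0) (List.range n) := by
      refine List.map_congr_left fun i _ => ?_
      by_cases h1 : i = x <;> simp [h1]
    rw [this, List.sum_map_mul_left, sum_map_ite_eq,
      List.count_eq_one_of_mem List.nodup_range (List.mem_range.mpr hx)]
    rfl

/-- The degree is $2d+3$ at a vertex of `G` of degree $d$, and $1$ at a leaf. -/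
theorem odd_degree {x : ℕ} (hx : x < n + (leaves G).length) :
    Odd {t : Fin (oddList G).length | oddSrc G t = x ∨ oddTgt G t = x}.ncard := by
  rw [ncard_odd_edges, oddList, List.map_append, List.sum_append]
  by_cases h : x < n
  · have : List.map (fun p : ℕ × ℕ => (if p.1 = x then 1 else 0) + if p.2 = x then 1 else 0)
        ((leaves G).zipIdx n) = List.map (fun a => if a = x then 1 else 0)
          (((leaves G).zipIdx n).map Prod.fst) := by
      rw [List.map_map]
      refine List.map_congr_left fun p hp => ?_
      have := List.le_snd_of_mem_zipIdx hp
      have : p.2 ≠ x := by omega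
      simp [this]
    rw [this, List.zipIdx_map_fst, sum_map_ite_eq, count_leaves G h, ← add_assoc, ← two_mul]
    exact ⟨_ + 1, by ring⟩
  · have h1 : List.map (fun p : ℕ × ℕ => (if p.1 = x then 1 else 0) + if p.2 = x then 1 else 0)
        (edgeList G) = List.map (fun _ => 0) (edgeList G) := by
      refine List.map_congr_left fun p hp => ?_
      have := lt_of_mem_edgeList G hp
      rw [if_neg (by omega), if_neg (by omega)]
    have h2 : List.map (fun p : ℕ × ℕ => (if p.1 = x then 1 else 0) + if p.2 = x then 1 else 0)
        ((leaves G).zipIdx n) = List.map (fun a => if a = x then 1 else 0)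
          (((leaves G).zipIdx n).map Prod.snd) := by
      rw [List.map_map]
      refine List.map_congr_left fun p hp => ?_
      have := lt_of_mem_leaves G (List.fst_mem_of_mem_zipIdx hp)
      rw [if_neg (by omega)]
      simp
    rw [h1, h2, List.zipIdx_map_snd, sum_map_ite_eq,
      List.count_eq_one_of_mem List.nodup_range' (List.mem_range'_1.mpr (by omega))]
    simp

theorem exists_ne_leaf {s : ℕ} (hs : s < (leaves G).length) :
    ∃ s' < (leaves G).length, s' ≠ s ∧
      oddSrc G ((edgeList G).length + s') = oddSrc G ((edgeList G).length + s) := by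
  set a := (leaves G)[s] with ha
  have h3 : 2 ≤ (leaves G).count a := by
    rw [count_leaves G (lt_of_mem_leaves G (List.getElem_mem hs))]
    omega
  obtain ⟨i, j, hij, h1, h2⟩ :=
    List.duplicate_iff_exists_distinct_get.mp (List.duplicate_iff_two_le_count.mpr h3)
  have hlt : (i : ℕ) < j := hij
  rw [(odd_leaf G hs).1]
  by_cases h : (i : ℕ) = s
  · exact ⟨j, j.2, by omega, by rw [(odd_leaf G j.2).1, ← ha]; exact h2.symm⟩
  · exact ⟨i, i.2, h, by rw [(odd_leaf G i.2).1, ← ha]; exact h1.symm⟩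

/-- Every vertex lies on a leaf edge, and its first end carries another one with a different leaf.
The three extra leaves ensure this even at a vertex without edges in `G`. -/
theorem exists_separating {x : ℕ} (hx : x < n + (leaves G).length) :
    ∃ t < (oddList G).length, ∃ t' < (oddList G).length, (x = oddSrc G t ∨ x = oddTgt G t) ∧
      oddSrc G t = oddSrc G t' ∧ oddTgt G t ≠ oddSrc G t' ∧ oddTgt G t ≠ oddTgt G t' := by
  have hlen : (oddList G).length = (edgeList G).length + (leaves G).length := by
    simp [oddList]
  obtain ⟨s, hs, hxs⟩ : ∃ s < (leaves G).length, x = oddSrc G ((edgeList G).length + s) ∨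
      x = oddTgt G ((edgeList G).length + s) := by
    by_cases h : x < n
    · have hmem : x ∈ leaves G := by
        rw [← List.count_pos_iff, count_leaves G h]
        omega
      obtain ⟨s, hs, hget⟩ := List.mem_iff_getElem.mp hmem
      exact ⟨s, hs, Or.inl (by rw [(odd_leaf G hs).1, hget])⟩
    · exact ⟨x - n, by omega, Or.inr (by rw [(odd_leaf G (by omega)).2]; omega)⟩
  obtain ⟨s', hs', hne, heq⟩ := exists_ne_leaf G hs
  have h1 := (odd_leaf G hs).2
  have h2 := (odd_leaf G hs').2
  have h3 := odd_leaf_lt G hs'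
  exact ⟨_, by omega, _, by omega, hxs, heq.symm, by omega, by omega⟩

theorem isFreeDLA_reducedGraph : IsFreeDLA (reducedGraph G) :=
  (isEdgeListing_odd G).isFreeDLA (fun _ hx => odd_degree G hx) fun _ hx => exists_separating G hx

theorem oddGraph_adj {x y : Fin (n + (leaves G).length)} : (oddGraph G).Adj x y ↔
    ∃ t < (oddList G).length, x.1 = oddSrc G t ∧ y.1 = oddTgt G t ∨
      x.1 = oddTgt G t ∧ y.1 = oddSrc G t := by
  rw [oddGraph, (isEdgeListing_odd G).enumerates_graph.adj_iff]
  simp only [Sym2.eq_iff, Fin.ext_iff, Fin.exists_iff, exists_prop]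
  refine exists_congr fun t => and_congr_right fun _ => ?_
  rw [eq_comm (a := x.1), eq_comm (a := y.1), eq_comm (a := x.1), eq_comm (a := y.1),
    and_comm (a := oddSrc G t = y.1)]

theorem connected_oddGraph (hG : G.Connected) : (oddGraph G).Connected := by
  have hle : n ≤ n + (leaves G).length := Nat.le_add_right _ _
  let φ : G →g oddGraph G := ⟨Fin.castLE hle, by
    intro x y h
    obtain ⟨t, ht⟩ := (enumerates_edgeList G).adj_iff.mp h
    have hlen : (oddList G).length = (edgeList G).length + (leaves G).length := by
      simp [oddList]
    refine (oddGraph_adj G).mpr ⟨t, by omega, ?_⟩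
    rcases Sym2.eq_iff.mp ht with ⟨h1, h2⟩ | ⟨h1, h2⟩
    · exact Or.inl ⟨congrArg Fin.val h1.symm, congrArg Fin.val h2.symm⟩
    · exact Or.inr ⟨congrArg Fin.val h2.symm, congrArg Fin.val h1.symm⟩⟩
  have key : ∀ x, ∃ a, (oddGraph G).Reachable x (φ a) := by
    intro x
    by_cases hx : x.1 < n
    · exact ⟨⟨x, hx⟩, SimpleGraph.Reachable.refl _⟩
    · have hs : x.1 - n < (leaves G).length := by omega
      refine ⟨⟨_, odd_leaf_lt G hs⟩, SimpleGraph.Adj.reachable ((oddGraph_adj G).mpr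
        ⟨(edgeList G).length + (x.1 - n), by simp [oddList]; omega, Or.inr ⟨?_, rfl⟩⟩)⟩
      rw [(odd_leaf G hs).2]
      omega
  have := hG.nonempty
  refine SimpleGraph.connected_iff _ |>.mpr ⟨fun x y => ?_, this.map φ⟩
  obtain ⟨a, ha⟩ := key x
  obtain ⟨b, hb⟩ := key y
  exact ha.trans (((hG.preconnected a b).map φ).trans hb.symm)

theorem isOddGraph_oddGraph (hG : G.Connected) : IsOddGraph (oddGraph G) where
  connected := connected_oddGraph G hG
  three_le_card := by
    have h : 0 < n := Fin.pos_iff_nonempty.mpr hG.nonempty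
    rw [Fintype.card_fin, length_leaves]
    omega
  odd_degree x := by
    rw [oddGraph, (isEdgeListing_odd G).enumerates_graph.ncard_neighborSet]
    convert odd_degree G x.2 using 6 <;> exact Fin.ext_iff

theorem isAsymmetricallySubdividedOddGraph_reducedGraph (hG : G.Connected) :
    IsAsymmetricallySubdividedOddGraph (reducedGraph G) :=
  ⟨_, oddGraph G, isOddGraph_oddGraph G hG, (isEdgeListing_odd G).isAsymmetricSubdivision⟩

theorem length_edgeList : (edgeList G).length = G.edgeSet.ncard := by
  rw [(enumerates_edgeList G).ncard_edgeSet, Fintype.card_fin]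

theorem reducedSize_le (hG : G.Connected) :
    reducedSize G ≤ 100 * max 1 (G.edgeSet.ncard ^ 2) ∧
      (reducedGraph G).edgeSet.ncard ≤ 100 * max 1 (G.edgeSet.ncard ^ 2) := by
  have hn : n ≤ G.edgeSet.ncard + 1 := by
    simpa using hG.card_vert_le_card_edgeSet_add_one
  have h1 := (isEdgeListing_odd G).ncard_edgeSet_subdivision
  have h0 : (reducedGraph G).edgeSet.ncard = _ := h1
  rw [h0, reducedSize, length_leaves, length_oddList, length_edgeList]
  generalize G.edgeSet.ncard = E at hn
  rcases Nat.eq_zero_or_pos E with rfl | hE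
  · constructor <;> · simp; nlinarith
  -- By connectedness $n\le E+1$. For $E\ge1$ one has $(6E+3)(6E+4)\le 90E^2$ and $4n+2E\le 10E^2$,
  -- hence the constant $100$; a single edge attains it.
  · have h2 : E ^ 2 ≤ max 1 (E ^ 2) := le_max_right _ _
    have h3 : (3 * E + 3 * n) * (3 * E + 3 * n + 1) ≤ (6 * E + 3) * (6 * E + 3 + 1) :=
      Nat.mul_le_mul (by omega) (by omega)
    constructor <;> nlinarith

/-! #### Cuts of the reduced graph -/

theorem le_reducedSize : n ≤ reducedSize G := by
  rw [reducedSize, add_assoc]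
  exact Nat.le_add_right _ _

/-- The restriction of a colouring of the reduced graph to the vertices of `G`. -/
noncomputable def restrictCut (C : Fin (reducedSize G) → Bool) (x : Fin n) : Bool :=
  C (Fin.castLE (le_reducedSize G) x)

/-- The contribution of the edge number `t` of the odd graph to a cut. -/
noncomputable def oddEdgeCut (C : Fin (reducedSize G) → Bool) (t : Fin (oddList G).length) : ℕ :=
  if C ((isEdgeListing_odd G).vert t 0) = C ((isEdgeListing_odd G).vert t (2 * t + 3))
    then 0 else 1

theorem reducedSize_sub : reducedSize G =
    n + ((oddList G).length * ((oddList G).length + 1) + (leaves G).length) := by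
  unfold reducedSize
  ring

/-- `d` extends the contributions by zero to all numbers, so that the sum can be split after the
edges of `G`, which contribute the cut of the restriction. -/
theorem sum_oddEdgeCut (C : Fin (reducedSize G) → Bool) :
    ∃ d : ℕ → ℕ, (∀ t, oddEdgeCut G C t = d t) ∧
    ∑ t, oddEdgeCut G C t = cutSize G (restrictCut G C) +
      ∑ s : Fin (leaves G).length, d ((edgeList G).length + s) := by
  let d : ℕ → ℕ := fun t => if h : t < (oddList G).length then oddEdgeCut G C ⟨t, h⟩ else 0
  have hd : ∀ t, oddEdgeCut G C t = d t := fun t => by simp [d]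
  have hlen : (oddList G).length = (edgeList G).length + (leaves G).length := by
    simp [oddList]
  refine ⟨d, hd, ?_⟩
  simp only [hd]
  rw [Fin.sum_univ_eq_sum_range d, hlen, Finset.sum_range_add, Finset.sum_range,
    Finset.sum_range (n := (leaves G).length), (enumerates_edgeList G).cutSize_eq]
  congr 1
  refine Finset.sum_congr rfl fun t _ => ?_
  have ht : (t : ℕ) < (oddList G).length := by omega
  simp only [d, ht, dif_pos, oddEdgeCut, IsEdgeListing.vert_last]
  rfl

/-- Each path contributes at most $2t+2$ beyond its edge in the odd graph, and each leaf edge at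
most one. -/
theorem cutSize_reducedGraph_le (C : Fin (reducedSize G) → Bool) :
    cutSize (reducedGraph G) C ≤ cutSize G (restrictCut G C) +
      ((oddList G).length * ((oddList G).length + 1) + (leaves G).length) := by
  obtain ⟨d, hd, hsum⟩ := sum_oddEdgeCut G C
  have h1 := cutSize_paths_le (isEdgeListing_odd G).enumerates_subdivision C
  have h2 : ∑ s : Fin (leaves G).length, d ((edgeList G).length + s) ≤
      ∑ _s : Fin (leaves G).length, 1 := by
    refine Finset.sum_le_sum fun s _ => ?_
    have := hd ⟨(edgeList G).length + s, by simp [oddList]⟩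
    rw [← this, oddEdgeCut]
    split_ifs <;> simp
  rw [Finset.sum_add_distrib, sum_two_mul_add_two] at h1
  simp only [Finset.sum_const, Finset.card_univ, Fintype.card_fin, smul_eq_mul, mul_one] at h2
  have h3 : cutSize (reducedGraph G) C ≤ _ := h1
  simp only [oddEdgeCut] at hsum
  omega

/-- A colouring that alternates along the paths and on the edges to the leaves. -/
structure IsAlternating (c : ℕ → Bool) : Prop where
  leaf : ∀ s < (leaves G).length, c (n + s) = !c (oddSrc G ((edgeList G).length + s))
  path : ∀ t < (oddList G).length, ∀ i < 2 * t + 2,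
    c (pathPos (n + (leaves G).length) (oddSrc G) (oddTgt G) t (i + 1)) =
      !c (pathPos (n + (leaves G).length) (oddSrc G) (oddTgt G) t i)

theorem cutSize_of_isAlternating {c : ℕ → Bool} (hc : IsAlternating G c) :
    cutSize (reducedGraph G) (fun x => c x) = cutSize G (fun x => c x) +
      ((oddList G).length * ((oddList G).length + 1) + (leaves G).length) := by
  obtain ⟨d, hd, hsum⟩ := sum_oddEdgeCut G fun x => c x
  have h1 := cutSize_paths_of_alternating (isEdgeListing_odd G).enumerates_subdivision
    (fun x => c x) fun t i hi => hc.path t t.2 i hi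
  have h2 : ∑ s : Fin (leaves G).length, d ((edgeList G).length + s) =
      ∑ _s : Fin (leaves G).length, 1 := by
    refine Finset.sum_congr rfl fun s _ => ?_
    have := hd ⟨(edgeList G).length + s, by simp [oddList]⟩
    rw [← this, oddEdgeCut, if_neg]
    simp only [IsEdgeListing.vert_zero, IsEdgeListing.vert_last, Fin.val_castLE,
      (odd_leaf G s.2).2, hc.leaf s s.2]
    cases c (oddSrc G ((edgeList G).length + s)) <;> simp
  rw [Finset.sum_add_distrib, sum_two_mul_add_two] at h1
  simp only [Finset.sum_const, Finset.card_univ, Fintype.card_fin, smul_eq_mul, mul_one] at h2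
  have h3 : cutSize (reducedGraph G) (fun x => c x) = _ := h1
  simp only [oddEdgeCut] at hsum
  have h4 : (restrictCut G fun x => c x) = fun x : Fin n => c x := rfl
  rw [h4] at hsum
  omega

end Construction

/-! ### Reasoning about programs with time bounds -/

section ProgramLogic

/-- Started in `σ`, the program `p` halts after at most `t` steps in a state satisfying `Q`. -/
def HaltsWithin (p : Program) (σ : RamState) (t : ℕ) (Q : RamState → Prop) : Prop :=
  ∃ (τ : RamState) (s : ℕ), s ≤ t ∧ Run p σ τ s ∧ Q τ

theorem HaltsWithin.mono {p : Program} {σ : RamState} {t t' : ℕ} {Q Q' : RamState → Prop}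
    (h : HaltsWithin p σ t Q) (ht : t ≤ t') (hQ : ∀ τ, Q τ → Q' τ) : HaltsWithin p σ t' Q' := by
  obtain ⟨τ, s, hs, hr, hq⟩ := h
  exact ⟨τ, s, hs.trans ht, hr, hQ τ hq⟩

theorem HaltsWithin.seq {p q : Program} {σ : RamState} {t₁ t₂ : ℕ} {P Q : RamState → Prop}
    (hp : HaltsWithin p σ t₁ P) (hq : ∀ τ, P τ → HaltsWithin q τ t₂ Q) :
    HaltsWithin (.seq p q) σ (t₁ + t₂) Q := by
  obtain ⟨τ, s, hs, hr, hP⟩ := hp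
  obtain ⟨υ, s', hs', hr', hQ⟩ := hq τ hP
  exact ⟨υ, s + s', by omega, .seq hr hr', hQ⟩

/-- A sequence of elementary instructions. -/
def block : List Instr → Program
  | [] => .skip
  | c :: l => .seq (.instr c) (block l)

/-- The effect of a sequence of elementary instructions. -/
def execAll : List Instr → RamState → RamState
  | [], σ => σ
  | c :: l, σ => execAll l (c.exec σ)

theorem haltsWithin_block {l : List Instr} {σ : RamState} {Q : RamState → Prop}
    (h : Q (execAll l σ)) : HaltsWithin (block l) σ (l.length + 1) Q := by
  induction l generalizing σ with
  | nil => exact ⟨σ, 1, le_rfl, .skip σ, h⟩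
  | cons c l ih =>
    obtain ⟨τ, s, hs, hr, hq⟩ := ih h
    exact ⟨τ, 1 + s, by simp only [List.length_cons]; omega, .seq (.instr c σ) hr, hq⟩

/-- A loop that is executed `N` times, with an invariant depending on the number of rounds. -/
theorem haltsWithin_loop {r : ℕ} {p : Program} {σ : RamState} {N b : ℕ}
    (I : ℕ → RamState → Prop) (h0 : I 0 σ) (hr : ∀ i ≤ N, ∀ τ, I i τ → (τ.reg r = 0 ↔ i = N))
    (step : ∀ i < N, ∀ τ, I i τ → HaltsWithin p τ b (I (i + 1))) :
    HaltsWithin (.loop r p) σ (N * (b + 1) + 1) (I N) := by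
  have key : ∀ k i σ, i + k = N → I i σ →
      HaltsWithin (.loop r p) σ (k * (b + 1) + 1) (I N) := by
    intro k
    induction k with
    | zero =>
      intro i σ hi hI
      obtain rfl : i = N := hi
      exact ⟨σ, 1, by omega, .loop_done ((hr i le_rfl σ hI).mpr rfl), hI⟩
    | succ k ih =>
      intro i σ hi hI
      obtain ⟨τ, s, hs, hrun, hI'⟩ := step i (by omega) σ hI
      obtain ⟨υ, s', hs', hrun', hN⟩ := ih (i + 1) τ (by omega) hI'
      refine ⟨υ, s + s' + 1, by rw [Nat.succ_mul]; omega, .loop_step (fun h => ?_) hrun hrun', hN⟩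
      have := (hr i (by omega) σ hI).mp h
      omega
  exact key N 0 σ (by omega) h0

end ProgramLogic

/-! ### Programs that list the edges of the odd graph -/

section Programs

set_option linter.unusedSimpArgs false
set_option linter.unusedVariables false

/-- Arrays that list the pairs in `l`. -/
def Lists (f g : ℕ → ℕ) (l : List (ℕ × ℕ)) : Prop :=
  ∀ k < l.length, f k = (l.getD k (0, 0)).1 ∧ g k = (l.getD k (0, 0)).2

/-- `listEdges` writes every candidate pair behind the list and then decides whether to count it; a
rejected pair does no harm. -/
theorem Lists.update {f g : ℕ → ℕ} {l : List (ℕ × ℕ)} (h : Lists f g l) (a b : ℕ) :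
    Lists (Function.update f l.length a) (Function.update g l.length b) l := by
  intro k hk
  rw [Function.update_of_ne hk.ne, Function.update_of_ne hk.ne]
  exact h k hk

theorem Lists.append {f g : ℕ → ℕ} {l : List (ℕ × ℕ)} (h : Lists f g l) (a b : ℕ) :
    Lists (Function.update f l.length a) (Function.update g l.length b) (l ++ [(a, b)]) := by
  intro k hk
  rw [List.length_append, List.length_singleton] at hk
  by_cases hkl : k < l.length
  · rw [List.getD_append _ _ _ _ hkl]
    exact h.update a b k hkl
  · obtain rfl : k = l.length := by omega
    simp

theorem Lists.append_two {f g : ℕ → ℕ} {l : List (ℕ × ℕ)} (h : Lists f g l) (a b c d : ℕ) :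
    Lists (Function.update (Function.update f l.length a) (l.length + 1) c)
      (Function.update (Function.update g l.length b) (l.length + 1) d) (l ++ [(a, b), (c, d)]) := by
  have h' := (h.append a b).append c d
  rwa [List.length_append, List.length_singleton, List.append_assoc, List.singleton_append] at h'

theorem Lists.append_three {f g : ℕ → ℕ} {l : List (ℕ × ℕ)} (h : Lists f g l)
    (a b c d a' b' : ℕ) :
    Lists (Function.update (Function.update (Function.update f l.length a) (l.length + 1) c)
        (l.length + 2) a')
      (Function.update (Function.update (Function.update g l.length b) (l.length + 1) d)
        (l.length + 2) b') (l ++ [(a, b), (c, d), (a', b')]) := by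
  have h' := (h.append_two a b c d).append a' b'
  rwa [List.length_append, List.append_assoc] at h'

/-- The register `2` receives the number of ones at the beginning of the input. -/
def parse : Program :=
  .seq (block [.const 1 1, .const 2 0, .const 19 0, .load 10 0 2])
    (.loop 10 (block [.add 2 2 1, .load 10 0 2]))

/-- The constants, the number of vertices and the input are available. -/
structure Base (n : ℕ) (inp : ℕ → ℕ) (σ : RamState) : Prop where
  one : σ.reg 1 = 1
  zero : σ.reg 19 = 0
  size : σ.reg 2 = n
  input : σ.arr 0 = inp

theorem haltsWithin_parse {n : ℕ} {inp : ℕ → ℕ} (h1 : ∀ i < n, inp i ≠ 0) (h2 : inp n = 0)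
    (σ : RamState) (hσ : σ.arr 0 = inp) (hσ' : σ.arr 1 = fun _ => 0) :
    HaltsWithin parse σ (4 * n + 6) fun τ => Base n inp τ ∧ τ.arr 1 = fun _ => 0 := by
  let I : ℕ → RamState → Prop := fun i τ => Base i inp τ ∧ τ.reg 10 = inp i ∧ τ.arr 1 = fun _ => 0
  refine ((haltsWithin_block ?_).seq (t₂ := n * (3 + 1) + 1) fun τ hτ =>
    haltsWithin_loop (N := n) I hτ ?_ ?_).mono ?_ ?_
  · refine ⟨⟨?_, ?_, ?_, ?_⟩, ?_, ?_⟩ <;> simp [execAll, Instr.exec, hσ, hσ']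
  · rintro i hi τ ⟨-, h, -⟩
    rw [h]
    constructor
    · intro h
      by_contra hne
      exact h1 i (by omega) h
    · rintro rfl
      exact h2
  · rintro i hi τ ⟨⟨e1, e2, e3, e4⟩, e5, e6⟩
    refine haltsWithin_block ?_
    refine ⟨⟨?_, ?_, ?_, ?_⟩, ?_, ?_⟩ <;> simp [execAll, Instr.exec, e1, e2, e3, e4, e6]
  · simp only [List.length_cons, List.length_nil]; omega
  · rintro τ ⟨h, -, h'⟩
    exact ⟨h, h'⟩

/-- Listing the edges of the graph. -/
def listEdges : Program :=
  .seq (block [.add 5 2 1, .const 6 0, .const 3 0, .add 8 2 19])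
    (.loop 8 (.seq (block [.const 7 0, .add 9 2 19])
      (.seq (.loop 9 (block [.load 10 0 5, .sub 11 7 6, .sub 12 10 11, .sub 10 10 12,
          .store 2 3 6, .store 3 3 7, .add 3 3 10, .add 5 5 1, .add 7 7 1, .sub 9 9 1]))
        (block [.add 6 6 1, .sub 8 8 1]))))

variable {n : ℕ} (G : SimpleGraph (Fin n))

/-- The input array starts with the encoding of `G`. -/
structure IsInput (inp : ℕ → ℕ) : Prop where
  size : ∀ i < n, inp i ≠ 0
  sep : inp n = 0
  adj : ∀ i < n, ∀ j < n, inp (n + 1 + i * n + j) = (adjNat G i j).toNat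

/-- The state after listing the pairs in `l`. -/
structure Listed (inp : ℕ → ℕ) (l : List (ℕ × ℕ)) (σ : RamState) : Prop where
  base : Base n inp σ
  output : σ.arr 1 = fun _ => 0
  length : σ.reg 3 = l.length
  lists : Lists (σ.arr 2) (σ.arr 3) l

theorem edgeRow_succ (i j : ℕ) : edgeRow G i (j + 1) =
    edgeRow G i j ++ if i < j ∧ adjNat G i j = true then [(i, j)] else [] := by
  rw [edgeRow, List.range_succ, List.filter_append, List.map_append, edgeRow]
  congr 1
  by_cases h1 : i < j <;> by_cases h2 : adjNat G i j = true <;> simp [h1, h2]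

/-- Two truncated subtractions compute the minimum of the adjacency bit and $j-i$. This is $1$
exactly for an edge with $i<j$, and it is added to the length of the list, so no branching is
needed. -/
theorem haltsWithin_listEdges {inp : ℕ → ℕ} (hinp : IsInput G inp) (σ : RamState)
    (hσ : Base n inp σ ∧ σ.arr 1 = fun _ => 0) :
    HaltsWithin listEdges σ (n * (n * 12 + 9) + 6) fun τ =>
      Listed (n := n) inp (edgeList G) τ ∧ τ.reg 5 = n + 1 + n * n := by
  let l : ℕ → List (ℕ × ℕ) := fun i => (List.range i).flatMap fun i => edgeRow G i n
  have hl : ∀ i, l (i + 1) = l i ++ edgeRow G i n := fun i => by simp [l, List.range_succ]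
  let I : ℕ → RamState → Prop := fun i τ => Listed (n := n) inp (l i) τ ∧
    τ.reg 5 = n + 1 + i * n ∧ τ.reg 6 = i ∧ τ.reg 8 = n - i
  let J : ℕ → ℕ → RamState → Prop := fun i j τ =>
    Listed (n := n) inp (l i ++ edgeRow G i j) τ ∧
    τ.reg 5 = n + 1 + i * n + j ∧ τ.reg 6 = i ∧ τ.reg 7 = j ∧ τ.reg 8 = n - i ∧ τ.reg 9 = n - j
  obtain ⟨⟨e1, e2, e3, e4⟩, e5⟩ := hσ
  refine ((haltsWithin_block ?_).seq (t₂ := n * ((3 + ((n * (11 + 1) + 1) + 3)) + 1) + 1)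
    fun τ hτ => haltsWithin_loop (N := n) I hτ ?_ ?_).mono ?_ ?_
  · refine ⟨⟨⟨?_, ?_, ?_, ?_⟩, ?_, ?_, ?_⟩, ?_, ?_, ?_⟩ <;>
      simp [execAll, Instr.exec, e1, e2, e3, e4, e5, l, Lists]
  · rintro i hi τ ⟨-, -, -, h⟩
    omega
  · rintro i hi τ ⟨⟨⟨e1, e2, e3, e4⟩, e5, e6, e7⟩, e8, e9, e10⟩
    refine (haltsWithin_block ?_).seq fun τ hτ => (haltsWithin_loop (N := n) (J i) hτ ?_ ?_).seq
      fun τ hτ => haltsWithin_block ?_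
    · refine ⟨⟨⟨?_, ?_, ?_, ?_⟩, ?_, ?_, ?_⟩, ?_, ?_, ?_, ?_, ?_⟩ <;>
        simp [execAll, Instr.exec, e1, e2, e3, e4, e5, e6, e7, e8, e9, e10, edgeRow]
    · rintro j hj τ ⟨-, -, -, -, -, h⟩
      omega
    · rintro j hj τ ⟨⟨⟨e1, e2, e3, e4⟩, e5, e6, e7⟩, e8, e9, e10, e11, e12⟩
      refine haltsWithin_block ?_
      have e13 := hinp.adj i hi j hj
      refine ⟨⟨⟨?_, ?_, ?_, ?_⟩, ?_, ?_, ?_⟩, ?_, ?_, ?_, ?_, ?_⟩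
      case refine_6 =>
        simp only [execAll, Instr.exec]
        simp [e1, e2, e3, e4, e5, e6, e8, e9, e10, e11, e12, e13, edgeRow_succ]
        by_cases h1 : i < j <;> by_cases h2 : adjNat G i j = true <;> simp [h1, h2] <;> omega
      case refine_7 =>
        rw [edgeRow_succ, ← List.append_assoc]
        simp only [execAll, Instr.exec]
        simp [e1, e4, e6, e8, e9, e10, e12, e13]
        rw [← List.length_append]
        split_ifs
        · rw [← List.append_assoc]
          exact e7.append i j
        · rw [List.append_nil]
          exact e7.update i j
      all_goals
        simp [execAll, Instr.exec, e1, e2, e3, e4, e5, e6, e7, e8, e9, e10, e11, e12, e13]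
      all_goals omega
    · obtain ⟨⟨⟨e1, e2, e3, e4⟩, e5, e6, e7⟩, e8, e9, e10, e11, e12⟩ := hτ
      refine ⟨⟨⟨?_, ?_, ?_, ?_⟩, ?_, ?_, ?_⟩, ?_, ?_, ?_⟩ <;>
        simp [execAll, Instr.exec, e1, e2, e3, e4, e5, e6, e7, e8, e9, e10, e11, e12]
      · rw [← List.length_append, ← hl]
      · rw [hl]
        exact e7
      · rw [Nat.succ_mul]
        omega
      · omega
  · simp only [List.length_cons, List.length_nil]; nlinarith
  · rintro τ ⟨h, h', -⟩
    exact ⟨h, h'⟩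

/-- Attaching the leaves. -/
def addLeaves : Program :=
  .seq (block [.add 13 3 19, .add 4 2 19, .add 8 3 19, .const 6 0])
    (.seq (.loop 8 (block [.load 10 2 6, .load 11 3 6,
        .store 2 3 10, .store 3 3 4, .add 4 4 1, .add 3 3 1,
        .store 2 3 11, .store 3 3 4, .add 4 4 1, .add 3 3 1, .add 6 6 1, .sub 8 8 1]))
      (.seq (block [.const 6 0, .add 8 2 19])
        (.loop 8 (block [.store 2 3 6, .store 3 3 4, .add 4 4 1, .add 3 3 1,
          .store 2 3 6, .store 3 3 4, .add 4 4 1, .add 3 3 1,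
          .store 2 3 6, .store 3 3 4, .add 4 4 1, .add 3 3 1, .add 6 6 1, .sub 8 8 1]))))

/-- The state after listing the edges `es` and the edges to the leaves at `ls`. -/
structure Attached (inp : ℕ → ℕ) (es : List (ℕ × ℕ)) (ls : List ℕ) (σ : RamState) : Prop where
  listed : Listed (n := n) inp (es ++ ls.zipIdx n) σ
  edges : σ.reg 13 = es.length
  size : σ.reg 4 = n + ls.length
  pos : σ.reg 5 = n + 1 + n * n

theorem haltsWithin_addLeaves {inp : ℕ → ℕ} {es : List (ℕ × ℕ)} (σ : RamState)
    (hσ : Listed (n := n) inp es σ ∧ σ.reg 5 = n + 1 + n * n) :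
    HaltsWithin addLeaves σ (es.length * 14 + n * 16 + 10)
      (Attached (n := n) inp es (leafList n es)) := by
  let X : ℕ → List ℕ := fun t => (es.take t).flatMap fun e => [e.1, e.2]
  let Y : ℕ → List ℕ := fun i => es.flatMap (fun e => [e.1, e.2]) ++
    (List.range i).flatMap fun i => [i, i, i]
  have hX : ∀ t (ht : t < es.length), X (t + 1) = X t ++ [es[t].1, es[t].2] := fun t ht => by
    simp only [X]
    rw [List.take_succ_eq_append_getElem ht, List.flatMap_append, List.flatMap_singleton]
  have hY : ∀ i, Y (i + 1) = Y i ++ [i, i, i] := fun i => by simp [Y, List.range_succ]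
  have hX0 : X 0 = [] := by simp [X]
  have hXY : X es.length = Y 0 := by simp [X, Y]
  let I : ℕ → RamState → Prop := fun t τ => Attached (n := n) inp es (X t) τ ∧
    τ.reg 6 = t ∧ τ.reg 8 = es.length - t
  let J : ℕ → RamState → Prop := fun i τ => Attached (n := n) inp es (Y i) τ ∧
    τ.reg 6 = i ∧ τ.reg 8 = n - i
  obtain ⟨⟨⟨e1, e2, e3, e4⟩, e5, e6, e7⟩, e8⟩ := hσ
  refine ((haltsWithin_block ?_).seq fun τ hτ =>
    (haltsWithin_loop (N := es.length) (b := 13) I hτ ?_ ?_).seq fun τ hτ =>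
    (haltsWithin_block (Q := J 0) ?_).seq fun τ hτ =>
      haltsWithin_loop (N := n) (b := 15) J hτ ?_ ?_).mono ?_ ?_
  · refine ⟨⟨⟨⟨?_, ?_, ?_, ?_⟩, ?_, ?_, ?_⟩, ?_, ?_, ?_⟩, ?_, ?_⟩ <;>
      simp [execAll, Instr.exec, e1, e2, e3, e4, e5, e6, e8, hX0]
    exact e7
  · rintro i hi τ ⟨-, -, h⟩
    omega
  · rintro t ht τ ⟨⟨⟨⟨e1, e2, e3, e4⟩, e5, e6, e7⟩, e8, e9, e10⟩, e11, e12⟩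
    -- The loop reads the arrays to which it appends; position `t` lies in the part that lists `es`
    -- and is never overwritten.
    have hlen : t < (es ++ (X t).zipIdx n).length := by rw [List.length_append]; omega
    have e13 : τ.arr 2 t = es[t].1 := by
      rw [(e7 t hlen).1, List.getD_append _ _ _ _ ht, List.getD_eq_getElem _ _ ht]
    have e14 : τ.arr 3 t = es[t].2 := by
      rw [(e7 t hlen).2, List.getD_append _ _ _ _ ht, List.getD_eq_getElem _ _ ht]
    have hl : es ++ (X (t + 1)).zipIdx n = (es ++ (X t).zipIdx n) ++
        [(es[t].1, n + (X t).length), (es[t].2, n + (X t).length + 1)] := by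
      rw [hX t ht, List.zipIdx_append]
      simp
    have hlist := e7.append_two es[t].1 (n + (X t).length) es[t].2 (n + (X t).length + 1)
    have hXl : (X (t + 1)).length = (X t).length + 2 := by rw [hX t ht]; simp
    have hll : (es ++ (X (t + 1)).zipIdx n).length = (es ++ (X t).zipIdx n).length + 2 := by
      rw [hl, List.length_append]; rfl
    rw [← hl] at hlist
    generalize es ++ (X t).zipIdx n = l at *
    refine haltsWithin_block ⟨⟨⟨⟨?_, ?_, ?_, ?_⟩, ?_, ?_, ?_⟩, ?_, ?_, ?_⟩, ?_, ?_⟩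
    case refine_6 =>
      rw [hll]
      simp [execAll, Instr.exec, e1, e6]
    case refine_7 =>
      simpa [execAll, Instr.exec, e1, e6, e9, e11, e13, e14, add_assoc] using hlist
    case refine_9 =>
      rw [hXl]
      simp [execAll, Instr.exec, e1, e9, add_assoc]
    all_goals
      simp [execAll, Instr.exec, e1, e2, e3, e4, e5, e8, e10, e11, e12]
    omega
  · obtain ⟨⟨⟨⟨e1, e2, e3, e4⟩, e5, e6, e7⟩, e8, e9, e10⟩, e11, e12⟩ := hτ
    rw [hXY] at e6 e7 e9
    refine ⟨⟨⟨⟨?_, ?_, ?_, ?_⟩, ?_, ?_, ?_⟩, ?_, ?_, ?_⟩, ?_, ?_⟩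
    case refine_6 =>
      rw [← e6]
      simp [execAll, Instr.exec]
    case refine_9 =>
      rw [← e9]
      simp [execAll, Instr.exec]
    all_goals
      simp [execAll, Instr.exec, e1, e2, e3, e4, e5, e8, e10]
    exact e7
  · rintro i hi τ ⟨-, -, h⟩
    omega
  · rintro t ht τ ⟨⟨⟨⟨e1, e2, e3, e4⟩, e5, e6, e7⟩, e8, e9, e10⟩, e11, e12⟩
    have hl : es ++ (Y (t + 1)).zipIdx n = (es ++ (Y t).zipIdx n) ++
        [(t, n + (Y t).length), (t, n + (Y t).length + 1), (t, n + (Y t).length + 2)] := by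
      rw [hY t, List.zipIdx_append]
      simp
    have hlist := e7.append_three t (n + (Y t).length) t (n + (Y t).length + 1)
      t (n + (Y t).length + 2)
    have hYl : (Y (t + 1)).length = (Y t).length + 3 := by rw [hY t]; simp
    have hll : (es ++ (Y (t + 1)).zipIdx n).length = (es ++ (Y t).zipIdx n).length + 3 := by
      rw [hl, List.length_append]; rfl
    rw [← hl] at hlist
    generalize es ++ (Y t).zipIdx n = l at *
    refine haltsWithin_block ⟨⟨⟨⟨?_, ?_, ?_, ?_⟩, ?_, ?_, ?_⟩, ?_, ?_, ?_⟩, ?_, ?_⟩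
    case refine_6 =>
      rw [hll]
      simp [execAll, Instr.exec, e1, e6]
    case refine_7 =>
      simpa [execAll, Instr.exec, e1, e6, e9, e11, add_assoc] using hlist
    case refine_9 =>
      rw [hYl]
      simp [execAll, Instr.exec, e1, e9, add_assoc]
    all_goals
      simp [execAll, Instr.exec, e1, e2, e3, e4, e5, e8, e10, e11, e12]
    omega
  · simp only [List.length_cons, List.length_nil]; omega
  · rintro τ ⟨h, -⟩
    exact h

/-- The list of the edges of the odd graph. -/
def listOddGraph : Program :=
  .seq parse (.seq listEdges addLeaves)

/-- The state after listing the edges of the odd graph. -/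
structure OddListed (inp : ℕ → ℕ) (σ : RamState) : Prop where
  base : Base n inp σ
  output : σ.arr 1 = fun _ => 0
  edges : σ.reg 13 = (edgeList G).length
  size : σ.reg 4 = n + (leaves G).length
  pos : σ.reg 5 = n + 1 + n * n
  length : σ.reg 3 = (oddList G).length
  src : ∀ t < (oddList G).length, σ.arr 2 t = oddSrc G t
  tgt : ∀ t < (oddList G).length, σ.arr 3 t = oddTgt G t

/-- Positions in the adjacency matrix distinguish the edges. This bounds running times by the input
length. -/
theorem length_edgeList_le : (edgeList G).length ≤ n * n := by
  have : ((edgeList G).map fun p => p.1 * n + p.2).Nodup := by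
    refine (nodup_edgeList G).map_on fun p hp q hq h => ?_
    have h1 := lt_of_mem_edgeList G hp
    have h2 := lt_of_mem_edgeList G hq
    have h3 : p.1 = q.1 := by
      have := congrArg (· / n) h
      simpa [Nat.mul_add_div, mul_comm _ n, Nat.div_eq_of_lt h1.2, Nat.div_eq_of_lt h2.2,
        show 0 < n by omega] using this
    exact Prod.ext h3 (by rw [h3] at h; omega)
  have hsub : ((edgeList G).map fun p => p.1 * n + p.2) ⊆ List.range (n * n) := by
    intro k hk
    obtain ⟨p, hp, rfl⟩ := List.mem_map.mp hk
    have h1 := lt_of_mem_edgeList G hp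
    rw [List.mem_range]
    nlinarith
  simpa using (List.subperm_of_subset this hsub).length_le

theorem haltsWithin_listOddGraph {inp : ℕ → ℕ} (hinp : IsInput G inp) (σ : RamState)
    (hσ : σ.arr 0 = inp) (hσ' : σ.arr 1 = fun _ => 0) :
    HaltsWithin listOddGraph σ (26 * (n * n) + 29 * n + 22) (OddListed G inp) := by
  refine ((haltsWithin_parse hinp.size hinp.sep σ hσ hσ').seq fun τ hτ =>
    (haltsWithin_listEdges G hinp τ hτ).seq fun τ hτ => haltsWithin_addLeaves τ hτ).mono ?_ ?_
  · have := length_edgeList_le G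
    have h2 : n * (n * 12 + 9) = 12 * (n * n) + 9 * n := by ring
    omega
  · rintro τ ⟨⟨h1, h2, h3, h4⟩, h5, h6, h7⟩
    exact ⟨h1, h2, h5, h6, h7, h3, fun t ht => (h4 t ht).1, fun t ht => (h4 t ht).2⟩

end Programs

/-! ### Reading and writing encoded graphs and cuts -/

section Encodings

variable {n : ℕ} (G : SimpleGraph (Fin n)) (r : List Bool)

theorem length_encodeGraph : (encodeGraph G).length = n + 1 + n * n := by
  simp [encodeGraph]
  ring

theorem getD_encodeGraph_of_lt {i : ℕ} (hi : i < n) : (encodeGraph G ++ r).getD i false = true := by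
  simp [encodeGraph, List.getD_eq_getElem?_getD, List.getElem?_append_left, hi]

theorem getD_encodeGraph_self : (encodeGraph G ++ r).getD n false = false := by
  simp [encodeGraph, List.getD_eq_getElem?_getD]

theorem getD_encodeGraph_adj {i j : ℕ} (hi : i < n) (hj : j < n) :
    (encodeGraph G ++ r).getD (n + 1 + i * n + j) false = adjNat G i j := by
  classical
  have hk : i * n + j < n * n := by nlinarith
  have hdiv : (i * n + j) / n = i := by
    rw [mul_comm, Nat.mul_add_div (by omega), Nat.div_eq_of_lt hj, add_zero]
  have hmod : (i * n + j) % n = j := by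
    rw [mul_comm, Nat.mul_add_mod, Nat.mod_eq_of_lt hj]
  rw [encodeGraph, List.append_assoc, List.getD_append_right _ _ _ _ (by simp; omega),
    List.length_replicate, show n + 1 + i * n + j - n = i * n + j + 1 by omega, List.cons_append,
    List.getD_cons_succ, List.getD_append _ _ _ _ (by simpa using hk),
    List.getD_eq_getElem _ _ (by simpa using hk), List.getElem_ofFn, Bool.eq_iff_iff, adjNat_iff,
    decide_eq_true_iff]
  constructor
  · intro h
    refine ⟨hi, hj, ?_⟩
    convert h using 1
    · exact Fin.ext hdiv.symm
    · exact Fin.ext hmod.symm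
  · rintro ⟨_, _, h⟩
    convert h using 1
    · exact Fin.ext hdiv
    · exact Fin.ext hmod

theorem getD_encodeGraph_append (k : ℕ) :
    (encodeGraph G ++ r).getD (n + 1 + n * n + k) false = r.getD k false := by
  rw [List.getD_append_right _ _ _ _ (by rw [length_encodeGraph]; omega), length_encodeGraph,
    Nat.add_sub_cancel_left]

theorem isInput_inputState : IsInput G ((inputState (encodeGraph G ++ r)).arr 0) where
  size i hi := by
    have := getD_encodeGraph_of_lt G r hi
    simp only [inputState, this]
    simp
  sep := by
    have := getD_encodeGraph_self G r
    simp only [inputState, this]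
    simp
  adj i hi j hj := by
    have := getD_encodeGraph_adj G r hi hj
    simp only [inputState, this]
    simp

theorem getD_encodeCut {C : Fin n → Bool} {i : ℕ} (hi : i < n) :
    (encodeCut C).getD i false = C ⟨i, hi⟩ := by
  rw [encodeCut, List.getD_eq_getElem _ _ (by simpa using hi), List.getElem_ofFn]

theorem showsOutput_encodeCut {C : Fin n → Bool} {τ : RamState} (h0 : τ.reg 0 = n)
    (h1 : ∀ i (hi : i < n), τ.arr 1 i = (C ⟨i, hi⟩).toNat) : ShowsOutput τ (encodeCut C) := by
  have hlen : (encodeCut C).length = n := by simp [encodeCut]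
  refine ⟨h0.trans hlen.symm, fun i hi => ?_⟩
  rw [hlen] at hi
  rw [getD_encodeCut hi, h1 i hi]

open Classical in
/-- The array that shows the ones of the encoding of a graph with `m` vertices and with the
edges `W`. -/
noncomputable def marked (m : ℕ) (W : ℕ → ℕ → Prop) (k : ℕ) : ℕ :=
  if k < m ∨ ∃ x y, W x y ∧ (k = m + 1 + x * m + y ∨ k = m + 1 + y * m + x) then 1 else 0

/-- Entering an edge amounts to two stores, at symmetric positions of the matrix. -/
theorem marked_update (m : ℕ) (W : ℕ → ℕ → Prop) (a b : ℕ) :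
    Function.update (Function.update (marked m W) (m + 1 + a * m + b) 1) (m + 1 + b * m + a) 1 =
      marked m fun x y => W x y ∨ x = a ∧ y = b := by
  classical
  funext k
  by_cases h1 : k = m + 1 + b * m + a
  · rw [h1, Function.update_self, marked, if_pos (Or.inr ⟨a, b, Or.inr ⟨rfl, rfl⟩, Or.inr rfl⟩)]
  · rw [Function.update_of_ne h1]
    by_cases h2 : k = m + 1 + a * m + b
    · rw [h2, Function.update_self, marked, if_pos (Or.inr ⟨a, b, Or.inr ⟨rfl, rfl⟩, Or.inl rfl⟩)]
    · rw [Function.update_of_ne h2, marked, marked]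
      refine if_congr (or_congr_right ⟨?_, ?_⟩) rfl rfl
      · rintro ⟨x, y, h, h'⟩
        exact ⟨x, y, Or.inl h, h'⟩
      · rintro ⟨x, y, h | ⟨rfl, rfl⟩, h'⟩
        · exact ⟨x, y, h, h'⟩
        · tauto

theorem showsOutput_encodeGraph {W : ℕ → ℕ → Prop} {τ : RamState}
    (hW : ∀ x y, W x y → x < n ∧ y < n)
    (hG : ∀ (x y : Fin n), G.Adj x y ↔ W x y ∨ W y x) (h0 : τ.reg 0 = n + 1 + n * n)
    (h1 : τ.arr 1 = marked n W) : ShowsOutput τ (encodeGraph G) := by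
  classical
  refine ⟨h0.trans (length_encodeGraph G).symm, fun k hk => ?_⟩
  rw [length_encodeGraph] at hk
  rw [h1, ← List.append_nil (encodeGraph G)]
  rcases lt_trichotomy k n with h | rfl | h
  · rw [getD_encodeGraph_of_lt G [] h, marked, if_pos (Or.inl h)]
    rfl
  · rw [getD_encodeGraph_self, marked, if_neg]
    · rfl
    · rintro (h | ⟨x, y, -, h | h⟩) <;> omega
  · obtain ⟨k, rfl⟩ : ∃ l, k = n + 1 + l := ⟨k - (n + 1), by omega⟩
    have hk' : k < n * n := by omega
    have hn : 0 < n := Nat.pos_of_ne_zero (by rintro rfl; omega)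
    obtain ⟨x, y, hx, hy, rfl⟩ : ∃ x y, x < n ∧ y < n ∧ k = x * n + y :=
      ⟨k / n, k % n, Nat.div_lt_of_lt_mul hk', Nat.mod_lt _ hn, (Nat.div_add_mod' k n).symm⟩
    have hdec : ∀ a b, b < n → x * n + y = a * n + b → x = a ∧ y = b := by
      intro a b hb h
      have hxa : x = a := by
        have := congrArg (· / n) h
        simpa [mul_comm _ n, Nat.mul_add_div hn, Nat.div_eq_of_lt hy, Nat.div_eq_of_lt hb] using this
      subst hxa
      exact ⟨rfl, by omega⟩
    rw [← add_assoc, getD_encodeGraph_adj G [] hx hy, marked]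
    by_cases h : W x y ∨ W y x
    · have hadj : adjNat G x y = true := adjNat_iff.mpr ⟨hx, hy, (hG _ _).mpr h⟩
      rw [hadj, if_pos]
      · rfl
      · exact Or.inr (h.elim (fun h => ⟨x, y, h, Or.inl rfl⟩) fun h => ⟨y, x, h, Or.inr rfl⟩)
    · have hadj : adjNat G x y = false := by
        rw [Bool.eq_false_iff]
        intro hadj
        obtain ⟨_, _, hadj⟩ := adjNat_iff.mp hadj
        exact h ((hG _ _).mp hadj)
      rw [hadj, if_neg]
      · rfl
      · rintro (h' | ⟨a, b, hab, h' | h'⟩)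
        · omega
        · obtain ⟨rfl, rfl⟩ := hdec a b (hW _ _ hab).2 (by omega)
          exact h (Or.inl hab)
        · obtain ⟨rfl, rfl⟩ := hdec b a (hW _ _ hab).1 (by omega)
          exact h (Or.inr hab)

end Encodings

/-! ### The program that computes the reduced graph -/

section Reduction

set_option linter.unusedSimpArgs false
set_option linter.unusedVariables false

/-- The registers and arrays hold a list of the edges of a graph. -/
structure Ready (h K : ℕ) (src tgt : ℕ → ℕ) (σ : RamState) : Prop where
  one : σ.reg 1 = 1
  zero : σ.reg 19 = 0
  length : σ.reg 3 = K
  size : σ.reg 4 = h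
  src : ∀ t < K, σ.arr 2 t = src t
  tgt : ∀ t < K, σ.arr 3 t = tgt t

/-- Computing the number of vertices of the subdivision. -/
def measure : Program :=
  .seq (block [.add 14 4 19, .const 15 2, .add 8 3 19])
    (.loop 8 (block [.add 14 14 15, .add 15 15 1, .add 15 15 1, .sub 8 8 1]))

variable {h K : ℕ} {src tgt : ℕ → ℕ}

/-- The machine cannot multiply, so $K(K+1)$ is accumulated as $2+4+\dots+2K$. -/
theorem haltsWithin_measure (σ : RamState) (hσ : Ready h K src tgt σ ∧ σ.arr 1 = fun _ => 0) :
    HaltsWithin measure σ (K * 6 + 5) fun τ =>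
      Ready h K src tgt τ ∧ (τ.arr 1 = fun _ => 0) ∧ τ.reg 14 = h + K * (K + 1) := by
  let I : ℕ → RamState → Prop := fun t τ => Ready h K src tgt τ ∧ (τ.arr 1 = fun _ => 0) ∧
    τ.reg 14 = h + t * (t + 1) ∧ τ.reg 15 = 2 * t + 2 ∧ τ.reg 8 = K - t
  obtain ⟨⟨e1, e2, e3, e4, e5, e6⟩, e7⟩ := hσ
  refine ((haltsWithin_block ?_).seq fun τ hτ =>
    haltsWithin_loop (N := K) (b := 5) I hτ ?_ ?_).mono ?_ ?_
  · refine ⟨⟨?_, ?_, ?_, ?_, ?_, ?_⟩, ?_, ?_, ?_, ?_⟩ <;>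
      simp [execAll, Instr.exec, e1, e2, e3, e4, e7]
    · exact e5
    · exact e6
  · rintro i hi τ ⟨-, -, -, -, h⟩
    omega
  · rintro t ht τ ⟨⟨e1, e2, e3, e4, e5, e6⟩, e7, e8, e9, e10⟩
    refine haltsWithin_block ⟨⟨?_, ?_, ?_, ?_, ?_, ?_⟩, ?_, ?_, ?_, ?_⟩ <;>
      simp [execAll, Instr.exec, e1, e2, e3, e4, e7, e8, e9, e10]
    · exact e5
    · exact e6
    · ring
    · omega
    · omega
  · simp only [List.length_cons, List.length_nil]; omega
  · rintro τ ⟨h1, h2, h3, -⟩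
    exact ⟨h1, h2, h3⟩

/-- Writing the number of vertices and the positions of the rows of the adjacency matrix. -/
def layRows : Program :=
  .seq (block [.add 0 14 1, .const 6 0, .add 8 14 19])
    (.loop 8 (block [.store 1 6 1, .store 4 6 0, .add 0 0 14, .add 6 6 1, .sub 8 8 1]))

/-- The state when the edges in `W` have been entered into the adjacency matrix. -/
structure Marked (h K : ℕ) (src tgt : ℕ → ℕ) (W : ℕ → ℕ → Prop) (σ : RamState) : Prop where
  ready : Ready h K src tgt σ
  total : σ.reg 0 = h + K * (K + 1) + 1 + (h + K * (K + 1)) * (h + K * (K + 1))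
  rows : ∀ x < h + K * (K + 1), σ.arr 4 x = h + K * (K + 1) + 1 + x * (h + K * (K + 1))
  output : σ.arr 1 = marked (h + K * (K + 1)) W

/-- Tabulating the row positions by repeated addition allows each matrix entry to be addressed later
with one addition. After the last row, register `0` holds the length of the output. -/
theorem haltsWithin_layRows (σ : RamState) (hσ : Ready h K src tgt σ ∧ (σ.arr 1 = fun _ => 0) ∧
      σ.reg 14 = h + K * (K + 1)) :
    HaltsWithin layRows σ ((h + K * (K + 1)) * 7 + 5)
      (Marked h K src tgt fun _ _ => False) := by
  generalize hm : h + K * (K + 1) = m at *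
  let I : ℕ → RamState → Prop := fun x τ => Ready h K src tgt τ ∧
    (τ.arr 1 = fun k => if k < x then 1 else 0) ∧ τ.reg 14 = m ∧ τ.reg 6 = x ∧ τ.reg 8 = m - x ∧
    τ.reg 0 = m + 1 + x * m ∧ ∀ y < x, τ.arr 4 y = m + 1 + y * m
  obtain ⟨⟨e1, e2, e3, e4, e5, e6⟩, e7, e8⟩ := hσ
  refine ((haltsWithin_block ?_).seq fun τ hτ =>
    haltsWithin_loop (N := m) (b := 6) I hτ ?_ ?_).mono ?_ ?_
  · refine ⟨⟨?_, ?_, ?_, ?_, ?_, ?_⟩, ?_, ?_, ?_, ?_, ?_, ?_⟩ <;>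
      simp [execAll, Instr.exec, e1, e2, e3, e4, e7, e8]
    · exact e5
    · exact e6
  · rintro i hi τ ⟨-, -, -, -, h, -⟩
    omega
  · rintro x hx τ ⟨⟨e1, e2, e3, e4, e5, e6⟩, e7, e8, e9, e10, e11, e12⟩
    refine haltsWithin_block ⟨⟨?_, ?_, ?_, ?_, ?_, ?_⟩, ?_, ?_, ?_, ?_, ?_, ?_⟩ <;>
      simp [execAll, Instr.exec, e1, e2, e3, e4, e7, e8, e9, e10, e11]
    · exact e5
    · exact e6
    · funext k
      by_cases hk : k = x
      · subst hk; simp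
      · rw [Function.update_of_ne hk]
        exact if_congr (by omega) rfl rfl
    · omega
    · ring
    · intro y hy
      by_cases hyx : y = x
      · subst hyx; simp
      · rw [Function.update_of_ne hyx]
        exact e12 y (by omega)
  · simp only [List.length_cons, List.length_nil]; omega
  · rintro τ ⟨h1, h2, -, -, -, h3, h4⟩
    subst hm
    refine ⟨h1, h3, h4, h2.trans ?_⟩
    funext k
    simp [marked]

/-- Entering the edges of the subdivision. -/
def markEdges : Program :=
  .seq (block [.const 6 0, .const 15 2, .add 17 4 19, .add 8 3 19])
    (.loop 8 (.seq (block [.load 16 2 6, .add 9 15 19])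
      (.seq (.loop 9 (block [.load 10 4 16, .add 10 10 17, .store 1 10 1,
          .load 10 4 17, .add 10 10 16, .store 1 10 1, .add 16 17 19, .add 17 17 1, .sub 9 9 1]))
        (block [.load 12 3 6, .load 10 4 16, .add 10 10 12, .store 1 10 1,
          .load 10 4 12, .add 10 10 16, .store 1 10 1,
          .add 6 6 1, .add 15 15 1, .add 15 15 1, .sub 8 8 1]))))

/-- The edges of the first `t` paths. -/
def pathEdges (h : ℕ) (src tgt : ℕ → ℕ) (t x y : ℕ) : Prop :=
  ∃ t' < t, ∃ i < 2 * t' + 3, x = pathPos h src tgt t' i ∧ y = pathPos h src tgt t' (i + 1)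

/-- Register `16` holds the current vertex of the path and register `17` the next unused number. The
inner loop enters the edges that lead to new vertices; the last edge, to `tgt t`, follows it. -/
theorem haltsWithin_markEdges (hE : IsEdgeListing h K src tgt) (σ : RamState)
    (hσ : Marked h K src tgt (fun _ _ => False) σ) :
    HaltsWithin markEdges σ (K * (22 * K + 18) + 6)
      (Marked h K src tgt (pathEdges h src tgt K)) := by
  let W : ℕ → ℕ → ℕ → ℕ → Prop := fun t i x y => pathEdges h src tgt t x y ∨
    ∃ i' < i, x = pathPos h src tgt t i' ∧ y = pathPos h src tgt t (i' + 1)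
  have hW0 : pathEdges h src tgt 0 = fun _ _ => False := by
    funext x y
    simp [pathEdges]
  have hWt : ∀ t, W t 0 = pathEdges h src tgt t := by
    intro t
    funext x y
    simp [W]
  have hWi : ∀ t i, (fun x y => W t i x y ∨
      x = pathPos h src tgt t i ∧ y = pathPos h src tgt t (i + 1)) = W t (i + 1) := by
    intro t i
    funext x y
    simp only [W, or_assoc, Nat.exists_lt_succ_right]
  have hWlast : ∀ t, W t (2 * t + 3) = pathEdges h src tgt (t + 1) := by
    intro t
    funext x y
    simp only [W, pathEdges, Nat.exists_lt_succ_right]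
  let I : ℕ → RamState → Prop := fun t τ => Marked h K src tgt (pathEdges h src tgt t) τ ∧
    τ.reg 6 = t ∧ τ.reg 15 = 2 * t + 2 ∧ τ.reg 17 = h + t * (t + 1) ∧ τ.reg 8 = K - t
  let J : ℕ → ℕ → RamState → Prop := fun t i τ => Marked h K src tgt (W t i) τ ∧
    τ.reg 6 = t ∧ τ.reg 15 = 2 * t + 2 ∧ τ.reg 17 = h + t * (t + 1) + i ∧ τ.reg 8 = K - t ∧
    τ.reg 16 = pathPos h src tgt t i ∧ τ.reg 9 = 2 * t + 2 - i
  obtain ⟨⟨e1, e2, e3, e4, e5, e6⟩, e7, e8, e9⟩ := hσ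
  refine ((haltsWithin_block ?_).seq fun τ hτ =>
    haltsWithin_loop (N := K) (b := 22 * K + 17) I hτ ?_ ?_).mono ?_ ?_
  · refine ⟨⟨⟨?_, ?_, ?_, ?_, ?_, ?_⟩, ?_, ?_, ?_⟩, ?_, ?_, ?_, ?_⟩ <;>
      simp [execAll, Instr.exec, e1, e2, e3, e4, e7, e9, hW0]
    · exact e5
    · exact e6
    · exact e8
  · rintro i hi τ ⟨-, -, -, -, h⟩
    omega
  · rintro t ht τ ⟨⟨⟨e1, e2, e3, e4, e5, e6⟩, e7, e8, e9⟩, e10, e11, e12, e13⟩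
    refine HaltsWithin.mono ((haltsWithin_block ?_).seq fun τ hτ =>
      (haltsWithin_loop (N := 2 * t + 2) (b := 10) (J t) hτ ?_ ?_).seq
      fun τ hτ => haltsWithin_block (Q := I (t + 1)) ?_) ?_ fun _ h => h
    · refine ⟨⟨⟨?_, ?_, ?_, ?_, ?_, ?_⟩, ?_, ?_, ?_⟩, ?_, ?_, ?_, ?_, ?_, ?_⟩ <;>
        simp [execAll, Instr.exec, e1, e2, e3, e4, e7, e9, e10, e11, e12, e13, hWt, pathPos]
      · exact e5
      · exact e6
      · exact e8
      · exact e5 t ht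
    · rintro i hi τ ⟨-, -, -, -, -, -, h⟩
      omega
    · rintro i hi τ ⟨⟨⟨e1, e2, e3, e4, e5, e6⟩, e7, e8, e9⟩, e10, e11, e12, e13, e14, e15⟩
      have hp : pathPos h src tgt t (i + 1) = h + t * (t + 1) + i := by rw [pathPos, if_pos hi]
      rw [← hp] at e12
      have e16 := e8 _ (hE.pathPos_lt ht i)
      have e17 := e8 _ (hE.pathPos_lt ht (i + 1))
      refine haltsWithin_block
        ⟨⟨⟨?_, ?_, ?_, ?_, ?_, ?_⟩, ?_, ?_, ?_⟩, ?_, ?_, ?_, ?_, ?_, ?_⟩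
      case refine_9 =>
        rw [← hWi, ← marked_update]
        simp [execAll, Instr.exec, e1, e9, e12, e14, e16, e17]
      all_goals
        simp [execAll, Instr.exec, e1, e2, e3, e4, e7, e10, e11, e12, e13, e15]
      · exact e5
      · exact e6
      · exact e8
      · rw [hp]; rfl
      · omega
    · obtain ⟨⟨⟨e1, e2, e3, e4, e5, e6⟩, e7, e8, e9⟩, e10, e11, e12, e13, e14, e15⟩ := hτ
      have e16 := e8 _ (hE.pathPos_lt ht (2 * t + 2))
      have e17 := e8 _ (hE.pathPos_lt ht (2 * t + 3))
      have e18 := e6 t ht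
      rw [← pathPos_last h src tgt t] at e18
      refine ⟨⟨⟨?_, ?_, ?_, ?_, ?_, ?_⟩, ?_, ?_, ?_⟩, ?_, ?_, ?_, ?_⟩
      case refine_9 =>
        rw [← hWlast, ← hWi, ← marked_update]
        simp [execAll, Instr.exec, e1, e9, e10, e14, e16, e17, e18]
      all_goals
        simp [execAll, Instr.exec, e1, e2, e3, e4, e7, e10, e11, e12, e13]
      · exact e5
      · exact e6
      · exact e8
      · omega
      · ring
      · omega
    · simp only [List.length_cons, List.length_nil]; omega
  · have : 22 * K + 17 + 1 = 22 * K + 18 := rfl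
    rw [this]
    simp only [List.length_cons, List.length_nil]; omega
  · rintro τ ⟨h, -⟩
    exact h

theorem OddListed.ready {n : ℕ} {G : SimpleGraph (Fin n)} {inp : ℕ → ℕ} {σ : RamState}
    (h : OddListed G inp σ) :
    Ready (n + (leaves G).length) (oddList G).length (oddSrc G) (oddTgt G) σ :=
  ⟨h.base.one, h.base.zero, h.length, h.size, h.src, h.tgt⟩

/-- The program that computes the reduced graph. -/
def reduction : Program :=
  .seq listOddGraph (.seq measure (.seq layRows markEdges))

variable {n : ℕ} (G : SimpleGraph (Fin n))

theorem reducedGraph_adj (x y : Fin (reducedSize G)) : (reducedGraph G).Adj x y ↔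
    pathEdges (n + (leaves G).length) (oddSrc G) (oddTgt G) (oddList G).length x y ∨
    pathEdges (n + (leaves G).length) (oddSrc G) (oddTgt G) (oddList G).length y x := by
  have key : ∀ u v : Fin (reducedSize G),
      pathEdges (n + (leaves G).length) (oddSrc G) (oddTgt G) (oddList G).length u v ↔
      ∃ a, edgeFst (isEdgeListing_odd G).vert a = u ∧ edgeSnd (isEdgeListing_odd G).vert a = v := by
    intro u v
    constructor
    · rintro ⟨t, ht, i, hi, h1, h2⟩
      exact ⟨⟨⟨t, ht⟩, ⟨i, hi⟩⟩, Fin.ext h1.symm, Fin.ext h2.symm⟩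
    · rintro ⟨⟨t, i⟩, rfl, rfl⟩
      exact ⟨t, t.2, i, i.2, rfl, rfl⟩
  rw [key, key]
  refine (isEdgeListing_odd G).enumerates_subdivision.adj_iff.trans ?_
  rw [← exists_or]
  refine exists_congr fun a => Sym2.eq_iff

/-- The matrix has more entries than the time bound would allow to write for large inputs, but its
zeros are present from the start and only the unary prefix and the edges are written. -/
theorem outputsWithin_reduction :
    OutputsWithin reduction (encodeGraph G) (encodeGraph (reducedGraph G))
      (1000 * (n + 1 + n * n) ^ 2) := by
  have hin := isInput_inputState G []
  rw [List.append_nil] at hin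
  obtain ⟨τ, s, hs, hrun, hτ⟩ := (haltsWithin_listOddGraph G hin (inputState (encodeGraph G)) rfl
    (by funext i; simp [inputState])).seq fun τ hτ =>
    (haltsWithin_measure τ ⟨hτ.ready, hτ.output⟩).seq fun τ hτ =>
    (haltsWithin_layRows τ hτ).seq fun τ hτ => haltsWithin_markEdges (isEdgeListing_odd G) τ hτ
  refine ⟨τ, s, hs.trans ?_, hrun, showsOutput_encodeGraph (reducedGraph G) ?_
    (reducedGraph_adj G) hτ.total hτ.output⟩
  · have h1 := length_edgeList_le G
    have h2 := length_oddList G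
    have h3 := length_leaves G
    generalize (oddList G).length = K at *
    generalize (leaves G).length = l at *
    generalize (edgeList G).length = e at *
    -- `S` is the length of the input. All loop bounds are at most quadratic in $K\le 3S$ and linear
    -- in the number of leaves.
    set S := n + 1 + n * n with hS
    have hK : K ≤ 3 * S := by omega
    have hl : n + l ≤ 4 * S := by omega
    have hKK : K * K ≤ 3 * S * (3 * S) := Nat.mul_le_mul hK hK
    have hSS : S ≤ S ^ 2 := Nat.le_self_pow two_ne_zero S
    have e1 : K * (K + 1) = K * K + K := by ring
    have e2 : K * (22 * K + 18) = 22 * (K * K) + 18 * K := by ring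
    have e3 : 3 * S * (3 * S) = 9 * S ^ 2 := by ring
    have hS1 : 1 ≤ S := by omega
    omega
  · rintro x y ⟨t, ht, i, hi, rfl, rfl⟩
    exact ⟨(isEdgeListing_odd G).pathPos_lt ht _, (isEdgeListing_odd G).pathPos_lt ht _⟩

end Reduction

/-! ### Extending and restricting cuts, with the programs -/

section Colouring

set_option linter.unusedSimpArgs false
set_option linter.unusedVariables false

variable {n : ℕ} (G : SimpleGraph (Fin n))

theorem block_unique {t t' j j' : ℕ} (hj : j < 2 * t + 2) (hj' : j' < 2 * t' + 2)
    (h : t * (t + 1) + j = t' * (t' + 1) + j') : t = t' ∧ j = j' := by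
  rcases lt_trichotomy t t' with hlt | rfl | hlt
  · have := block_le hlt
    omega
  · exact ⟨rfl, by omega⟩
  · have := block_le hlt
    omega

/-- Every colouring of `G` extends to an alternating colouring. -/
theorem exists_isAlternating (C : ℕ → Bool) :
    ∃ c, IsAlternating G c ∧ ∀ x < n, c x = C x := by
  classical
  let h := n + (leaves G).length
  let c₀ : ℕ → Bool := fun x =>
    if x < n then C x else !C (oddSrc G ((edgeList G).length + (x - n)))
  let P : ℕ → ℕ × ℕ → Prop := fun x p => p.2 < 2 * p.1 + 2 ∧ x = h + p.1 * (p.1 + 1) + p.2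
  -- By `block_unique` the chosen pair is the path of `x` and its position there, counted from $0$;
  -- the even positions get the colour opposite to the start of the path.
  let c : ℕ → Bool := fun x =>
    if hx : ∃ p, P x p then Bool.xor (c₀ (oddSrc G hx.choose.1)) (hx.choose.2 % 2 = 0) else c₀ x
  have hc₀ : ∀ x < h, c x = c₀ x := fun x hx => dif_neg (by rintro ⟨p, -, hp⟩; omega)
  have hc : ∀ t, ∀ j < 2 * t + 2,
      c (h + t * (t + 1) + j) = Bool.xor (c₀ (oddSrc G t)) (j % 2 = 0) := by
    intro t j hj
    have hx : ∃ p, P (h + t * (t + 1) + j) p := ⟨(t, j), hj, rfl⟩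
    have h1 := hx.choose_spec
    obtain ⟨h2, h3⟩ := block_unique hj h1.1 (by have := h1.2; omega)
    simp only [c]
    rw [dif_pos hx, ← h2, ← h3]
  have hn : ∀ x < n, c x = C x := fun x hx => by
    rw [hc₀ x (by simp only [h]; omega)]
    exact if_pos hx
  refine ⟨c, ⟨fun s hs => ?_, fun t ht i hi => ?_⟩, hn⟩
  · rw [hn _ (odd_leaf_lt G hs), hc₀ _ (by simp only [h]; omega)]
    simp only [c₀]
    rw [if_neg (by omega), Nat.add_sub_cancel_left]
  · have hpos : pathPos (n + (leaves G).length) (oddSrc G) (oddTgt G) t (i + 1) =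
        h + t * (t + 1) + i := by rw [pathPos, if_pos hi]
    rw [hpos, hc t i hi]
    cases i with
    | zero =>
      rw [pathPos, hc₀ _ ((isEdgeListing_odd G).src_lt t ht)]
      simp
    | succ i =>
      have hpos : pathPos (n + (leaves G).length) (oddSrc G) (oddTgt G) t (i + 1) =
          h + t * (t + 1) + i := by rw [pathPos, if_pos (by omega)]
      rw [hpos, hc t i (by omega)]
      rcases Nat.mod_two_eq_zero_or_one i with h0 | h0
      · have h1 : (i + 1) % 2 = 1 := by omega
        simp [h0, h1]
      · have h1 : (i + 1) % 2 = 0 := by omega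
        simp [h0, h1]

/-- Copying a colouring from the input to the output. -/
def copyCut : Program :=
  .seq (block [.const 6 0, .add 8 2 19])
    (.loop 8 (block [.load 10 0 5, .store 1 6 10, .add 5 5 1, .add 6 6 1, .sub 8 8 1]))

/-- The same program starts the extension and performs the restriction, as the vertices of `G` are
the first `n` ones of the reduced graph. What it is said to preserve is needed for colouring the new
vertices. -/
theorem haltsWithin_copyCut {inp : ℕ → ℕ} {p : ℕ} (σ : RamState) (hσ : Base n inp σ)
    (hp : σ.reg 5 = p) :
    HaltsWithin copyCut σ (n * 7 + 4) fun τ => Base n inp τ ∧ τ.reg 3 = σ.reg 3 ∧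
      τ.reg 4 = σ.reg 4 ∧ τ.reg 13 = σ.reg 13 ∧ τ.arr 2 = σ.arr 2 ∧ τ.arr 3 = σ.arr 3 ∧
      τ.reg 6 = n ∧ ∀ x < n, τ.arr 1 x = inp (p + x) := by
  let I : ℕ → RamState → Prop := fun i τ => Base n inp τ ∧ τ.reg 3 = σ.reg 3 ∧
    τ.reg 4 = σ.reg 4 ∧ τ.reg 13 = σ.reg 13 ∧ τ.arr 2 = σ.arr 2 ∧ τ.arr 3 = σ.arr 3 ∧
    τ.reg 6 = i ∧ τ.reg 5 = p + i ∧ τ.reg 8 = n - i ∧ ∀ x < i, τ.arr 1 x = inp (p + x)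
  obtain ⟨e1, e2, e3, e4⟩ := hσ
  refine ((haltsWithin_block ?_).seq fun τ hτ =>
    haltsWithin_loop (N := n) (b := 6) I hτ ?_ ?_).mono ?_ ?_
  · refine ⟨⟨?_, ?_, ?_, ?_⟩, ?_, ?_, ?_, ?_, ?_, ?_, ?_, ?_, ?_⟩ <;>
      simp [execAll, Instr.exec, e1, e2, e3, e4, hp]
  · rintro i hi τ ⟨-, -, -, -, -, -, -, -, h, -⟩
    omega
  · rintro i hi τ ⟨⟨e1, e2, e3, e4⟩, e5, e6, e7, e8, e9, e10, e11, e12, e13⟩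
    refine haltsWithin_block
      ⟨⟨?_, ?_, ?_, ?_⟩, ?_, ?_, ?_, ?_, ?_, ?_, ?_, ?_, ?_⟩ <;>
      simp [execAll, Instr.exec, e1, e2, e3, e4, e5, e6, e7, e8, e9, e10, e11, e12]
    · omega
    · omega
    · intro x hx
      by_cases hxi : x = i
      · subst hxi; simp
      · rw [Function.update_of_ne hxi]
        exact e13 x (by omega)
  · simp only [List.length_cons, List.length_nil]; omega
  · rintro τ ⟨h1, h2, h3, h4, h5, h6, h7, -, -, h8⟩
    exact ⟨h1, h2, h3, h4, h5, h6, h7, h8⟩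

/-- Colouring the leaves. -/
def colourLeaves : Program :=
  .seq (block [.add 7 13 19, .sub 8 3 13])
    (.loop 8 (block [.load 10 2 7, .load 11 1 10, .sub 11 1 11, .store 1 6 11,
      .add 6 6 1, .add 7 7 1, .sub 8 8 1]))

/-- The vertices below `x` have been coloured by `c`. -/
structure Coloured (c : ℕ → Bool) (x : ℕ) (σ : RamState) : Prop where
  one : σ.reg 1 = 1
  zero : σ.reg 19 = 0
  length : σ.reg 3 = (oddList G).length
  src : ∀ t < (oddList G).length, σ.arr 2 t = oddSrc G t
  next : σ.reg 6 = x
  colour : ∀ y < x, σ.arr 1 y = (c y).toNat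

theorem update_colour {f : ℕ → ℕ} {c : ℕ → Bool} {x : ℕ} (h : ∀ y < x, f y = (c y).toNat)
    (y : ℕ) (hy : y < x + 1) : Function.update f x (c x).toNat y = (c y).toNat := by
  by_cases hyx : y = x
  · subst hyx
    rw [Function.update_self]
  · rw [Function.update_of_ne hyx]
    exact h y (by omega)

theorem one_sub_toNat (b : Bool) : 1 - b.toNat = (!b).toNat := by
  cases b <;> rfl

theorem haltsWithin_colourLeaves {c : ℕ → Bool} (hc : IsAlternating G c) (σ : RamState)
    (hσ : Coloured G c n σ) (he : σ.reg 13 = (edgeList G).length) :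
    HaltsWithin colourLeaves σ ((leaves G).length * 9 + 4)
      (Coloured G c (n + (leaves G).length)) := by
  have hlen : (oddList G).length = (edgeList G).length + (leaves G).length := by
    simp [oddList]
  let I : ℕ → RamState → Prop := fun s τ => Coloured G c (n + s) τ ∧
    τ.reg 7 = (edgeList G).length + s ∧ τ.reg 8 = (leaves G).length - s
  obtain ⟨e1, e2, e3, e4, e5, e6⟩ := hσ
  refine ((haltsWithin_block ?_).seq fun τ hτ =>
    haltsWithin_loop (N := (leaves G).length) (b := 8) I hτ ?_ ?_).mono ?_ ?_
  · refine ⟨⟨?_, ?_, ?_, ?_, ?_, ?_⟩, ?_, ?_⟩ <;>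
      simp [execAll, Instr.exec, e1, e2, e3, e5, he]
    · exact e4
    · exact e6
    · omega
  · rintro i hi τ ⟨-, -, h⟩
    omega
  · rintro s hs τ ⟨⟨e1, e2, e3, e4, e5, e6⟩, e7, e8⟩
    have e9 := e4 ((edgeList G).length + s) (by omega)
    have e10 := e6 _ ((odd_leaf_lt G hs).trans_le (Nat.le_add_right n s))
    have e11 := update_colour (c := c) e6
    rw [hc.leaf s hs, ← one_sub_toNat] at e11
    refine haltsWithin_block ⟨⟨?_, ?_, ?_, ?_, ?_, ?_⟩, ?_, ?_⟩
    case refine_6 =>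
      simp [execAll, Instr.exec, e1, e5, e7, e9, e10]
      exact e11
    all_goals
      simp [execAll, Instr.exec, e1, e2, e3, e5, e7, e8]
    · exact e4
    · omega
    · omega
    · omega
  · simp only [List.length_cons, List.length_nil]; omega
  · rintro τ ⟨h, -⟩
    exact h

/-- Colouring the paths. -/
def colourPaths : Program :=
  .seq (block [.const 7 0, .const 15 2, .add 8 3 19])
    (.loop 8 (.seq (block [.load 10 2 7, .load 11 1 10, .add 9 15 19])
      (.seq (.loop 9 (block [.sub 11 1 11, .store 1 6 11, .add 6 6 1, .sub 9 9 1]))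
        (block [.add 7 7 1, .add 15 15 1, .add 15 15 1, .sub 8 8 1]))))

/-- Inner vertices are numbered in the order in which the paths are traversed, so the colours are
written one after another while register `11` is flipped. -/
theorem haltsWithin_colourPaths {c : ℕ → Bool} (hc : IsAlternating G c) (σ : RamState)
    (hσ : Coloured G c (n + (leaves G).length) σ) :
    HaltsWithin colourPaths σ ((oddList G).length * (12 * (oddList G).length + 11) + 5)
      (Coloured G c (reducedSize G)) := by
  have hn : n ≤ n + (leaves G).length := Nat.le_add_right _ _
  have hp : ∀ t i, i < 2 * t + 2 →
      pathPos (n + (leaves G).length) (oddSrc G) (oddTgt G) t (i + 1) =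
        n + (leaves G).length + t * (t + 1) + i := fun t i hi => by rw [pathPos, if_pos hi]
  have halt := hc.path
  have hsrc := (isEdgeListing_odd G).src_lt
  unfold reducedSize
  generalize n + (leaves G).length = h at *
  let I : ℕ → RamState → Prop := fun t τ => Coloured G c (h + t * (t + 1)) τ ∧
    τ.reg 7 = t ∧ τ.reg 15 = 2 * t + 2 ∧ τ.reg 8 = (oddList G).length - t
  let J : ℕ → ℕ → RamState → Prop := fun t i τ => Coloured G c (h + t * (t + 1) + i) τ ∧
    τ.reg 7 = t ∧ τ.reg 15 = 2 * t + 2 ∧ τ.reg 8 = (oddList G).length - t ∧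
    τ.reg 9 = 2 * t + 2 - i ∧ τ.reg 11 = (c (pathPos h (oddSrc G) (oddTgt G) t i)).toNat
  obtain ⟨e1, e2, e3, e4, e5, e6⟩ := hσ
  refine ((haltsWithin_block ?_).seq fun τ hτ => haltsWithin_loop (N := (oddList G).length)
    (b := 12 * (oddList G).length + 10) I hτ ?_ ?_).mono ?_ ?_
  · refine ⟨⟨?_, ?_, ?_, ?_, ?_, ?_⟩, ?_, ?_, ?_⟩ <;>
      simp [execAll, Instr.exec, e1, e2, e3, e5]
    · exact e4
    · exact e6
  · rintro i hi τ ⟨-, -, -, h⟩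
    omega
  · rintro t ht τ ⟨⟨e1, e2, e3, e4, e5, e6⟩, e7, e8, e9⟩
    refine HaltsWithin.mono ((haltsWithin_block ?_).seq fun τ hτ =>
      (haltsWithin_loop (N := 2 * t + 2) (b := 5) (J t) hτ ?_ ?_).seq
      fun τ hτ => haltsWithin_block (Q := I (t + 1)) ?_) ?_ fun _ h => h
    · have e10 := e4 t ht
      have e11 := e6 _ ((hsrc t ht).trans_le (Nat.le_add_right h _))
      refine ⟨⟨?_, ?_, ?_, ?_, ?_, ?_⟩, ?_, ?_, ?_, ?_, ?_⟩ <;>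
        simp [execAll, Instr.exec, e1, e2, e3, e5, e7, e8, e9, e10, e11, pathPos]
      · exact e4
      · exact e6
    · rintro i hi τ ⟨-, -, -, -, h, -⟩
      omega
    · rintro i hi τ ⟨⟨e1, e2, e3, e4, e5, e6⟩, e7, e8, e9, e10, e11⟩
      have e12 := update_colour (c := c) e6
      have e13 := halt t ht i hi
      rw [← hp t i hi, e13, ← one_sub_toNat, hp t i hi] at e12
      refine haltsWithin_block ⟨⟨?_, ?_, ?_, ?_, ?_, ?_⟩, ?_, ?_, ?_, ?_, ?_⟩
      case refine_6 =>
        simpa [execAll, Instr.exec, e1, e5, e11, add_assoc] using e12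
      case refine_11 =>
        rw [e13, ← one_sub_toNat]
        simp [execAll, Instr.exec, e1, e11]
      all_goals
        simp [execAll, Instr.exec, e1, e2, e3, e5, e7, e8, e9, e10]
      · exact e4
      · omega
      · omega
    · obtain ⟨⟨e1, e2, e3, e4, e5, e6⟩, e7, e8, e9, e10, e11⟩ := hτ
      have hr : h + t * (t + 1) + (2 * t + 2) = h + (t + 1) * (t + 1 + 1) := by ring
      rw [hr] at e5 e6
      refine ⟨⟨?_, ?_, ?_, ?_, ?_, ?_⟩, ?_, ?_, ?_⟩ <;>
        simp [execAll, Instr.exec, e1, e2, e3, e5, e7, e8, e9]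
      · exact e4
      · exact e6
      · omega
      · omega
    · simp only [List.length_cons, List.length_nil]; omega
  · simp only [List.length_cons, List.length_nil]
    generalize (oddList G).length = K
    have : K * (12 * K + 10 + 1) = K * (12 * K + 11) := rfl
    omega
  · rintro τ ⟨h, -⟩
    exact h

/-- The program that extends cuts. -/
def forward : Program :=
  .seq listOddGraph (.seq copyCut (.seq colourLeaves (.seq colourPaths (block [.add 0 6 19]))))

theorem inputState_cut {m : ℕ} (C : Fin m → Bool) {x : ℕ} (hx : x < m) :
    (inputState (encodeGraph G ++ encodeCut C)).arr 0 (n + 1 + n * n + x) =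
      (C ⟨x, hx⟩).toNat := by
  have := getD_encodeGraph_append G (encodeCut C) x
  rw [getD_encodeCut hx] at this
  simp only [inputState, this]
  simp

theorem outputsWithin_forward (C : Fin n → Bool) {c : ℕ → Bool} (hc : IsAlternating G c)
    (hC : ∀ x : Fin n, c x = C x) :
    OutputsWithin forward (encodeGraph G ++ encodeCut C)
      (encodeCut fun x : Fin (reducedSize G) => c x) (1000 * (n + 1 + n * n) ^ 2) := by
  have hin := isInput_inputState G (encodeCut C)
  obtain ⟨τ, s, hs, hrun, hτ⟩ := (haltsWithin_listOddGraph G hin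
    (inputState (encodeGraph G ++ encodeCut C)) rfl (by funext i; simp [inputState])).seq
    fun τ hτ => ((haltsWithin_copyCut τ hτ.base hτ.pos).mono le_rfl
      (Q' := fun τ => Coloured G c n τ ∧ τ.reg 13 = (edgeList G).length)
      fun τ' ⟨h1, h2, h3, h4, h5, h6, h7, h8⟩ => ⟨⟨h1.one, h1.zero, h2.trans hτ.length,
        fun t ht => h5 ▸ hτ.src t ht, h7, fun y hy => by
          rw [h8 y hy, inputState_cut G C hy, ← hC]⟩, h4.trans hτ.edges⟩).seq
    fun τ hτ => (haltsWithin_colourLeaves G hc τ hτ.1 hτ.2).seq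
    fun τ hτ => (haltsWithin_colourPaths G hc τ hτ).seq
    fun τ hτ => haltsWithin_block (l := [.add 0 6 19])
      (Q := fun τ => τ.reg 0 = reducedSize G ∧ ∀ y < reducedSize G, τ.arr 1 y = (c y).toNat)
      ⟨by simp [execAll, Instr.exec, hτ.zero, hτ.next], hτ.colour⟩
  refine ⟨τ, s, hs.trans ?_, hrun, showsOutput_encodeCut hτ.1 hτ.2⟩
  have h1 := length_edgeList_le G
  have h2 := length_oddList G
  have h3 := length_leaves G
  generalize (oddList G).length = K at *
  generalize (leaves G).length = l at *
  generalize (edgeList G).length = e at *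
  set S := n + 1 + n * n with hS
  have hK : K ≤ 3 * S := by omega
  have hKK : K * K ≤ 3 * S * (3 * S) := Nat.mul_le_mul hK hK
  have hSS : S ≤ S ^ 2 := Nat.le_self_pow two_ne_zero S
  have e1 : K * (12 * K + 11) = 12 * (K * K) + 11 * K := by ring
  have e2 : 3 * S * (3 * S) = 9 * S ^ 2 := by ring
  simp only [List.length_cons, List.length_nil]
  omega

/-- Skipping the adjacency matrix. -/
def skipMatrix : Program :=
  .seq (block [.add 5 2 1, .add 8 2 19]) (.loop 8 (block [.add 5 5 2, .sub 8 8 1]))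

theorem haltsWithin_skipMatrix {inp : ℕ → ℕ} (σ : RamState) (hσ : Base n inp σ) :
    HaltsWithin skipMatrix σ (n * 4 + 4) fun τ => Base n inp τ ∧ τ.reg 5 = n + 1 + n * n := by
  let I : ℕ → RamState → Prop := fun i τ => Base n inp τ ∧ τ.reg 5 = n + 1 + i * n ∧
    τ.reg 8 = n - i
  obtain ⟨e1, e2, e3, e4⟩ := hσ
  refine ((haltsWithin_block ?_).seq fun τ hτ =>
    haltsWithin_loop (N := n) (b := 3) I hτ ?_ ?_).mono ?_ ?_
  · refine ⟨⟨?_, ?_, ?_, ?_⟩, ?_, ?_⟩ <;> simp [execAll, Instr.exec, e1, e2, e3, e4]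
  · rintro i hi τ ⟨-, -, h⟩
    omega
  · rintro i hi τ ⟨⟨e1, e2, e3, e4⟩, e5, e6⟩
    refine haltsWithin_block ⟨⟨?_, ?_, ?_, ?_⟩, ?_, ?_⟩ <;>
      simp [execAll, Instr.exec, e1, e2, e3, e4, e5, e6]
    · ring
    · omega
  · simp only [List.length_cons, List.length_nil]; omega
  · rintro τ ⟨h1, h2, -⟩
    exact ⟨h1, h2⟩

/-- The program that restricts cuts. -/
def backward : Program :=
  .seq parse (.seq skipMatrix (.seq copyCut (block [.add 0 2 19])))

/-- Only the end of the adjacency matrix has to be found; of the cut that follows, the first `n`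
bits are read. -/
theorem outputsWithin_backward (C : Fin (reducedSize G) → Bool) :
    OutputsWithin backward (encodeGraph G ++ encodeCut C) (encodeCut (restrictCut G C))
      (1000 * (n + 1 + n * n) ^ 2) := by
  have hin := isInput_inputState G (encodeCut C)
  obtain ⟨τ, s, hs, hrun, hτ⟩ := (haltsWithin_parse hin.size hin.sep
    (inputState (encodeGraph G ++ encodeCut C)) rfl (by funext i; simp [inputState])).seq
    fun τ hτ => (haltsWithin_skipMatrix τ hτ.1).seq
    fun τ hτ => (haltsWithin_copyCut τ hτ.1 hτ.2).seq
    fun τ ⟨h1, _, _, _, _, _, _, h8⟩ => haltsWithin_block (l := [.add 0 2 19])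
      (Q := fun τ => τ.reg 0 = n ∧ ∀ y (hy : y < n), τ.arr 1 y = (restrictCut G C ⟨y, hy⟩).toNat)
      ⟨by simp [execAll, Instr.exec, h1.zero, h1.size], fun y hy =>
        (h8 y hy).trans (inputState_cut G C (hy.trans_le (le_reducedSize G)))⟩
  refine ⟨τ, s, hs.trans ?_, hrun, showsOutput_encodeCut hτ.1 hτ.2⟩
  set S := n + 1 + n * n with hS
  have hSS : S ≤ S ^ 2 := Nat.le_self_pow two_ne_zero S
  simp only [List.length_cons, List.length_nil]
  omega

theorem exists_extension (C : Fin n → Bool) :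
    ∃ c : ℕ → Bool, IsAlternating G c ∧ ∀ x : Fin n, c x = C x := by
  obtain ⟨c, hc, hC⟩ := exists_isAlternating G fun x => if hx : x < n then C ⟨x, hx⟩ else false
  exact ⟨c, hc, fun x => by rw [hC x x.2, dif_pos x.2]⟩

theorem cutSize_extension {C : Fin n → Bool} {c : ℕ → Bool} (hc : IsAlternating G c)
    (hC : ∀ x : Fin n, c x = C x) :
    cutSize (reducedGraph G) (fun x => c x) = cutSize G C +
      ((oddList G).length * ((oddList G).length + 1) + (leaves G).length) := by
  rw [cutSize_of_isAlternating G hc, show (fun x : Fin n => c x) = C from funext hC]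

theorem maxCut_reducedGraph : maxCut (reducedGraph G) = maxCut G +
      ((oddList G).length * ((oddList G).length + 1) + (leaves G).length) ∧
    ∀ C', IsOptimalCut (reducedGraph G) C' → IsOptimalCut G (restrictCut G C') :=
  optimalCut_correspondence _ (restrictCut G) (cutSize_reducedGraph_le G) fun C =>
    let ⟨_, hc, hC⟩ := exists_extension G C
    ⟨_, cutSize_extension G hc hC⟩

end Colouring

end DLAMaxCut

/-! ### The main theorem -/

theorem mainTheorem5 :
    ∃ (reduction forward backward : DLAMaxCut.Program) (T : Polynomial ℕ) (c : ℕ),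
      ∀ (n : ℕ) (G : SimpleGraph (Fin n)), G.Connected →
        ∃ (m : ℕ) (G' : SimpleGraph (Fin m)),
          -- the graph `G'` is computed from `G` in polynomial time
          DLAMaxCut.OutputsWithin reduction (DLAMaxCut.encodeGraph G) (DLAMaxCut.encodeGraph G')
            (T.eval (DLAMaxCut.encodeGraph G).length) ∧
          DLAMaxCut.IsAsymmetricallySubdividedOddGraph G' ∧
          m ≤ c * max 1 (G.edgeSet.ncard ^ 2) ∧
          G'.edgeSet.ncard ≤ c * max 1 (G.edgeSet.ncard ^ 2) ∧
          (DLAMaxCut.maxCut G' : ℤ) - (DLAMaxCut.maxCut G : ℤ) = (m : ℤ) - (n : ℤ) ∧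
          -- optimal cuts of `G` are transformed into optimal cuts of `G'` in polynomial time
          (∀ C : Fin n → Bool, DLAMaxCut.IsOptimalCut G C →
            ∃ C' : Fin m → Bool, DLAMaxCut.IsOptimalCut G' C' ∧
              DLAMaxCut.OutputsWithin forward
                (DLAMaxCut.encodeGraph G ++ DLAMaxCut.encodeCut C) (DLAMaxCut.encodeCut C')
                (T.eval (DLAMaxCut.encodeGraph G ++ DLAMaxCut.encodeCut C).length)) ∧
          -- and conversely
          (∀ C' : Fin m → Bool, DLAMaxCut.IsOptimalCut G' C' →
            ∃ C : Fin n → Bool, DLAMaxCut.IsOptimalCut G C ∧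
              DLAMaxCut.OutputsWithin backward
                (DLAMaxCut.encodeGraph G ++ DLAMaxCut.encodeCut C') (DLAMaxCut.encodeCut C)
                (T.eval (DLAMaxCut.encodeGraph G ++ DLAMaxCut.encodeCut C').length)) ∧
          DLAMaxCut.IsFreeDLA G' := by
  open DLAMaxCut in
  refine ⟨reduction, forward, backward, Polynomial.C 1000 * Polynomial.X ^ 2, 100, ?_⟩
  intro n G hG
  -- All running times are bounded in the length of the encoded graph alone; an appended cut only
  -- increases the allowance.
  have heval : ∀ (r : List Bool), 1000 * (n + 1 + n * n) ^ 2 ≤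
      (Polynomial.C 1000 * Polynomial.X ^ 2 : Polynomial ℕ).eval (encodeGraph G ++ r).length := by
    intro r
    rw [Polynomial.eval_mul, Polynomial.eval_C, Polynomial.eval_pow, Polynomial.eval_X,
      List.length_append, length_encodeGraph]
    exact Nat.mul_le_mul_left _ (Nat.pow_le_pow_left (Nat.le_add_right _ _) 2)
  have hmono : ∀ {p x y t t'}, OutputsWithin p x y t → t ≤ t' → OutputsWithin p x y t' :=
    fun ⟨τ, s, hs, h⟩ ht => ⟨τ, s, hs.trans ht, h⟩
  obtain ⟨hmax, hback⟩ := maxCut_reducedGraph G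
  refine ⟨reducedSize G, reducedGraph G, ?_,
    isAsymmetricallySubdividedOddGraph_reducedGraph G hG, (reducedSize_le G hG).1,
    (reducedSize_le G hG).2, ?_, fun C hC => ?_, fun C' hC' => ?_, isFreeDLA_reducedGraph G⟩
  · have := heval []
    rw [List.append_nil] at this
    exact hmono (outputsWithin_reduction G) this
  · have := reducedSize_sub G
    omega
  · obtain ⟨c, hc, hcC⟩ := exists_extension G C
    refine ⟨_, ?_, hmono (outputsWithin_forward G C hc hcC) (heval _)⟩
    rw [IsOptimalCut] at hC ⊢
    rw [cutSize_extension G hc hcC, hC, hmax]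
  · exact ⟨restrictCut G C', hback C' hC', hmono (outputsWithin_backward G C') (heval _)⟩
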